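/- Let $U\subset\mathbb R^3$ be an open neighbourhood of $0$ and let $g=(g_{ij})$ be a real-analytic Riemannian metric on $U$. Regard $\mathbb R^3\subset\mathbb C^3$ as the real part, with $z_k=x_k+iy_k$, and let $J$ denote multiplication by $i$. Then there is a standard complexification $U_{\mathbb C}$ of $U$, that is, an open set $U_{\mathbb C}\subset\mathbb C^3$ with $U\subset U_{\mathbb C}$ and $\operatorname{Re}(U_{\mathbb C})=U$, and a holomorphic $3$-form $\Omega$ on $U_{\mathbb C}$ such that the following hold. (a) There is at least one Kähler form $\omega$ on $U_{\mathbb C}$ (a smooth closed real $(1,1)$-form for which $\omega(\cdot,J\cdot)$ is a Riemannian metric) such that 1. $\dfrac{\omega^3}{3!}=-\left(\dfrac i2\right)^3\,\Omega\wedge\overline\Omega$ on $U_{\mathbb C}$; 2. the metric $\omega(\cdot,J\cdot)$ induces $g$ on $U$; 3. $\Omega|_U=\operatorname{Vol}_U=\sqrt{\det(g_{ij})}\,dx_1\wedge dx_2\wedge dx_3$. Moreover $(U_{\mathbb C},\Omega,\omega)$ is a Calabi–Yau manifold ($\Omega$ is nowhere vanishing and $\omega$ is a Kähler form with $\omega^3=c\,\Omega\wedge\overline\Omega$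 for a constant $c$), and the inclusion $U\hookrightarrow U_{\mathbb C}$ is an isometric embedding of $(U,g)$ as a special Lagrangian submanifold: $\operatorname{Re}\Omega|_U=\operatorname{Vol}_U$, $\operatorname{Im}\Omega|_U=0$ and $\omega|_U=0$. (b) $\Omega$ is unique: if $\Omega'$ is a holomorphic $3$-form on $U_{\mathbb C}$ and there is a Kähler form $\omega'$ on $U_{\mathbb C}$ such that $(\Omega',\omega')$ satisfies 1–3, then $\Omega'=\Omega$ on $U_{\mathbb C}$. (c) $\Omega=\Gamma(z)\,dz_1\wedge dz_2\wedge dz_3$, where $\Gamma$ is holomorphic on $U_{\mathbb C}$ and $\Gamma(x)=\sqrt{\det(g_{ij}(x))}$ for $x\in U$. -/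

import Mathlib

noncomputable section

namespace LocalSLag

/-- Real coordinate space, with coordinates `x₁, x₂, x₃`. -/
abbrev R3 : Type := Fin 3 → ℝ

/-- Complex coordinate space, with coordinates `z_k = x_k + i y_k`; it is also used as a real
vector space, whose complex structure `J` is multiplication by `Complex.I`. -/
abbrev C3 : Type := Fin 3 → ℂ

/-- The standard inclusion `x ↦ x + i0` of the real coordinate space into the complex one. -/
def incl : R3 →L[ℝ] C3 :=
  ContinuousLinearMap.pi fun i => Complex.ofRealCLM.comp (ContinuousLinearMap.proj i)

/-- The real part `x + iy ↦ x`. -/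
def rePart (z : C3) : R3 := fun i => (z i).re

/-- `UC` is a standard complexification of `U`: an open neighbourhood of `U` in `ℂ³` whose real
part is `U`. -/
structure IsStandardComplexification (U : Set R3) (UC : Set C3) : Prop where
  isOpen : IsOpen UC
  incl_mem : ∀ x ∈ U, incl x ∈ UC
  re_image : rePart '' UC = U

/-- The matrix field `g = (g_ij)` is a real-analytic Riemannian metric on `U`. (Positive
definiteness of a real matrix includes its symmetry.) -/
structure IsAnalyticMetric (U : Set R3) (g : R3 → Matrix (Fin 3) (Fin 3) ℝ) : Prop where
  posDef : ∀ x ∈ U, (g x).PosDef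
  analytic : ∀ i j, AnalyticOnNhd ℝ (fun x => g x i j) U

/-- `g_x(u, v) = ∑ g_ij(x) u_i v_j`. -/
def metricVal (g : R3 → Matrix (Fin 3) (Fin 3) ℝ) (x : R3) (u v : R3) : ℝ :=
  ∑ i, ∑ j, g x i j * u i * v j

/-- The Riemannian volume form `√(det g) dx₁ ∧ dx₂ ∧ dx₃` of `g` at `x`. -/
def volForm (g : R3 → Matrix (Fin 3) (Fin 3) ℝ) (x : R3) : R3 [⋀^Fin 3]→ₗ[ℝ] ℝ :=
  Real.sqrt (g x).det • Matrix.detRowAlternating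

/-- The holomorphic volume form `dz₁ ∧ dz₂ ∧ dz₃` at any point. -/
def dz123 : C3 [⋀^Fin 3]→ₗ[ℂ] ℂ := Matrix.detRowAlternating

/-- The exterior product of complex-valued real-multilinear alternating forms (the sum over
shuffles, without further normalising factor). -/
def wedge {p q : ℕ} (α : C3 [⋀^Fin p]→ₗ[ℝ] ℂ) (β : C3 [⋀^Fin q]→ₗ[ℝ] ℂ) :
    C3 [⋀^Fin (p + q)]→ₗ[ℝ] ℂ :=
  ((LinearMap.mul' ℝ ℂ).compAlternatingMap (α.domCoprod β)).domDomCongr finSumFinEquiv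

/-- A real 2-form at a point, regarded as a complex-valued form. -/
def complexify (ω : C3 [⋀^Fin 2]→L[ℝ] ℝ) : C3 [⋀^Fin 2]→ₗ[ℝ] ℂ :=
  Complex.ofRealCLM.toLinearMap.compAlternatingMap ω.toAlternatingMap

/-- A `(3,0)`-form at a point, regarded as a real-multilinear form. -/
def realify (Ω : C3 [⋀^Fin 3]→L[ℂ] ℂ) : C3 [⋀^Fin 3]→ₗ[ℝ] ℂ :=
  (Ω.restrictScalars ℝ).toAlternatingMap

/-- The complex conjugate form. -/
def conjForm {p : ℕ} (α : C3 [⋀^Fin p]→ₗ[ℝ] ℂ) : C3 [⋀^Fin p]→ₗ[ℝ] ℂ :=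
  Complex.conjAe.toLinearMap.compAlternatingMap α

/-- The 6-form `ω³ = ω ∧ ω ∧ ω` at a point. -/
def cube (ω : C3 [⋀^Fin 2]→L[ℝ] ℝ) : C3 [⋀^Fin 6]→ₗ[ℝ] ℂ :=
  wedge (wedge (complexify ω) (complexify ω)) (complexify ω)

/-- The 6-form `Ω ∧ Ω̄` at a point. -/
def wedgeConj (Ω : C3 [⋀^Fin 3]→L[ℂ] ℂ) : C3 [⋀^Fin 6]→ₗ[ℝ] ℂ :=
  wedge (realify Ω) (conjForm (realify Ω))

/-- `Ω` is a holomorphic 3-form on the open set `W` (complex multilinearity of `Ω z` says that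
it is of type `(3,0)`). -/
def IsHolomorphicForm (W : Set C3) (Ω : C3 → C3 [⋀^Fin 3]→L[ℂ] ℂ) : Prop :=
  DifferentiableOn ℂ Ω W

/-- `ω` is a Kähler form on the open set `W`: a smooth closed real 2-form of type `(1,1)` which
is positive, i.e. `(u, v) ↦ ω(u, Jv)` is a Riemannian metric. -/
structure IsKahlerForm (W : Set C3) (ω : C3 → C3 [⋀^Fin 2]→L[ℝ] ℝ) : Prop where
  smooth : ContDiffOn ℝ ((⊤ : ℕ∞) : WithTop ℕ∞) ω W
  closed : ∀ z ∈ W, extDeriv ω z = 0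
  type_one_one : ∀ z ∈ W, ∀ u v : C3, ω z ![Complex.I • u, Complex.I • v] = ω z ![u, v]
  positive : ∀ z ∈ W, ∀ u : C3, u ≠ 0 → 0 < ω z ![u, Complex.I • u]

/-- The Riemannian metric `(u, v) ↦ ω(u, Jv)` of a Kähler form. -/
def kahlerMetric (ω : C3 → C3 [⋀^Fin 2]→L[ℝ] ℝ) (z : C3) (u v : C3) : ℝ :=
  ω z ![u, Complex.I • v]

/-- `(W, Ω, ω)` is a Calabi–Yau manifold: `Ω` is a nowhere vanishing holomorphic volume form and
`ω` a Kähler form with `ω³ = c Ω ∧ Ω̄` for some constant `c`. -/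
structure IsCalabiYau (W : Set C3) (Ω : C3 → C3 [⋀^Fin 3]→L[ℂ] ℂ)
    (ω : C3 → C3 [⋀^Fin 2]→L[ℝ] ℝ) : Prop where
  isOpen : IsOpen W
  holomorphic : IsHolomorphicForm W Ω
  ne_zero : ∀ z ∈ W, Ω z ≠ 0
  kahler : IsKahlerForm W ω
  volume : ∃ c : ℂ, ∀ z ∈ W, cube (ω z) = c • wedgeConj (Ω z)

/-- `f` embeds the Riemannian manifold `(U, g)` isometrically into `(W, Ω, ω)` as a special
Lagrangian submanifold: `f` is a smooth embedding with `f^*⟨·,·⟩ = g` and `f^* Re Ω = Vol_g`;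
the equivalent conditions `f^* Im Ω = 0` and `f^* ω = 0` are recorded as well. -/
structure IsSLagEmbedding (U : Set R3) (g : R3 → Matrix (Fin 3) (Fin 3) ℝ) (W : Set C3)
    (Ω : C3 → C3 [⋀^Fin 3]→L[ℂ] ℂ) (ω : C3 → C3 [⋀^Fin 2]→L[ℝ] ℝ) (f : R3 → C3) : Prop where
  mapsTo : Set.MapsTo f U W
  smooth : ContDiffOn ℝ ((⊤ : ℕ∞) : WithTop ℕ∞) f U
  immersion : ∀ x ∈ U, Function.Injective (fderiv ℝ f x)
  embedding : Topology.IsEmbedding (U.domRestrict f)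
  isometric : ∀ x ∈ U, ∀ u v : R3,
    kahlerMetric ω (f x) (fderiv ℝ f x u) (fderiv ℝ f x v) = metricVal g x u v
  calibrated : ∀ x ∈ U, ∀ v : Fin 3 → R3,
    (Ω (f x) fun i => fderiv ℝ f x (v i)).re = volForm g x v
  im_zero : ∀ x ∈ U, ∀ v : Fin 3 → R3, (Ω (f x) fun i => fderiv ℝ f x (v i)).im = 0
  lagrangian : ∀ x ∈ U, ∀ u v : R3, ω (f x) ![fderiv ℝ f x u, fderiv ℝ f x v] = 0

/-- The three conditions on a holomorphic 3-form `Ω` and a Kähler form `ω` on `UC`. -/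
structure Solves (U : Set R3) (g : R3 → Matrix (Fin 3) (Fin 3) ℝ) (UC : Set C3)
    (Ω : C3 → C3 [⋀^Fin 3]→L[ℂ] ℂ) (ω : C3 → C3 [⋀^Fin 2]→L[ℝ] ℝ) : Prop where
  holomorphic : IsHolomorphicForm UC Ω
  kahler : IsKahlerForm UC ω
  /-- `ω³ / 3! = -(i/2)³ Ω ∧ Ω̄`. -/
  volume : ∀ z ∈ UC,
    ((1 : ℂ) / (Nat.factorial 3 : ℂ)) • cube (ω z) = (-((Complex.I / 2) ^ 3)) • wedgeConj (Ω z)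
  /-- The induced metric on `U` is `g`. -/
  induced : ∀ x ∈ U, ∀ u v : R3,
    kahlerMetric ω (incl x) (incl u) (incl v) = metricVal g x u v
  /-- `Ω|_U = Vol_U`. -/
  restrict : ∀ x ∈ U, ∀ v : Fin 3 → R3,
    Ω (incl x) (fun i => incl (v i)) = ((volForm g x v : ℝ) : ℂ)

end LocalSLag

end

/-! The Kähler form is sought as `ω = d(-df ∘ J)` with a real-analytic potential `f`. Such a form is
closed and of type (1,1), and its Hermitian matrix is the complex Hessian of `f`. If `Γ` is the
holomorphic extension of `√det g` and `Ω = Γ dz₁ ∧ dz₂ ∧ dz₃`, the volume condition becomes the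
Monge–Ampère equation `det Hess f = |Γ|²`.

Put `f = f₀ + y₃² k` with `f₀ = ½ ∑ g_jk(x) y_j y_k`. At a real point the complex Hessian of `f₀` is
`g`, so `f₀` satisfies the equation there. The coefficient of `∂²f/∂y₃²` is the upper left minor of
the Hessian, which is nonzero because `g` is positive definite. So `y₃ = 0` is noncharacteristic,
and a germ `k` exists and is unique at every real point (`CauchyData.exists_isLocalSolution`,
`IsLocalSolution.eventuallyEq`). Since `f₀` satisfies the equation at the real point itself, the
complex Hessian of `f` there is still `g` (`IsLocalSolution.hessFun_eq`). This yields the induced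
metric, the Lagrangian condition and, by continuity, positivity nearby.

The Cauchy–Kovalevskaya theorem is proved with formal power series. The unknown is `w = ∂ₜ²(t² k)`,
where `t = y₃`. All other second derivatives of `t² k` are obtained from `w` by the operators `∂ₐ ∫
dt` with `a ≠ t`, and the equation reads `w = A(s₀ + Lw) + w B(s₀ + Lw)` with polynomials `A`, `B`
without constant term. The right side is a contraction for the degree in which `t` has weight two,
so the formal solution exists and is unique. For convergence, the weights `ρ^|m| ε^(m t) / choose
|m| (m t)` give a submultiplicative `ℓ¹` norm in which `∂ₐ ∫ dt` has norm at most `ε`. For small `ρ`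
and `ε` the iterates stay in the unit ball (`exists_converges_cauchyMap_fixed`).

The local data are glued on balls with real centres. These are convex and stable under taking real
parts, so any two that overlap do so in a connected set containing a real point, where the germs
agree (`exists_glue`). A holomorphic function on such a ball is determined by its values at real
points (`eqOn_ball_of_eqOn_real`). This makes `Γ` well defined and `Ω` unique. -/

noncomputable section

namespace LocalSLag

open Filter Topology Finset MvPowerSeries
open scoped NNReal ENNReal

/-! ### Convergent power series in several variables and the germs that they represent -/

section PowerSeries

variable {σ : Type*} [Fintype σ] {𝕜 : Type*} [RCLike 𝕜]

/-- The value at `v` of the monomial with exponent `m`. -/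
def monomialEval (m : σ →₀ ℕ) (v : σ → 𝕜) : 𝕜 := ∏ i, v i ^ m i

theorem monomialEval_add (m n : σ →₀ ℕ) (v : σ → 𝕜) :
    monomialEval (m + n) v = monomialEval m v * monomialEval n v := by
  simp [monomialEval, pow_add, Finset.prod_mul_distrib]

theorem norm_monomialEval_le (m : σ →₀ ℕ) {v : σ → 𝕜} {r : ℝ} (hv : ∀ i, ‖v i‖ ≤ r) :
    ‖monomialEval m v‖ ≤ r ^ m.degree := by
  rw [monomialEval, norm_prod, Finsupp.degree_eq_sum, ← Finset.prod_pow_eq_pow_sum]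
  exact Finset.prod_le_prod (fun _ _ => norm_nonneg _) fun i _ => by
    rw [norm_pow]; exact pow_le_pow_left₀ (norm_nonneg _) (hv i) _

theorem monomialEval_zero_left (v : σ → 𝕜) : monomialEval 0 v = 1 := by simp [monomialEval]

theorem monomialEval_zero_right {m : σ →₀ ℕ} (hm : m ≠ 0) :
    monomialEval m (0 : σ → 𝕜) = 0 := by
  obtain ⟨i, hi⟩ := Finsupp.ne_iff.1 hm
  exact Finset.prod_eq_zero (Finset.mem_univ i) (by simpa using hi)

/-- The power series converges absolutely on some polydisc. -/
def Converges (u : MvPowerSeries σ 𝕜) : Prop :=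
  ∃ r : ℝ, 0 < r ∧ Summable fun m => ‖coeff m u‖ * r ^ m.degree

theorem summable_eval {u : MvPowerSeries σ 𝕜} {r : ℝ}
    (h : Summable fun m => ‖coeff m u‖ * r ^ m.degree) {v : σ → 𝕜} (hv : ∀ i, ‖v i‖ ≤ r) :
    Summable fun m => ‖coeff m u * monomialEval m v‖ := by
  refine Summable.of_nonneg_of_le (fun _ => norm_nonneg _) (fun m => ?_) h
  rw [norm_mul]
  exact mul_le_mul_of_nonneg_left (norm_monomialEval_le m hv) (norm_nonneg _)

theorem eventually_norm_le {r : ℝ} (hr : 0 < r) : ∀ᶠ v in 𝓝 (0 : σ → 𝕜), ∀ i, ‖v i‖ ≤ r := by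
  filter_upwards [Metric.ball_mem_nhds (0 : σ → 𝕜) hr] with v hv i
  exact (norm_le_pi_norm v i).trans (by simpa using (mem_ball_zero_iff.1 hv).le)

theorem Converges.eventually_summable {u : MvPowerSeries σ 𝕜} (h : Converges u) :
    ∀ᶠ v in 𝓝 (0 : σ → 𝕜), Summable fun m => ‖coeff m u * monomialEval m v‖ := by
  obtain ⟨r, hr, hs⟩ := h
  filter_upwards [eventually_norm_le hr] with v hv using summable_eval hs hv

omit [Fintype σ] in
theorem summable_mono {u : MvPowerSeries σ 𝕜} {r s : ℝ} (hs : 0 ≤ s) (hsr : s ≤ r)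
    (h : Summable fun m => ‖coeff m u‖ * r ^ m.degree) :
    Summable fun m => ‖coeff m u‖ * s ^ m.degree :=
  Summable.of_nonneg_of_le (fun _ => by positivity)
    (fun _ => mul_le_mul_of_nonneg_left (pow_le_pow_left₀ hs hsr _) (norm_nonneg _)) h

variable {E : Type*} [NormedAddCommGroup E] [NormedSpace 𝕜 E]
  (b : Module.Basis σ 𝕜 E)

/-- Near `q`, in the coordinates of the basis `b` centred at `q`, the function `f` is the sum of
the convergent power series `u`. -/
structure HasExpansion (u : MvPowerSeries σ 𝕜) (f : E → 𝕜) (q : E) : Prop where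
  converges : Converges u
  hasSum : ∀ᶠ v in 𝓝 (0 : σ → 𝕜),
    HasSum (fun m => coeff m u * monomialEval m v) (f (q + b.equivFun.symm v))

variable {b} {u u' : MvPowerSeries σ 𝕜} {f f' : E → 𝕜} {q : E}

theorem tendsto_coord : Tendsto (fun v => q + b.equivFun.symm v) (𝓝 (0 : σ → 𝕜)) (𝓝 q) := by
  have : Continuous fun v => q + b.equivFun.symm v :=
    continuous_const.add (LinearMap.continuous_of_finiteDimensional b.equivFun.symm.toLinearMap)
  simpa using this.tendsto 0

theorem HasExpansion.congr (h : HasExpansion b u f q) (hf : f =ᶠ[𝓝 q] f') :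
    HasExpansion b u f' q := by
  refine ⟨h.converges, ?_⟩
  filter_upwards [h.hasSum, tendsto_coord.eventually hf] with v h1 h2
  rwa [← h2]

omit [Fintype σ] in
theorem Converges.add (h : Converges u) (h' : Converges u') : Converges (u + u') := by
  obtain ⟨r, hr, hs⟩ := h
  obtain ⟨r', hr', hs'⟩ := h'
  refine ⟨min r r', lt_min hr hr', ?_⟩
  refine Summable.of_nonneg_of_le (fun _ => by positivity) (fun m => ?_)
    ((summable_mono (lt_min hr hr').le (min_le_left _ _) hs).add
      (summable_mono (lt_min hr hr').le (min_le_right _ _) hs'))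
  rw [← add_mul, map_add]
  gcongr
  exact norm_add_le _ _

theorem HasExpansion.add (h : HasExpansion b u f q) (h' : HasExpansion b u' f' q) :
    HasExpansion b (u + u') (fun z => f z + f' z) q := by
  refine ⟨h.converges.add h'.converges, ?_⟩
  filter_upwards [h.hasSum, h'.hasSum] with v h1 h2
  simpa [add_mul] using h1.add h2

theorem hasExpansion_C (c : 𝕜) : HasExpansion b (C c) (fun _ => c) q := by
  classical
  refine ⟨⟨1, one_pos, ?_⟩, Eventually.of_forall fun v => ?_⟩
  · refine summable_of_ne_finset_zero (s := {0}) fun m hm => ?_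
    simp [coeff_C, Finset.notMem_singleton.1 hm]
  · have h := hasSum_single (f := fun m => coeff m (C c : MvPowerSeries σ 𝕜) * monomialEval m v) 0
      fun m hm => by simp [coeff_C, hm]
    simpa [monomialEval_zero_left] using h

omit [Fintype σ] in
theorem Converges.mul (h : Converges u) (h' : Converges u') : Converges (u * u') := by
  classical
  obtain ⟨r, hr, hs⟩ := h
  obtain ⟨r', hr', hs'⟩ := h'
  have hm := lt_min hr hr'
  refine ⟨min r r', hm, ?_⟩
  refine Summable.of_nonneg_of_le (fun _ => by positivity) (fun m => ?_)
    (summable_sum_mul_antidiagonal_of_summable_mul (Summable.mul_of_nonneg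
      (summable_mono hm.le (min_le_left _ _) hs) (summable_mono hm.le (min_le_right _ _) hs')
      (fun _ => by positivity) (fun _ => by positivity)))
  rw [coeff_mul]
  calc _ ≤ (∑ p ∈ antidiagonal m, ‖coeff p.1 u‖ * ‖coeff p.2 u'‖) * (min r r') ^ m.degree := by
        gcongr
        exact (norm_sum_le _ _).trans (Finset.sum_le_sum fun p _ => (norm_mul_le _ _))
    _ = _ := by
        rw [Finset.sum_mul]
        refine Finset.sum_congr rfl fun p hp => ?_
        rw [← mem_antidiagonal.1 hp, map_add, pow_add]
        ring

theorem hasSum_mul_antidiagonal {A : Type*} [AddCommMonoid A] [HasAntidiagonal A] {x y : A → 𝕜}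
    {X Y : 𝕜} (hx : HasSum x X) (hy : HasSum y Y) (hx' : Summable fun n => ‖x n‖)
    (hy' : Summable fun n => ‖y n‖) :
    HasSum (fun n => ∑ p ∈ antidiagonal n, x p.1 * y p.2) (X * Y) := by
  have h := summable_mul_of_summable_norm hx' hy'
  rw [← hx.tsum_eq, ← hy.tsum_eq,
    hx.summable.tsum_mul_tsum_eq_tsum_sum_antidiagonal hy.summable h]
  exact (summable_sum_mul_antidiagonal_of_summable_mul h).hasSum

theorem coeff_mul_mul_monomialEval [DecidableEq σ] (u u' : MvPowerSeries σ 𝕜) (m : σ →₀ ℕ)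
    (v : σ → 𝕜) : coeff m (u * u') * monomialEval m v = ∑ p ∈ antidiagonal m,
      (coeff p.1 u * monomialEval p.1 v) * (coeff p.2 u' * monomialEval p.2 v) := by
  rw [coeff_mul, Finset.sum_mul]
  refine Finset.sum_congr rfl fun p hp => ?_
  rw [← mem_antidiagonal.1 hp, monomialEval_add]
  ring

theorem HasExpansion.mul (h : HasExpansion b u f q) (h' : HasExpansion b u' f' q) :
    HasExpansion b (u * u') (fun z => f z * f' z) q := by
  classical
  have hc : Converges (u * u') := h.converges.mul h'.converges
  refine ⟨hc, ?_⟩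
  filter_upwards [h.hasSum, h'.hasSum, h.converges.eventually_summable,
    h'.converges.eventually_summable] with v h1 h2 h3 h4
  have h5 := hasSum_mul_antidiagonal h1 h2 h3 h4
  have h6 : (fun m => coeff m (u * u') * monomialEval m v) = _ :=
    funext fun m => coeff_mul_mul_monomialEval u u' m v
  rw [h6]
  exact h5

theorem HasExpansion.constantCoeff_eq (h : HasExpansion b u f q) :
    constantCoeff u = f q := by
  have h1 := h.hasSum.self_of_nhds
  have h2 : HasSum (fun m => coeff m u * monomialEval m (0 : σ → 𝕜))
      (coeff 0 u * monomialEval 0 (0 : σ → 𝕜)) :=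
    hasSum_single _ fun m hm => by simp [monomialEval_zero_right hm]
  simpa [monomialEval_zero_left] using h2.unique h1

theorem HasExpansion.sum {ι : Type*} (s : Finset ι) {u : ι → MvPowerSeries σ 𝕜}
    {f : ι → E → 𝕜} (h : ∀ i ∈ s, HasExpansion b (u i) (f i) q) :
    HasExpansion b (∑ i ∈ s, u i) (fun z => ∑ i ∈ s, f i z) q := by
  classical
  induction s using Finset.induction_on with
  | empty => simpa using hasExpansion_C (b := b) (q := q) (0 : 𝕜)
  | insert a s ha ih =>
    simp only [Finset.sum_insert ha]
    exact (h a (by simp)).add (ih fun i hi => h i (by simp [hi]))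

theorem HasExpansion.const_mul (c : 𝕜) (h : HasExpansion b u f q) :
    HasExpansion b (c • u) (fun z => c * f z) q := by
  rw [smul_eq_C_mul]
  exact (hasExpansion_C c).mul h

theorem HasExpansion.neg (h : HasExpansion b u f q) :
    HasExpansion b (-u) (fun z => -f z) q := by
  simpa using h.const_mul (-1)

theorem HasExpansion.sub (h : HasExpansion b u f q) (h' : HasExpansion b u' f' q) :
    HasExpansion b (u - u') (fun z => f z - f' z) q := by
  simpa [sub_eq_add_neg] using h.add h'.neg

/-- The sum of a power series, as a function on the space. -/
def sumFun (b : Module.Basis σ 𝕜 E) (u : MvPowerSeries σ 𝕜) (q z : E) : 𝕜 :=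
  ∑' m, coeff m u * monomialEval m (b.equivFun (z - q))

theorem Converges.hasExpansion (h : Converges u) : HasExpansion b u (sumFun b u q) q := by
  refine ⟨h, ?_⟩
  filter_upwards [h.eventually_summable] with v hv
  simpa only [sumFun, add_sub_cancel_left, LinearEquiv.apply_symm_apply] using
    hv.of_norm.hasSum

theorem HasExpansion.eventuallyEq (h : HasExpansion b u f q) (h' : HasExpansion b u f' q) :
    f =ᶠ[𝓝 q] f' := by
  have := Module.Basis.finiteDimensional_of_finite b
  have hc : Tendsto (fun z => b.equivFun (z - q)) (𝓝 q) (𝓝 0) := by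
    have : Continuous fun z => b.equivFun (z - q) :=
      (LinearMap.continuous_of_finiteDimensional b.equivFun.toLinearMap).comp
        (continuous_id.sub continuous_const)
    simpa using this.tendsto q
  filter_upwards [hc.eventually h.hasSum, hc.eventually h'.hasSum] with z h1 h2
  have := h1.unique h2
  rw [LinearEquiv.symm_apply_apply] at this
  simpa using this

end PowerSeries

/-! ### Analytic germs correspond to convergent power series -/

section Analytic

variable {σ : Type*} [Fintype σ] {𝕜 : Type*} [RCLike 𝕜]

/-- A word with the letters prescribed by the multi-index `m`. -/
def word (m : σ →₀ ℕ) : List σ := (Finsupp.toMultiset m).toList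

omit [Fintype σ] in
theorem length_word (m : σ →₀ ℕ) : (word m).length = m.degree := by
  rw [word, Multiset.length_toList, Finsupp.card_toMultiset, Finsupp.degree]
  rfl

theorem prod_word (m : σ →₀ ℕ) (v : σ → 𝕜) : ((word m).map v).prod = monomialEval m v := by
  classical
  rw [← Multiset.prod_coe, ← Multiset.map_coe, word, Multiset.coe_toList, Finsupp.toMultiset_map,
    Finsupp.prod_toMultiset, Finsupp.prod_mapDomain_index (by simp) (by intros; rw [pow_add]),
    Finsupp.prod_fintype _ _ (by simp), monomialEval]

/-- A multilinear form whose value on the diagonal is the monomial with exponent `m`, if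
`n` is the degree of `m`. -/
def monomialForm (𝕜 : Type*) [RCLike 𝕜] (n : ℕ) (m : σ →₀ ℕ) :
    ContinuousMultilinearMap 𝕜 (fun _ : Fin n => σ → 𝕜) 𝕜 :=
  (ContinuousMultilinearMap.mkPiAlgebra 𝕜 (Fin n) 𝕜).compContinuousLinearMap fun k =>
    if h : (k : ℕ) < (word m).length then ContinuousLinearMap.proj ((word m).get ⟨k, h⟩) else 0

theorem norm_monomialForm_le (n : ℕ) (m : σ →₀ ℕ) : ‖monomialForm 𝕜 n m‖ ≤ 1 := by
  refine ContinuousMultilinearMap.opNorm_le_bound zero_le_one fun v => ?_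
  rw [monomialForm, ContinuousMultilinearMap.compContinuousLinearMap_apply,
    ContinuousMultilinearMap.mkPiAlgebra_apply, norm_prod, one_mul]
  refine Finset.prod_le_prod (fun _ _ => norm_nonneg _) fun k _ => ?_
  split_ifs with h
  · exact norm_le_pi_norm (v k) _
  · simp

theorem monomialForm_apply_diag {n : ℕ} {m : σ →₀ ℕ} (h : m.degree = n) (v : σ → 𝕜) :
    monomialForm 𝕜 n m (fun _ => v) = monomialEval m v := by
  rw [← length_word] at h
  subst h
  rw [← prod_word, monomialForm, ContinuousMultilinearMap.compContinuousLinearMap_apply,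
    ContinuousMultilinearMap.mkPiAlgebra_apply, ← Fin.prod_univ_getElem]
  rw [← Fin.prod_congr' _ (List.length_map (as := word m) v).symm]
  refine Finset.prod_congr rfl fun k _ => ?_
  simp

/-- The exponents of degree `n`. -/
def exponentsOfDegree (σ : Type*) [Fintype σ] [DecidableEq σ] (n : ℕ) : Finset (σ →₀ ℕ) :=
  Finset.univ.finsuppAntidiag n

theorem mem_exponentsOfDegree [DecidableEq σ] {n : ℕ} {m : σ →₀ ℕ} :
    m ∈ exponentsOfDegree σ n ↔ m.degree = n := by
  simp [exponentsOfDegree, Finset.mem_finsuppAntidiag, Finsupp.degree_eq_sum]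

theorem hasSum_exponentsOfDegree [DecidableEq σ] {F : Type*} [NormedAddCommGroup F]
    [CompleteSpace F] {a : (σ →₀ ℕ) → F} {s : F} (h : HasSum a s) :
    HasSum (fun n => ∑ m ∈ exponentsOfDegree σ n, a m) s := by
  have h1 := (Equiv.sigmaFiberEquiv (fun m : σ →₀ ℕ => m.degree)).hasSum_iff.2 h
  refine h1.sigma fun n => ?_
  let _ : Fintype {m : σ →₀ ℕ // m.degree = n} :=
    Fintype.subtype (exponentsOfDegree σ n) fun _ => mem_exponentsOfDegree
  rw [Finset.sum_subtype (exponentsOfDegree σ n) (fun _ => mem_exponentsOfDegree) a]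
  exact hasSum_fintype _

/-- Grouping the monomials by total degree gives a formal multilinear series. Each `monomialForm`
has norm at most one, so the assumed summability bounds the radius from below. -/
theorem hasFPowerSeriesOnBall_of_summable [DecidableEq σ] {u : MvPowerSeries σ 𝕜} {r : ℝ}
    (hr : 0 < r) (h : Summable fun m => ‖coeff m u‖ * r ^ m.degree) :
    HasFPowerSeriesOnBall (fun v => ∑' m, coeff m u * monomialEval m v)
      (fun n => ∑ m ∈ exponentsOfDegree σ n, coeff m u • monomialForm 𝕜 n m) 0
      (ENNReal.ofReal r) where
  r_le := by
    have h1 : Summable fun n =>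
        ‖∑ m ∈ exponentsOfDegree σ n, coeff m u • monomialForm 𝕜 n m‖ * r ^ n := by
      refine Summable.of_nonneg_of_le (fun _ => by positivity) (fun n => ?_)
        (hasSum_exponentsOfDegree h.hasSum).summable
      calc _ ≤ (∑ m ∈ exponentsOfDegree σ n, ‖coeff m u‖) * r ^ n := by
            refine mul_le_mul_of_nonneg_right ?_ (by positivity)
            refine (norm_sum_le _ _).trans (Finset.sum_le_sum fun m _ => ?_)
            rw [norm_smul]
            exact mul_le_of_le_one_right (norm_nonneg _) (norm_monomialForm_le _ _)
        _ = _ := by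
            rw [Finset.sum_mul]
            exact Finset.sum_congr rfl fun m hm => by rw [mem_exponentsOfDegree.1 hm]
    rw [ENNReal.ofReal_eq_coe_nnreal hr.le]
    exact FormalMultilinearSeries.le_radius_of_summable _ h1
  r_pos := by simpa using hr
  hasSum := by
    intro y hy
    have hy' : ∀ i, ‖y i‖ ≤ r := fun i => by
      rw [Metric.eball_ofReal, mem_ball_zero_iff] at hy
      exact (norm_le_pi_norm y i).trans hy.le
    rw [zero_add]
    convert! hasSum_exponentsOfDegree (summable_eval h hy').of_norm.hasSum using 2 with n
    rw [_root_.sum_apply]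
    exact Finset.sum_congr rfl fun m hm => by
      simp [monomialForm_apply_diag (mem_exponentsOfDegree.1 hm)]

variable {E : Type*} [NormedAddCommGroup E] [NormedSpace 𝕜 E] {b : Module.Basis σ 𝕜 E}
  {u u' : MvPowerSeries σ 𝕜} {f f' : E → 𝕜} {q : E}

theorem HasExpansion.analyticAt (h : HasExpansion b u f q) : AnalyticAt 𝕜 f q := by
  classical
  have := Module.Basis.finiteDimensional_of_finite b
  obtain ⟨r, hr, hs⟩ := h.converges
  have h1 := (hasFPowerSeriesOnBall_of_summable hr hs).analyticAt
  have h2 : AnalyticAt 𝕜 (sumFun b u q) q := by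
    have h3 : AnalyticAt 𝕜 (fun z => b.equivFun (z - q)) q :=
      (b.equivFun.toLinearMap.toContinuousLinearMap.analyticAt _).fun_comp
        (analyticAt_id.sub analyticAt_const)
    refine AnalyticAt.fun_comp (g := fun v => ∑' m, coeff m u * monomialEval m v) ?_ h3
    simpa using h1
  exact h2.congr (h.converges.hasExpansion.eventuallyEq h)

/-- Expanding `p n (v, …, v)` in the standard basis gives a sum over words of length `n`. Collecting
the words with the same letter counts gives the coefficient of a monomial. -/
theorem exists_hasSum_of_analyticAt {g : (σ → 𝕜) → 𝕜} (hg : AnalyticAt 𝕜 g 0) :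
    ∃ u : MvPowerSeries σ 𝕜, Converges u ∧
      ∀ᶠ v in 𝓝 (0 : σ → 𝕜), HasSum (fun m => coeff m u * monomialEval m v) (g v) := by
  classical
  obtain ⟨p, R, hp⟩ := hg
  obtain ⟨r, hr0, hrR⟩ := ENNReal.lt_iff_exists_nnreal_btwn.1 hp.r_pos
  have hr : 0 < (r : ℝ) := by exact_mod_cast hr0
  have hsum : Summable fun n => ‖p n‖ * (r : ℝ) ^ n :=
    p.summable_norm_mul_pow (hrR.trans_le hp.r_le)
  -- words of letters and their coefficients
  let W := Σ n : ℕ, Fin n → σ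
  let c : W → 𝕜 := fun w => p w.1 fun k => Pi.single (w.2 k) 1
  let cnt : W → (σ →₀ ℕ) := fun w => ∑ k, Finsupp.single (w.2 k) 1
  have hdeg : ∀ w, (cnt w).degree = w.1 := fun w => by simp [cnt, map_sum]
  have hmon : ∀ (w : W) (v : σ → 𝕜), ∏ k, v (w.2 k) = monomialEval (cnt w) v := fun w v => by
    simp only [cnt, monomialEval, Finsupp.finsetSum_apply, ← Finset.prod_pow_eq_pow_sum]
    rw [Finset.prod_comm]
    refine Finset.prod_congr rfl fun k _ => ?_
    rw [Finset.prod_eq_single (w.2 k)] <;> simp +contextual [eq_comm]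
  have hc : ∀ w, ‖c w‖ ≤ ‖p w.1‖ := fun w => by
    refine ((p w.1).le_opNorm _).trans (mul_le_of_le_one_right (norm_nonneg _) ?_)
    refine Finset.prod_le_one (fun _ _ => norm_nonneg _) fun k _ => ?_
    rw [pi_norm_le_iff_of_nonneg zero_le_one]
    intro i
    by_cases h : i = w.2 k
    · subst h; simp
    · simp [h]
  -- There are `card σ ^ n` words of length `n`, so the radius is divided by a bound for `card σ` to
  -- keep the sum over words absolutely convergent. The `+ 1` keeps `N` positive when `σ` is empty.
  set N : ℝ := Fintype.card σ + 1 with hN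
  have hN0 : 0 < N := by positivity
  set ρ : ℝ := r / N with hρ
  have hρ0 : 0 < ρ := by positivity
  have hWsum : Summable fun w : W => ‖c w‖ * ρ ^ (cnt w).degree := by
    have h1 : Summable fun w : W => ‖p w.1‖ * ρ ^ w.1 := by
      rw [summable_sigma_of_nonneg (fun _ => by positivity)]
      refine ⟨fun n => (hasSum_fintype _).summable, ?_⟩
      refine Summable.of_nonneg_of_le (fun _ => tsum_nonneg fun _ => by positivity)
        (fun n => ?_) hsum
      rw [tsum_fintype]
      change ∑ _j : Fin n → σ, ‖p n‖ * ρ ^ n ≤ _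
      rw [Finset.sum_const, nsmul_eq_mul, Finset.card_univ, Fintype.card_fun,
        Fintype.card_fin, hρ, div_pow]
      have : ((Fintype.card σ : ℝ)) ^ n ≤ N ^ n := by
        gcongr
        simp [hN]
      push_cast
      calc _ ≤ N ^ n * (‖p n‖ * (r ^ n / N ^ n)) := by gcongr
        _ = _ := by field_simp
    refine Summable.of_nonneg_of_le (fun _ => by positivity) (fun w => ?_) h1
    rw [hdeg]
    gcongr
    exact hc w
  have hfib : ∀ m, Summable fun w : {w // cnt w = m} => ‖c w‖ := fun m => by
    have h1 := hWsum.subtype {w | cnt w = m}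
    have h2 : Summable fun w : {w // cnt w = m} => ‖c w‖ * ρ ^ m.degree := by
      refine h1.congr fun w => ?_
      have hw : cnt w.1 = m := w.2
      simp [hw]
    exact (summable_mul_right_iff (by positivity)).1 h2
  let u : MvPowerSeries σ 𝕜 := fun m => ∑' w : {w // cnt w = m}, c w
  have hu : ∀ m, coeff m u = ∑' w : {w // cnt w = m}, c w := fun m => rfl
  have hWsum' := ((Equiv.sigmaFiberEquiv cnt).summable_iff).2 hWsum
  refine ⟨u, ⟨ρ, hρ0, ?_⟩, ?_⟩
  · refine Summable.of_nonneg_of_le (fun _ => by positivity) (fun m => ?_) hWsum'.sigma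
    rw [hu]
    calc _ ≤ (∑' w : {w // cnt w = m}, ‖c w‖) * ρ ^ m.degree := by
          gcongr
          exact norm_tsum_le_tsum_norm (hfib m)
      _ = _ := by
          rw [← tsum_mul_right]
          refine tsum_congr fun w => ?_
          have hw : cnt w.1 = m := w.2
          simp [Equiv.sigmaFiberEquiv, hw]
  · filter_upwards [eventually_norm_le hρ0,
      Metric.ball_mem_nhds (0 : σ → 𝕜) hr] with v hv hvr
    have h1 : HasSum (fun n => p n fun _ => v) (g v) := by
      have : v ∈ Metric.eball (0 : σ → 𝕜) R := by
        refine Metric.eball_subset_eball hrR.le ?_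
        rwa [Metric.eball_coe]
      simpa using hp.hasSum this
    have habs : Summable fun w : W => c w * monomialEval (cnt w) v := by
      refine Summable.of_norm_bounded hWsum fun w => ?_
      rw [norm_mul]
      gcongr
      exact norm_monomialEval_le _ hv
    have hn : ∀ n, HasSum (fun j : Fin n → σ => c ⟨n, j⟩ * monomialEval (cnt ⟨n, j⟩) v)
        (p n fun _ => v) := fun n => by
      have hv' : v = ∑ i, v i • Pi.single i (1 : 𝕜) := by
        ext j
        simp [Finset.sum_apply, Pi.single_apply]
      have h2 : (p n fun _ => v) = ∑ j : Fin n → σ, c ⟨n, j⟩ * monomialEval (cnt ⟨n, j⟩) v := by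
        conv_lhs => rw [hv']
        rw [ContinuousMultilinearMap.map_sum]
        refine Finset.sum_congr rfl fun j _ => ?_
        rw [ContinuousMultilinearMap.map_smul_univ, smul_eq_mul, mul_comm, ← hmon ⟨n, j⟩ v]
      rw [h2]
      exact hasSum_fintype _
    have h3 : HasSum (fun w : W => c w * monomialEval (cnt w) v) (g v) := by
      have h4 := habs.hasSum.sigma hn
      rw [← h4.unique h1]
      exact habs.hasSum
    refine (((Equiv.sigmaFiberEquiv cnt).hasSum_iff).2 h3).sigma fun m => ?_
    rw [hu]
    refine HasSum.congr_fun (((hfib m).of_norm.hasSum).mul_right (monomialEval m v)) fun w => ?_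
    have hw : cnt w.1 = m := w.2
    simp [Equiv.sigmaFiberEquiv, hw]

theorem exists_hasExpansion_of_analyticAt (b : Module.Basis σ 𝕜 E) (hf : AnalyticAt 𝕜 f q) :
    ∃ u, HasExpansion b u f q := by
  have h1 : AnalyticAt 𝕜 (fun v => q + b.equivFun.symm v) 0 :=
    analyticAt_const.add (b.equivFun.symm.toLinearMap.toContinuousLinearMap.analyticAt _)
  have h2 : AnalyticAt 𝕜 (fun v => f (q + b.equivFun.symm v)) 0 :=
    AnalyticAt.fun_comp (g := f) (by simpa using hf) h1
  obtain ⟨u, hu, hs⟩ := exists_hasSum_of_analyticAt h2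
  exact ⟨u, hu, hs⟩

/-! ### Derivatives -/

theorem monomialEval_add_single [DecidableEq σ] (m : σ →₀ ℕ) (v : σ → 𝕜) (i : σ) (s : 𝕜) :
    monomialEval m (v + Pi.single i s) = (v i + s) ^ m i * ∏ j ∈ univ.erase i, v j ^ m j := by
  rw [monomialEval, ← Finset.mul_prod_erase _ _ (Finset.mem_univ i)]
  congr 1
  · simp
  · exact Finset.prod_congr rfl fun j hj => by simp [Finset.ne_of_mem_erase hj]

theorem succ_mul_half_pow_le {r : ℝ} (hr : 0 < r) (k : ℕ) : (k + 1) * (r / 2) ^ k ≤ r ^ k := by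
  have h : ((k : ℝ) + 1) ≤ 2 ^ k := by exact_mod_cast Nat.lt_two_pow_self (n := k)
  rw [div_pow]
  calc _ ≤ 2 ^ k * (r ^ k / 2 ^ k) := by gcongr
    _ = r ^ k := by field_simp

omit [Fintype σ] in
theorem Converges.pderiv (h : Converges u) (i : σ) : Converges (pderiv 𝕜 i u) := by
  obtain ⟨r, hr, hs⟩ := h
  -- Halving the radius absorbs the factor `m i + 1` produced by differentiation, since `k + 1 ≤ 2 ^
  -- k`.
  refine ⟨r / 2, by positivity, ?_⟩
  have h1 := (hs.comp_injective (add_left_injective (Finsupp.single i 1))).mul_right r⁻¹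
  refine Summable.of_nonneg_of_le (fun _ => by positivity) (fun m => ?_) h1
  rw [coeff_pderiv, norm_mul]
  have h2 : ‖((m i : 𝕜) + 1)‖ ≤ m.degree + 1 := by
    rw [show ((m i : 𝕜) + 1) = ((m i + 1 : ℕ) : 𝕜) by push_cast; rfl, RCLike.norm_natCast]
    exact_mod_cast Nat.succ_le_succ (Finsupp.le_degree i m)
  calc _ ≤ ‖coeff (m + Finsupp.single i 1) u‖ * (m.degree + 1) * (r / 2) ^ m.degree := by gcongr
    _ = ‖coeff (m + Finsupp.single i 1) u‖ * ((m.degree + 1) * (r / 2) ^ m.degree) := by ring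
    _ ≤ ‖coeff (m + Finsupp.single i 1) u‖ * r ^ m.degree := by
        gcongr
        exact succ_mul_half_pow_le hr _
    _ = _ := by simp [pow_succ]; field_simp

/-- Termwise differentiation along one coordinate. With `‖v j‖ ≤ r / 4` and `‖s‖ < r / 4` all
arguments stay within `r / 2`, where the differentiated terms are dominated by the given series of
radius `r`. -/
theorem hasDerivAt_tsum_monomialEval [DecidableEq σ] {r : ℝ} (hr : 0 < r)
    (h : Summable fun m => ‖coeff m u‖ * r ^ m.degree) (i : σ) {v : σ → 𝕜}
    (hv : ∀ j, ‖v j‖ ≤ r / 4) :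
    HasDerivAt (fun s => ∑' m, coeff m u * monomialEval m (v + Pi.single i s))
      (∑' m, coeff m (pderiv 𝕜 i u) * monomialEval m v) 0 := by
  let P : (σ →₀ ℕ) → 𝕜 := fun m => ∏ j ∈ univ.erase i, v j ^ m j
  let g' : (σ →₀ ℕ) → 𝕜 → 𝕜 := fun m s => coeff m u * (m i * (v i + s) ^ (m i - 1) * P m)
  have hbound : ∀ m : σ →₀ ℕ, ∀ s ∈ Metric.ball (0 : 𝕜) (r / 4),
      ‖g' m s‖ ≤ ‖coeff m u‖ * r ^ m.degree * r⁻¹ := by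
    intro m s hs
    rw [mem_ball_zero_iff] at hs
    rcases Nat.eq_zero_or_pos (m i) with h0 | h0
    · simp only [g', h0, Nat.cast_zero, zero_mul, mul_zero, norm_zero]
      positivity
    · obtain ⟨k, hk⟩ : ∃ k, m i = k + 1 := ⟨m i - 1, by omega⟩
      have hd : m.degree = (k + ∑ j ∈ univ.erase i, m j) + 1 := by
        rw [Finsupp.degree_eq_sum, ← Finset.add_sum_erase _ _ (Finset.mem_univ i), hk]
        ring
      have h1 : ‖v i + s‖ ≤ r / 2 := (norm_add_le _ _).trans (by linarith [hv i])
      have h2 : ‖P m‖ ≤ (r / 2) ^ ∑ j ∈ univ.erase i, m j := by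
        rw [norm_prod, ← Finset.prod_pow_eq_pow_sum]
        refine Finset.prod_le_prod (fun _ _ => norm_nonneg _) fun j _ => ?_
        rw [norm_pow]
        exact pow_le_pow_left₀ (norm_nonneg _) ((hv j).trans (by linarith)) _
      set K := ∑ j ∈ univ.erase i, m j
      have h3 : ‖g' m s‖ = ‖coeff m u‖ * (((k : ℝ) + 1) * ‖v i + s‖ ^ k * ‖P m‖) := by
        simp only [g', norm_mul, norm_pow, RCLike.norm_natCast, hk, Nat.add_sub_cancel]
        push_cast
        ring
      have h4 : r ^ m.degree * r⁻¹ = r ^ (k + K) := by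
        rw [hd, pow_succ, mul_assoc, mul_inv_cancel₀ hr.ne', mul_one]
      have h5 : ((k : ℝ) + 1) ≤ ((k + K : ℕ) : ℝ) + 1 := by
        exact_mod_cast Nat.succ_le_succ (Nat.le_add_right k K)
      rw [h3, mul_assoc ‖coeff m u‖ (r ^ _), h4]
      refine mul_le_mul_of_nonneg_left ?_ (norm_nonneg _)
      calc _ ≤ (((k + K : ℕ) : ℝ) + 1) * (r / 2) ^ k * (r / 2) ^ K := by
            gcongr
        _ = (((k + K : ℕ) : ℝ) + 1) * (r / 2) ^ (k + K) := by rw [pow_add]; ring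
        _ ≤ r ^ (k + K) := succ_mul_half_pow_le hr _
  have hr4 : (0 : ℝ) < r / 4 := by positivity
  have h0 : (0 : 𝕜) ∈ Metric.ball (0 : 𝕜) (r / 4) := Metric.mem_ball_self hr4
  have key := hasDerivAt_tsum_of_isPreconnected (h.mul_right r⁻¹) Metric.isOpen_ball
    (convex_ball (0 : 𝕜) (r / 4)).isPreconnected
    (g := fun m s => coeff m u * monomialEval m (v + Pi.single i s)) (g' := g')
    (fun m s _ => by
      simp only [monomialEval_add_single, g', P]
      have h3 : HasDerivAt (fun s : 𝕜 => (v i + s) ^ m i) (m i * (v i + s) ^ (m i - 1)) s := by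
        simpa using ((hasDerivAt_id s).const_add (v i)).fun_pow (m i)
      exact (h3.mul_const _).const_mul _)
    hbound h0
    (by simpa using (summable_eval h fun j => (hv j).trans (by linarith)).of_norm) h0
  convert! key using 1
  have h5 : Summable fun m => g' m 0 :=
    Summable.of_norm_bounded (h.mul_right r⁻¹) fun m => hbound m 0 h0
  have hinj := add_left_injective (Finsupp.single i 1 : σ →₀ ℕ)
  -- Terms with `m i = 0` have derivative zero, so the sum may be taken over the exponents `m +
  -- single i 1`, which is how the coefficients of `pderiv` are indexed.
  rw [← hinj.tsum_eq (f := fun m => g' m 0)]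
  · refine tsum_congr fun m => ?_
    have h6 : monomialEval m v = v i ^ m i * P m := by
      simpa using monomialEval_add_single m v i 0
    have h7 : P (m + Finsupp.single i 1) = P m :=
      Finset.prod_congr rfl fun j hj => by simp [(ne_of_mem_erase hj).symm]
    simp only [g', h7, coeff_pderiv, h6]
    simp
    ring
  · intro m hm
    have h8 : m i ≠ 0 := fun h9 => hm (by simp [g', h9])
    refine ⟨m - Finsupp.single i 1, ?_⟩
    refine tsub_add_cancel_of_le ?_
    simpa [Finsupp.single_le_iff] using Nat.one_le_iff_ne_zero.2 h8

theorem HasExpansion.fderiv (h : HasExpansion b u f q) (i : σ) :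
    HasExpansion b (pderiv 𝕜 i u) (fun z => fderiv 𝕜 f z (b i)) q := by
  classical
  refine ⟨h.converges.pderiv i, ?_⟩
  obtain ⟨r, hr, hs⟩ := h.converges
  have hs' := h.converges.pderiv i |>.eventually_summable
  filter_upwards [h.hasSum.eventually_nhds, eventually_norm_le (show 0 < r / 4 by positivity),
    tendsto_coord.eventually h.analyticAt.eventually_analyticAt, hs'] with v h1 h2 h3 h4
  have h5 := hasDerivAt_tsum_monomialEval hr hs i h2
  have hcont : Tendsto (fun s : 𝕜 => v + Pi.single i s) (𝓝 0) (𝓝 v) := by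
    have : Continuous fun s : 𝕜 => v + Pi.single (M := fun _ => 𝕜) i s :=
      continuous_const.add (continuous_single (A := fun _ => 𝕜) i)
    simpa using this.tendsto 0
  have h6 : HasDerivAt (fun s : 𝕜 => f (q + b.equivFun.symm v + s • b i))
      (∑' m, coeff m (pderiv 𝕜 i u) * monomialEval m v) 0 := by
    refine h5.congr_of_eventuallyEq ?_
    filter_upwards [hcont.eventually h1] with s hs
    rw [hs.tsum_eq, map_add, add_assoc]
    congr 3
    rw [Module.Basis.equivFun_symm_apply, Finset.sum_eq_single i] <;> simp +contextual
  have h7 : HasDerivAt (fun s : 𝕜 => f (q + b.equivFun.symm v + s • b i))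
      (_root_.fderiv 𝕜 f (q + b.equivFun.symm v) (b i)) 0 := by
    have h8 := h3.differentiableAt.hasFDerivAt
    have h9 : HasDerivAt (fun s : 𝕜 => q + b.equivFun.symm v + s • b i) (b i) 0 := by
      simpa using ((hasDerivAt_id (0 : 𝕜)).smul_const (b i)).const_add (q + b.equivFun.symm v)
    refine HasFDerivAt.comp_hasDerivAt (0 : 𝕜) ?_ h9
    simpa using h8
  rw [h7.unique h6]
  exact h4.of_norm.hasSum

/-- The constant coefficient is the value at `q`. Any other coefficient is, up to a nonzero integer
factor, a coefficient of lower degree in the expansion of a partial derivative. -/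
theorem HasExpansion.unique (h : HasExpansion b u f q) (h' : HasExpansion b u' f q) :
    u = u' := by
  classical
  have key : ∀ (n : ℕ) (f : E → 𝕜) (u u' : MvPowerSeries σ 𝕜), HasExpansion b u f q →
      HasExpansion b u' f q → ∀ m : σ →₀ ℕ, m.degree = n → coeff m u = coeff m u' := by
    intro n
    induction n with
    | zero =>
      intro f u u' h h' m hm
      rw [Finsupp.degree_eq_zero_iff] at hm
      subst hm
      simpa using h.constantCoeff_eq.trans h'.constantCoeff_eq.symm
    | succ n ih =>
      intro f u u' h h' m hm
      obtain ⟨i, hi⟩ : ∃ i, m i ≠ 0 := by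
        by_contra! h0
        have : m = 0 := Finsupp.ext h0
        simp [this] at hm
      obtain ⟨m', rfl⟩ : ∃ m', m = m' + Finsupp.single i 1 :=
        ⟨m - Finsupp.single i 1, (tsub_add_cancel_of_le
          (by simpa [Finsupp.single_le_iff] using Nat.one_le_iff_ne_zero.2 hi)).symm⟩
      have h1 := ih _ _ _ (h.fderiv i) (h'.fderiv i) m' (by simpa using hm)
      rw [coeff_pderiv, coeff_pderiv] at h1
      exact mul_right_cancel₀ (Nat.cast_add_one_ne_zero _) h1
  ext m
  exact key _ f u u' h h' m rfl

end Analytic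

/-! ### Formal Cauchy–Kovalevskaya theorem -/

section Formal

variable {σ : Type*}

/-- Formal integration in the variable `t`. -/
def integ (t : σ) : MvPowerSeries σ ℝ →ₗ[ℝ] MvPowerSeries σ ℝ where
  toFun u := fun m => if m t = 0 then 0 else coeff (m - Finsupp.single t 1) u / m t
  map_add' u v := by
    ext m
    change (if m t = 0 then (0 : ℝ) else _) =
      (if m t = 0 then (0 : ℝ) else _) + (if m t = 0 then (0 : ℝ) else _)
    split_ifs <;> simp [add_div]
  map_smul' c u := by
    ext m
    change (if m t = 0 then (0 : ℝ) else _) = c * (if m t = 0 then (0 : ℝ) else _)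
    split_ifs <;> simp [mul_div_assoc]

theorem coeff_integ_of_eq_zero {t : σ} {m : σ →₀ ℕ} (hm : m t = 0) (u : MvPowerSeries σ ℝ) :
    coeff m (integ t u) = 0 := if_pos hm

theorem coeff_integ_add_single (t : σ) (m : σ →₀ ℕ) (u : MvPowerSeries σ ℝ) :
    coeff (m + Finsupp.single t 1) (integ t u) = coeff m u / (m t + 1) := by
  refine (if_neg (by simp)).trans ?_
  simp

theorem exists_eq_add_single {t : σ} {m : σ →₀ ℕ} (h : m t ≠ 0) :
    ∃ m', m = m' + Finsupp.single t 1 :=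
  ⟨m - Finsupp.single t 1, (tsub_add_cancel_of_le
    (by simpa [Finsupp.single_le_iff] using Nat.one_le_iff_ne_zero.2 h)).symm⟩

theorem pderiv_integ_self (t : σ) (u : MvPowerSeries σ ℝ) : pderiv ℝ t (integ t u) = u := by
  ext m
  rw [coeff_pderiv, coeff_integ_add_single]
  field_simp

/-- The operator `∂ₐ ∘ ∫ dt`. -/
def slope (t a : σ) : MvPowerSeries σ ℝ →ₗ[ℝ] MvPowerSeries σ ℝ :=
  (pderiv ℝ a).toLinearMap ∘ₗ integ t

theorem slope_apply (t a : σ) (u : MvPowerSeries σ ℝ) :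
    slope t a u = pderiv ℝ a (integ t u) := rfl

theorem coeff_slope_of_eq_zero {t a : σ} (ha : a ≠ t) {m : σ →₀ ℕ} (hm : m t = 0)
    (u : MvPowerSeries σ ℝ) : coeff m (slope t a u) = 0 := by
  rw [slope_apply, coeff_pderiv, coeff_integ_of_eq_zero, zero_mul]
  simp [hm, ha.symm]

/-- `∂ₐ ∫ dt` trades one factor `a` for one factor `t`. Both the gain in weighted degree and the
norm bound are read off from this formula. -/
theorem coeff_slope_add_single {t a : σ} (ha : a ≠ t) (m : σ →₀ ℕ) (u : MvPowerSeries σ ℝ) :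
    coeff (m + Finsupp.single t 1) (slope t a u) =
      coeff (m + Finsupp.single a 1) u * ((m a + 1) / (m t + 1)) := by
  rw [slope_apply, coeff_pderiv, add_right_comm, coeff_integ_add_single]
  simp [ha, ha.symm]
  ring

/-- `∂ₐ` commutes with `∫ dt` because `a ≠ t`. So composites of slopes are second derivatives of the
double integral. -/
theorem integ_slope {t a : σ} (ha : a ≠ t) (u : MvPowerSeries σ ℝ) :
    integ t (slope t a u) = pderiv ℝ a (integ t (integ t u)) := by
  ext m
  by_cases h : m t = 0
  · rw [coeff_integ_of_eq_zero h, coeff_pderiv, coeff_integ_of_eq_zero, zero_mul]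
    simp [h, ha.symm]
  · obtain ⟨m, rfl⟩ := exists_eq_add_single h
    rw [coeff_integ_add_single, slope_apply, coeff_pderiv, coeff_pderiv, add_right_comm,
      coeff_integ_add_single]
    simp [ha, ha.symm]
    ring

theorem slope_slope {t a c : σ} (ha : a ≠ t) (u : MvPowerSeries σ ℝ) :
    slope t c (slope t a u) = pderiv ℝ c (pderiv ℝ a (integ t (integ t u))) := by
  rw [slope_apply t c, integ_slope ha]

/-! ### The filtration by weighted degree -/

/-- The degree in which `t` has weight two and the other variables have weight one. -/
def wdeg (t : σ) (m : σ →₀ ℕ) : ℕ := m.degree + m t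

theorem wdeg_add (t : σ) (m n : σ →₀ ℕ) : wdeg t (m + n) = wdeg t m + wdeg t n := by
  simp [wdeg]; ring

/-- All coefficients of weighted degree less than `n` vanish. -/
def Vanishes (t : σ) (n : ℕ) (u : MvPowerSeries σ ℝ) : Prop := ∀ m, wdeg t m < n → coeff m u = 0

variable {t : σ} {n k : ℕ} {u v : MvPowerSeries σ ℝ}

theorem vanishes_zero_left (u : MvPowerSeries σ ℝ) : Vanishes t 0 u :=
  fun _ h => absurd h (Nat.not_lt_zero _)

theorem vanishes_zero (n : ℕ) : Vanishes t n (0 : MvPowerSeries σ ℝ) := fun _ _ => by simp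

theorem Vanishes.add (hu : Vanishes t n u) (hv : Vanishes t n v) : Vanishes t n (u + v) :=
  fun m hm => by rw [map_add, hu m hm, hv m hm, add_zero]

theorem Vanishes.smul (c : ℝ) (hu : Vanishes t n u) : Vanishes t n (c • u) :=
  fun m hm => by rw [coeff_smul, hu m hm, mul_zero]

theorem Vanishes.mul (hu : Vanishes t n u) (hv : Vanishes t k v) :
    Vanishes t (n + k) (u * v) := by
  classical
  intro m hm
  rw [coeff_mul]
  refine Finset.sum_eq_zero fun p hp => ?_
  rw [← mem_antidiagonal.1 hp, wdeg_add] at hm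
  rcases lt_or_ge (wdeg t p.1) n with h | h
  · rw [hu _ h, zero_mul]
  · rw [hv _ (by omega), mul_zero]

theorem Vanishes.mul_left (hu : Vanishes t n u) (v : MvPowerSeries σ ℝ) :
    Vanishes t n (v * u) := by
  simpa using (vanishes_zero_left v).mul hu

theorem vanishes_one_iff : Vanishes t 1 u ↔ constantCoeff u = 0 := by
  refine ⟨fun h => by simpa using h 0 (by simp [wdeg]), fun h m hm => ?_⟩
  have : m = 0 := by
    rw [← Finsupp.degree_eq_zero_iff]
    unfold wdeg at hm
    omega
  simpa [this] using h

/-- A factor of weight one is exchanged for the factor `t` of weight two. This gain is the reason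
for the doubled weight of `t`. -/
theorem Vanishes.slope {a : σ} (ha : a ≠ t) (hu : Vanishes t n u) :
    Vanishes t (n + 1) (slope t a u) := by
  intro m hm
  by_cases h : m t = 0
  · exact coeff_slope_of_eq_zero ha h u
  · obtain ⟨m, rfl⟩ := exists_eq_add_single h
    rw [coeff_slope_add_single ha, hu, zero_mul]
    simp [wdeg, ha.symm] at hm ⊢
    omega

theorem eq_of_forall_vanishes (h : ∀ n, Vanishes t n (u - v)) : u = v := by
  ext m
  exact sub_eq_zero.1 ((map_sub _ _ _).symm.trans (h (wdeg t m + 1) m (Nat.lt_succ_self _)))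

theorem Vanishes.aeval_sub {ι : Type*} (P : MvPolynomial ι ℝ) {s s' : ι → MvPowerSeries σ ℝ}
    (h : ∀ i, Vanishes t n (s i - s' i)) :
    Vanishes t n (MvPolynomial.aeval s P - MvPolynomial.aeval s' P) := by
  induction P using MvPolynomial.induction_on with
  | C a => simpa using vanishes_zero n
  | add p q hp hq => 
    rw [map_add, map_add, add_sub_add_comm]
    exact hp.add hq
  | mul_X p i hp =>
    rw [map_mul, map_mul, MvPolynomial.aeval_X, MvPolynomial.aeval_X]
    have : MvPolynomial.aeval s p * s i - MvPolynomial.aeval s' p * s' i =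
      MvPolynomial.aeval s p * (s i - s' i) +
        s' i * (MvPolynomial.aeval s p - MvPolynomial.aeval s' p) := by ring
    rw [this]
    exact ((h i).mul_left _).add (hp.mul_left _)

theorem Vanishes.aeval {ι : Type*} {P : MvPolynomial ι ℝ} (hP : MvPolynomial.constantCoeff P = 0)
    {s : ι → MvPowerSeries σ ℝ} (h : ∀ i, Vanishes t n (s i)) :
    Vanishes t n (MvPolynomial.aeval s P) := by
  have h1 := Vanishes.aeval_sub P (s' := 0) (fun i => by simpa using h i)
  simpa [hP] using h1

/-! ### The weighted norm -/

/-- The weight of an exponent in the norm `majorant`. -/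
def weight (t : σ) (ρ ε : ℝ≥0) (m : σ →₀ ℕ) : ℝ≥0 :=
  ρ ^ m.degree * ε ^ m t / (m.degree.choose (m t) : ℝ≥0)

theorem apply_le_degree (m : σ →₀ ℕ) (i : σ) : m i ≤ m.degree := Finsupp.le_degree i m

/-- By Vandermonde's identity, the product of the two binomial coefficients is one term of the sum
for the binomial coefficient of `m + n`. -/
theorem weight_add_le (t : σ) (ρ ε : ℝ≥0) (m n : σ →₀ ℕ) :
    weight t ρ ε (m + n) ≤ weight t ρ ε m * weight t ρ ε n := by
  have hm : 0 < m.degree.choose (m t) := Nat.choose_pos (apply_le_degree m t)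
  have hn : 0 < n.degree.choose (n t) := Nat.choose_pos (apply_le_degree n t)
  have h : m.degree.choose (m t) * n.degree.choose (n t) ≤
      (m.degree + n.degree).choose (m t + n t) := by
    rw [Nat.add_choose_eq]
    exact Finset.single_le_sum (f := fun p : ℕ × ℕ => m.degree.choose p.1 * n.degree.choose p.2)
      (a := (m t, n t)) (fun _ _ => Nat.zero_le _) (by simp)
  rw [weight, weight, weight, div_mul_div_comm, map_add, Finsupp.add_apply]
  have h1 : ρ ^ (m.degree + n.degree) * ε ^ (m t + n t) =
      ρ ^ m.degree * ε ^ m t * (ρ ^ n.degree * ε ^ n t) := by rw [pow_add, pow_add]; ring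
  rw [h1]
  gcongr
  exact_mod_cast h

/-- With `n = |m|` and `k = m t`, the quotient of `choose (n+1) (k+1)` by `choose (n+1) k` is `(n +
1 - k) / (k + 1)`, and `m a ≤ n - k`. The binomial coefficient in the weight thus compensates
exactly the unbounded factor `(m a + 1) / (m t + 1)`. -/
theorem slope_weight_le {t a : σ} (ha : a ≠ t) (ρ ε : ℝ≥0) (m : σ →₀ ℕ) :
    ((m a + 1 : ℝ≥0) / (m t + 1)) * weight t ρ ε (m + Finsupp.single t 1) ≤
      ε * weight t ρ ε (m + Finsupp.single a 1) := by
  classical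
  have h1 : m a + m t ≤ m.degree := by
    have : Finsupp.single a (m a) + Finsupp.single t (m t) ≤ m := fun i => by
      by_cases hi : i = a
      · subst hi; simp [ha]
      · by_cases hi' : i = t
        · subst hi'; simp [ha.symm]
        · simp [Ne.symm hi, Ne.symm hi']
    simpa using Finsupp.degree_mono this
  have hc : 0 < (m.degree + 1).choose (m t) := Nat.choose_pos (by omega)
  have hc' : 0 < (m.degree + 1).choose (m t + 1) := Nat.choose_pos (by omega)
  have h2 : (m a + 1) * (m.degree + 1).choose (m t) ≤
      (m t + 1) * (m.degree + 1).choose (m t + 1) := by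
    rw [mul_comm (m t + 1), Nat.choose_succ_right_eq, mul_comm]
    exact Nat.mul_le_mul_left _ (by omega)
  have h3 : ((m a : ℝ≥0) + 1) * (m.degree + 1).choose (m t) ≤
      (m t + 1) * (m.degree + 1).choose (m t + 1) := by exact_mod_cast h2
  have e1 : weight t ρ ε (m + Finsupp.single t 1) =
      ρ ^ (m.degree + 1) * ε ^ (m t + 1) / ((m.degree + 1).choose (m t + 1) : ℝ≥0) := by
    simp [weight]
  have e2 : weight t ρ ε (m + Finsupp.single a 1) =
      ρ ^ (m.degree + 1) * ε ^ m t / ((m.degree + 1).choose (m t) : ℝ≥0) := by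
    simp [weight, ha.symm]
  rw [e1, e2, div_mul_div_comm, ← mul_div_assoc, div_le_div_iff₀ (by positivity) (by positivity)]
  calc _ = ρ ^ (m.degree + 1) * ε ^ (m t + 1) *
        (((m a : ℝ≥0) + 1) * (m.degree + 1).choose (m t)) := by ring
    _ ≤ ρ ^ (m.degree + 1) * ε ^ (m t + 1) *
        ((m t + 1) * (m.degree + 1).choose (m t + 1)) := by gcongr
    _ = _ := by ring

/-- A weighted `ℓ¹` norm of the coefficients. -/
def majorant (t : σ) (ρ ε : ℝ≥0) (u : MvPowerSeries σ ℝ) : ℝ≥0∞ :=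
  ∑' m, ((‖coeff m u‖₊ * weight t ρ ε m : ℝ≥0) : ℝ≥0∞)

variable {ρ ε : ℝ≥0}

theorem majorant_add_le : majorant t ρ ε (u + v) ≤ majorant t ρ ε u + majorant t ρ ε v := by
  rw [majorant, majorant, majorant, ← ENNReal.tsum_add]
  refine ENNReal.tsum_le_tsum fun m => ?_
  rw [← ENNReal.coe_add, ← add_mul, map_add]
  gcongr
  exact nnnorm_add_le _ _

theorem majorant_smul (c : ℝ) :
    majorant t ρ ε (c • u) = ‖c‖₊ * majorant t ρ ε u := by
  rw [majorant, majorant, ← ENNReal.tsum_mul_left]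
  refine tsum_congr fun m => ?_
  rw [coeff_smul, nnnorm_mul, mul_assoc, ENNReal.coe_mul]

theorem majorant_C (c : ℝ) : majorant t ρ ε (C c) = ‖c‖₊ := by
  classical
  rw [majorant, tsum_eq_single 0]
  · simp [weight]
  · intro m hm
    simp [coeff_C, hm]

theorem majorant_zero : majorant t ρ ε 0 = 0 := by simp [majorant]

theorem majorant_mul_le : majorant t ρ ε (u * v) ≤ majorant t ρ ε u * majorant t ρ ε v := by
  classical
  rw [majorant, majorant, majorant, ← ENNReal.tsum_mul_right]
  simp_rw [← ENNReal.tsum_mul_left]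
  rw [← ENNReal.tsum_prod, ← HasAntidiagonal.sigmaAntidiagonalEquivProd.tsum_eq,
    ENNReal.tsum_sigma']
  refine ENNReal.tsum_le_tsum fun m => ?_
  rw [tsum_fintype, coeff_mul]
  simp only [HasAntidiagonal.sigmaAntidiagonalEquivProd_apply]
  rw [Finset.sum_coe_sort (antidiagonal m) (fun p : (σ →₀ ℕ) × (σ →₀ ℕ) =>
    ((‖coeff p.1 u‖₊ * weight t ρ ε p.1 : ℝ≥0) : ℝ≥0∞) *
      ((‖coeff p.2 v‖₊ * weight t ρ ε p.2 : ℝ≥0) : ℝ≥0∞))]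
  simp only [← ENNReal.coe_mul]
  rw [← ENNReal.ofNNReal_finsetSum, ENNReal.coe_le_coe]
  calc _ ≤ (∑ p ∈ antidiagonal m, ‖coeff p.1 u‖₊ * ‖coeff p.2 v‖₊) * weight t ρ ε m := by
        gcongr
        exact (nnnorm_sum_le _ _).trans (Finset.sum_le_sum fun p _ => (nnnorm_mul _ _).le)
    _ ≤ _ := by
        rw [Finset.sum_mul]
        refine Finset.sum_le_sum fun p hp => ?_
        rw [← mem_antidiagonal.1 hp, mul_mul_mul_comm]
        gcongr
        exact weight_add_le _ _ _ _ _

theorem majorant_slope_le {a : σ} (ha : a ≠ t) :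
    majorant t ρ ε (slope t a u) ≤ ε * majorant t ρ ε u := by
  have hinj := add_left_injective (Finsupp.single t 1 : σ →₀ ℕ)
  have hinj' := add_left_injective (Finsupp.single a 1 : σ →₀ ℕ)
  rw [majorant, ← hinj.tsum_eq]
  · rw [majorant, ← ENNReal.tsum_mul_left]
    refine le_trans (ENNReal.tsum_le_tsum fun m => ?_) (ENNReal.tsum_comp_le_tsum_of_injective hinj'
      (fun m => (ε : ℝ≥0∞) * ((‖coeff m u‖₊ * weight t ρ ε m : ℝ≥0) : ℝ≥0∞)))
    rw [← ENNReal.coe_mul, ENNReal.coe_le_coe, coeff_slope_add_single ha, nnnorm_mul]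
    have : ‖((m a : ℝ) + 1) / (m t + 1)‖₊ = (m a + 1 : ℝ≥0) / (m t + 1) := by
      apply NNReal.eq
      rw [coe_nnnorm, Real.norm_of_nonneg (by positivity)]
      push_cast
      rfl
    rw [this, mul_assoc, mul_left_comm ε]
    exact mul_le_mul' le_rfl (slope_weight_le ha ρ ε m)
  · intro m hm
    by_contra h
    refine hm ?_
    have : m t = 0 := by
      by_contra h'
      obtain ⟨m', hm'⟩ := exists_eq_add_single h'
      exact h ⟨m', hm'.symm⟩
    simp [coeff_slope_of_eq_zero ha this]

/-- The point is that `K` depends on `P` alone, so `ρ`, `ε` and `δ` can be chosen after it. The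
bound is linear in `δ` because higher powers of `δ ≤ 1` are at most `δ`. -/
theorem exists_majorant_aeval_le {ι : Type*} (P : MvPolynomial ι ℝ) :
    ∃ K : ℝ≥0, ∀ (ρ ε δ : ℝ≥0), δ ≤ 1 → ∀ s : ι → MvPowerSeries σ ℝ,
      (∀ i, majorant t ρ ε (s i) ≤ δ) →
      majorant t ρ ε (MvPolynomial.aeval s P - C (MvPolynomial.constantCoeff P)) ≤ K * δ := by
  induction P using MvPolynomial.induction_on with
  | C a =>
    refine ⟨0, fun ρ ε δ hδ s hs => ?_⟩
    have : MvPolynomial.aeval s (MvPolynomial.C a) = (C a : MvPowerSeries σ ℝ) := by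
      rw [MvPolynomial.aeval_C]; rfl
    simp [this, majorant_zero]
  | add p q hp hq =>
    obtain ⟨K, hK⟩ := hp
    obtain ⟨K', hK'⟩ := hq
    refine ⟨K + K', fun ρ ε δ hδ s hs => ?_⟩
    rw [map_add, map_add, map_add, add_sub_add_comm, ENNReal.coe_add, add_mul]
    exact majorant_add_le.trans (add_le_add (hK ρ ε δ hδ s hs) (hK' ρ ε δ hδ s hs))
  | mul_X p i hp =>
    obtain ⟨K, hK⟩ := hp
    refine ⟨K + ‖MvPolynomial.constantCoeff p‖₊, fun ρ ε δ hδ s hs => ?_⟩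
    rw [map_mul, map_mul, MvPolynomial.aeval_X, MvPolynomial.constantCoeff_X, mul_zero, map_zero,
      sub_zero]
    refine majorant_mul_le.trans (mul_le_mul' ?_ (hs i))
    rw [← sub_add_cancel (MvPolynomial.aeval s p) (C (MvPolynomial.constantCoeff p))]
    refine majorant_add_le.trans ?_
    rw [ENNReal.coe_add, majorant_C]
    gcongr
    refine (hK ρ ε δ hδ s hs).trans ?_
    exact mul_le_of_le_one_right' (by exact_mod_cast hδ)

/-! ### The fixed point -/

/-- Operators which raise the weighted degree and are small in the weighted norms. -/
structure Smoothing (t : σ) (L : MvPowerSeries σ ℝ →ₗ[ℝ] MvPowerSeries σ ℝ) : Prop where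
  vanishes : ∀ n u, Vanishes t n u → Vanishes t (n + 1) (L u)
  bound : ∃ K : ℝ≥0, ∀ ρ ε : ℝ≥0, ε ≤ 1 → ∀ u, majorant t ρ ε (L u) ≤ K * ε * majorant t ρ ε u

theorem smoothing_slope {a : σ} (ha : a ≠ t) : Smoothing t (slope t a) where
  vanishes _ _ h := h.slope ha
  bound := ⟨1, fun _ _ _ _ => by simpa using majorant_slope_le ha⟩

theorem smoothing_zero : Smoothing t (0 : MvPowerSeries σ ℝ →ₗ[ℝ] MvPowerSeries σ ℝ) where
  vanishes _ _ _ := vanishes_zero _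
  bound := ⟨0, fun _ _ _ _ => by simp [majorant_zero]⟩

theorem Smoothing.add {L L' : MvPowerSeries σ ℝ →ₗ[ℝ] MvPowerSeries σ ℝ} (h : Smoothing t L)
    (h' : Smoothing t L') : Smoothing t (L + L') where
  vanishes n u hu := (h.vanishes n u hu).add (h'.vanishes n u hu)
  bound := by
    obtain ⟨K, hK⟩ := h.bound
    obtain ⟨K', hK'⟩ := h'.bound
    refine ⟨K + K', fun ρ ε hε u => ?_⟩
    rw [LinearMap.add_apply, ENNReal.coe_add, add_mul, add_mul]
    exact majorant_add_le.trans (add_le_add (hK ρ ε hε u) (hK' ρ ε hε u))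

theorem Smoothing.smul {L : MvPowerSeries σ ℝ →ₗ[ℝ] MvPowerSeries σ ℝ} (c : ℝ)
    (h : Smoothing t L) : Smoothing t (c • L) where
  vanishes n u hu := (h.vanishes n u hu).smul c
  bound := by
    obtain ⟨K, hK⟩ := h.bound
    refine ⟨‖c‖₊ * K, fun ρ ε hε u => ?_⟩
    rw [LinearMap.smul_apply, majorant_smul, ENNReal.coe_mul, mul_assoc, mul_assoc, ← mul_assoc (K : ℝ≥0∞)]
    gcongr
    exact hK ρ ε hε u

theorem Smoothing.sub {L L' : MvPowerSeries σ ℝ →ₗ[ℝ] MvPowerSeries σ ℝ} (h : Smoothing t L)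
    (h' : Smoothing t L') : Smoothing t (L - L') := by
  have : L - L' = L + (-1 : ℝ) • L' := by
    refine LinearMap.ext fun u => ?_
    rw [LinearMap.add_apply, LinearMap.smul_apply, neg_one_smul, LinearMap.sub_apply,
      sub_eq_add_neg]
  rw [this]
  exact h.add (h'.smul _)

theorem Smoothing.comp {L L' : MvPowerSeries σ ℝ →ₗ[ℝ] MvPowerSeries σ ℝ} (h : Smoothing t L)
    (h' : Smoothing t L') : Smoothing t (L ∘ₗ L') where
  vanishes n u hu := fun m hm => (h.vanishes _ _ (h'.vanishes n u hu)) m (by omega)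
  bound := by
    obtain ⟨K, hK⟩ := h.bound
    obtain ⟨K', hK'⟩ := h'.bound
    refine ⟨K * K', fun ρ ε hε u => ?_⟩
    calc _ ≤ K * ε * (K' * ε * majorant t ρ ε u) :=
          (hK ρ ε hε _).trans (by gcongr; exact hK' ρ ε hε u)
      _ = K * K' * (ε * ε) * majorant t ρ ε u := by ring
      _ ≤ K * K' * (ε * 1) * majorant t ρ ε u := by gcongr; exact_mod_cast hε
      _ = _ := by push_cast; ring

variable {ι : Type*} (A B : MvPolynomial ι ℝ) (s₀ : ι → MvPowerSeries σ ℝ)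
  (L : ι → MvPowerSeries σ ℝ →ₗ[ℝ] MvPowerSeries σ ℝ)

/-- The map whose fixed points solve the formal Cauchy problem. -/
def cauchyMap (w : MvPowerSeries σ ℝ) : MvPowerSeries σ ℝ :=
  MvPolynomial.aeval (fun i => s₀ i + L i w) A + w * MvPolynomial.aeval (fun i => s₀ i + L i w) B

variable {A B s₀ L}

/-- Contraction for the filtration. The arguments of `A` and `B` gain a degree from the operators `L
i`. The term `(w - w') B` gains one because `B` has no constant term and is evaluated at series
without constant term. -/
theorem Vanishes.cauchyMap_sub (hB : MvPolynomial.constantCoeff B = 0)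
    (hs : ∀ i, constantCoeff (s₀ i) = 0) (hL : ∀ i, Smoothing t (L i))
    {w w' : MvPowerSeries σ ℝ} (h : Vanishes t n (w - w')) :
    Vanishes t (n + 1) (cauchyMap A B s₀ L w - cauchyMap A B s₀ L w') := by
  have h1 : ∀ i, Vanishes t (n + 1) (s₀ i + L i w - (s₀ i + L i w')) := fun i => by
    rw [add_sub_add_left_eq_sub, ← map_sub]
    exact (hL i).vanishes n _ h
  have h2 : ∀ i, Vanishes t 1 (s₀ i + L i w') := fun i =>
    (vanishes_one_iff.2 (hs i)).add ((hL i).vanishes 0 _ (vanishes_zero_left w'))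
  have h3 : cauchyMap A B s₀ L w - cauchyMap A B s₀ L w' =
      (MvPolynomial.aeval (fun i => s₀ i + L i w) A -
        MvPolynomial.aeval (fun i => s₀ i + L i w') A) +
      (w * (MvPolynomial.aeval (fun i => s₀ i + L i w) B -
        MvPolynomial.aeval (fun i => s₀ i + L i w') B) +
      (w - w') * MvPolynomial.aeval (fun i => s₀ i + L i w') B) := by
    simp only [cauchyMap]
    ring
  rw [h3]
  exact (Vanishes.aeval_sub A h1).add
    (((Vanishes.aeval_sub B h1).mul_left w).add (h.mul (Vanishes.aeval hB h2)))

theorem cauchyMap_fixed_unique (t : σ) (hB : MvPolynomial.constantCoeff B = 0)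
    (hs : ∀ i, constantCoeff (s₀ i) = 0) (hL : ∀ i, Smoothing t (L i))
    {w w' : MvPowerSeries σ ℝ} (h : cauchyMap A B s₀ L w = w) (h' : cauchyMap A B s₀ L w' = w') :
    w = w' := by
  refine eq_of_forall_vanishes (t := t) fun n => ?_
  induction n with
  | zero => exact vanishes_zero_left _
  | succ n ih => simpa only [h, h'] using Vanishes.cauchyMap_sub (A := A) hB hs hL ih

theorem constantCoeff_fixed (t : σ) (hA : MvPolynomial.constantCoeff A = 0)
    (hB : MvPolynomial.constantCoeff B = 0)
    (hs : ∀ i, constantCoeff (s₀ i) = 0) (hL : ∀ i, Smoothing t (L i))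
    {w : MvPowerSeries σ ℝ} (h : cauchyMap A B s₀ L w = w) : constantCoeff w = 0 := by
  have h2 : ∀ i, Vanishes t 1 (s₀ i + L i w) := fun i =>
    (vanishes_one_iff.2 (hs i)).add ((hL i).vanishes 0 _ (vanishes_zero_left w))
  rw [← vanishes_one_iff (t := t), ← h]
  exact (Vanishes.aeval hA h2).add ((Vanishes.aeval hB h2).mul_left w)

/-- The coefficients of the iterates are eventually constant in each weighted degree. The comparison
with the iterates is kept in the conclusion so that norm bounds can be transferred to the limit. -/
theorem exists_cauchyMap_fixed (t : σ) (hB : MvPolynomial.constantCoeff B = 0)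
    (hs : ∀ i, constantCoeff (s₀ i) = 0) (hL : ∀ i, Smoothing t (L i)) :
    ∃ w, cauchyMap A B s₀ L w = w ∧ ∀ n, Vanishes t n (w - (cauchyMap A B s₀ L)^[n] 0) := by
  set Φ := cauchyMap A B s₀ L
  have hstep : ∀ n, Vanishes t n (Φ^[n + 1] 0 - Φ^[n] 0) := by
    intro n
    induction n with
    | zero => exact vanishes_zero_left _
    | succ n ih =>
      rw [Function.iterate_succ_apply'] at ih ⊢
      rw [Function.iterate_succ_apply' Φ n]
      exact Vanishes.cauchyMap_sub hB hs hL ih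
  have hstep' : ∀ n k, Vanishes t n (Φ^[n + k] 0 - Φ^[n] 0) := by
    intro n k
    induction k with
    | zero => simpa using vanishes_zero n
    | succ k ih =>
      have h1 : Vanishes t n (Φ^[n + k + 1] 0 - Φ^[n + k] 0) :=
        fun m hm => hstep (n + k) m (by omega)
      simpa [add_assoc] using h1.add ih
  -- The iterate with index `wdeg t m + 1` is the first at which the contraction estimate guarantees
  -- that the coefficient of `m` no longer changes.
  let w : MvPowerSeries σ ℝ := fun m => coeff m (Φ^[wdeg t m + 1] 0)
  have hw : ∀ n, Vanishes t n (w - Φ^[n] 0) := by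
    intro n m hm
    obtain ⟨k, rfl⟩ := Nat.exists_eq_add_of_lt hm
    have := hstep' (wdeg t m + 1) k m (Nat.lt_succ_self _)
    rw [map_sub, sub_eq_zero] at this ⊢
    rw [show wdeg t m + k + 1 = wdeg t m + 1 + k by ring, this]
    rfl
  refine ⟨w, eq_of_forall_vanishes (t := t) fun n => ?_, hw⟩
  have h1 : Vanishes t n (Φ w - Φ^[n + 1] 0) := fun m hm => by
    rw [Function.iterate_succ_apply']
    exact Vanishes.cauchyMap_sub hB hs hL (hw n) m (by omega)
  have h2 : Vanishes t n ((-1 : ℝ) • (w - Φ^[n + 1] 0)) :=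
    Vanishes.smul _ fun m hm => hw (n + 1) m (by omega)
  have h3 := h1.add h2
  rw [neg_one_smul] at h3
  simpa using h3

/-- Without a constant term every occurring degree is positive, so a factor `ρ / r` can be extracted
from the whole norm. -/
theorem Converges.exists_majorant_le (hu : Converges u) (hc : constantCoeff u = 0) {δ : ℝ≥0}
    (hδ : 0 < δ) (t : σ) : ∃ r : ℝ≥0, 0 < r ∧ ∀ ρ ε : ℝ≥0, ρ ≤ r → ε ≤ 1 →
      majorant t ρ ε u ≤ δ := by
  obtain ⟨r, hr, h⟩ := hu
  lift r to ℝ≥0 using hr.le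
  have hr : 0 < r := by exact_mod_cast hr
  have h' : Summable fun m => ‖coeff m u‖₊ * r ^ m.degree := by
    rw [← NNReal.summable_coe]
    simpa using h
  set S := ∑' m, ‖coeff m u‖₊ * r ^ m.degree with hS
  have hS1 : 0 < S + 1 := by positivity
  refine ⟨min r (r * δ / (S + 1)), lt_min hr (by positivity), fun ρ ε hρ hε => ?_⟩
  have hρr : ρ / r ≤ 1 := div_le_one_of_le₀ (hρ.trans (min_le_left _ _)) zero_le
  have hρδ : ρ / r * S ≤ δ := by
    have h1 := hρ.trans (min_le_right _ _)
    rw [le_div_iff₀ hS1] at h1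
    rw [div_mul_eq_mul_div, div_le_iff₀ hr]
    calc ρ * S ≤ ρ * (S + 1) := by gcongr; exact le_self_add
      _ ≤ _ := h1
      _ = _ := mul_comm _ _
  have key : ∀ m : σ →₀ ℕ, ‖coeff m u‖₊ * weight t ρ ε m ≤
      ρ / r * (‖coeff m u‖₊ * r ^ m.degree) := by
    intro m
    rcases Nat.eq_zero_or_pos m.degree with h0 | h0
    · rw [Finsupp.degree_eq_zero_iff] at h0
      subst h0
      have : coeff 0 u = 0 := by simpa using hc
      simp [this]
    · have hch : 0 < m.degree.choose (m t) := Nat.choose_pos (apply_le_degree m t)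
      have h1 : weight t ρ ε m ≤ ρ ^ m.degree := by
        rw [weight, div_le_iff₀ (by exact_mod_cast hch)]
        refine mul_le_mul' le_rfl ((pow_le_one₀ zero_le hε).trans ?_)
        exact_mod_cast hch
      have h2 : ρ ^ m.degree ≤ ρ / r * r ^ m.degree := by
        have h3 : ρ ^ m.degree = (ρ / r) ^ m.degree * r ^ m.degree := by
          rw [← mul_pow, div_mul_cancel₀ _ hr.ne']
        rw [h3]
        gcongr
        exact pow_le_of_le_one zero_le hρr h0.ne'
      calc _ ≤ ‖coeff m u‖₊ * (ρ / r * r ^ m.degree) := by gcongr; exact h1.trans h2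
        _ = _ := by ring
  calc majorant t ρ ε u
      ≤ ∑' m, ((ρ / r * (‖coeff m u‖₊ * r ^ m.degree) : ℝ≥0) : ℝ≥0∞) :=
        ENNReal.tsum_le_tsum fun m => ENNReal.coe_le_coe.2 (key m)
    _ = ((ρ / r * S : ℝ≥0) : ℝ≥0∞) := by
        rw [hS, ← NNReal.tsum_mul_left, ENNReal.coe_tsum (h'.mul_left _)]
    _ ≤ δ := by exact_mod_cast hρδ

/-- The binomial coefficient in the weight is at most `2 ^ |m|`, so passing to an ordinary polydisc
costs only a factor two in the radius. -/
theorem converges_of_majorant_ne_top (hρ : 0 < ρ) (hε : 0 < ε) (h : majorant t ρ ε u ≠ ∞) :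
    Converges u := by
  have h1 : Summable fun m => ‖coeff m u‖₊ * weight t ρ ε m := ENNReal.tsum_coe_ne_top_iff_summable.1 h
  refine ⟨ρ * min ε 1 / 2, by positivity, ?_⟩
  refine Summable.of_nonneg_of_le (fun _ => by positivity) (fun m => ?_) (NNReal.summable_coe.2 h1)
  have hch : 0 < m.degree.choose (m t) := Nat.choose_pos (apply_le_degree m t)
  have h2 : (ρ * min ε 1 / 2) ^ m.degree ≤ weight t ρ ε m := by
    rw [weight, le_div_iff₀ (by exact_mod_cast hch), div_pow, mul_pow]
    have h3 : (m.degree.choose (m t) : ℝ≥0) ≤ 2 ^ m.degree := by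
      exact_mod_cast Nat.choose_le_two_pow _ _
    have h4 : (min ε 1) ^ m.degree ≤ ε ^ m t := by
      calc _ ≤ (min ε 1) ^ m t :=
            pow_le_pow_of_le_one zero_le (min_le_right _ _) (apply_le_degree m t)
        _ ≤ _ := by gcongr; exact min_le_left _ _
    calc _ ≤ ρ ^ m.degree * (min ε 1) ^ m.degree / 2 ^ m.degree * 2 ^ m.degree := by gcongr
      _ = ρ ^ m.degree * (min ε 1) ^ m.degree := by field_simp
      _ ≤ _ := by gcongr
  push_cast
  refine mul_le_mul_of_nonneg_left ?_ (norm_nonneg _)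
  exact_mod_cast h2

/-- **Cauchy–Kovalevskaya theorem**, in the form of a fixed point equation for formal power
series: the fixed point converges. -/
theorem exists_converges_cauchyMap_fixed [Finite ι] (t : σ)
    (hA : MvPolynomial.constantCoeff A = 0) (hB : MvPolynomial.constantCoeff B = 0)
    (hs : ∀ i, constantCoeff (s₀ i) = 0) (hs' : ∀ i, Converges (s₀ i))
    (hL : ∀ i, Smoothing t (L i)) : ∃ w, cauchyMap A B s₀ L w = w ∧ Converges w := by
  have := Fintype.ofFinite ι
  obtain ⟨w, hw, happrox⟩ := exists_cauchyMap_fixed (A := A) t hB hs hL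
  refine ⟨w, hw, ?_⟩
  obtain ⟨KA, hKA⟩ := exists_majorant_aeval_le (σ := σ) A
  obtain ⟨KB, hKB⟩ := exists_majorant_aeval_le (σ := σ) B
  choose K hK using fun i => (hL i).bound
  -- If all arguments of `A` and `B` have norm at most `δ`, then `cauchyMap` preserves the unit
  -- ball. Half of `δ` is reserved for `L i v`, by the choice of `ε`, and half for `s₀ i`, by the
  -- choice of `ρ`.
  set δ : ℝ≥0 := 1 / (KA + KB + 1) with hδ
  have hδ0 : 0 < δ := by positivity
  have hδ1 : δ ≤ 1 := div_le_one_of_le₀ (by simp) zero_le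
  have hKδ : KA * δ + KB * δ ≤ 1 := by
    rw [hδ, ← add_mul, mul_one_div]
    exact div_le_one_of_le₀ (by simp) zero_le
  set ε : ℝ≥0 := min 1 (δ / 2 / (∑ i, K i + 1)) with hε
  have hε0 : 0 < ε := lt_min one_pos (by positivity)
  have hKε : ∀ i, K i * ε ≤ δ / 2 := fun i => by
    calc K i * ε ≤ (∑ i, K i + 1) * (δ / 2 / (∑ i, K i + 1)) := by
          gcongr
          · exact (Finset.single_le_sum (fun _ _ => zero_le) (Finset.mem_univ i)).trans le_self_add
          · exact min_le_right _ _
      _ = δ / 2 := by field_simp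
  choose r hr0 hr using fun i => (hs' i).exists_majorant_le (hs i) (half_pos hδ0) t
  obtain ⟨ρ, hρ0, hρ⟩ : ∃ ρ : ℝ≥0, 0 < ρ ∧ ∀ i, ρ ≤ r i := by
    rcases isEmpty_or_nonempty ι with h | h
    · exact ⟨1, one_pos, fun i => h.elim i⟩
    · obtain ⟨i, hi⟩ := Finite.exists_min r
      exact ⟨r i, hr0 i, hi⟩
  have hiter : ∀ n, majorant t ρ ε ((cauchyMap A B s₀ L)^[n] 0) ≤ 1 := by
    intro n
    induction n with
    | zero => simp [majorant_zero]
    | succ n ih =>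
      rw [Function.iterate_succ_apply']
      set v := (cauchyMap A B s₀ L)^[n] 0
      have h1 : ∀ i, majorant t ρ ε (s₀ i + L i v) ≤ δ := fun i => by
        refine majorant_add_le.trans ?_
        have h2 := hr i ρ ε (hρ i) (min_le_left _ _)
        have h3 : majorant t ρ ε (L i v) ≤ (δ / 2 : ℝ≥0) :=
          calc _ ≤ (K i : ℝ≥0∞) * ε * majorant t ρ ε v := hK i ρ ε (min_le_left _ _) v
            _ ≤ K i * ε * 1 := by gcongr
            _ ≤ _ := by rw [mul_one]; exact_mod_cast hKε i
        refine (add_le_add h2 h3).trans ?_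
        rw [← ENNReal.coe_add, add_halves]
      have h2 := hKA ρ ε δ hδ1 _ h1
      have h3 := hKB ρ ε δ hδ1 _ h1
      rw [hA, map_zero, sub_zero] at h2
      rw [hB, map_zero, sub_zero] at h3
      refine majorant_add_le.trans ((add_le_add h2 (majorant_mul_le.trans
        (mul_le_mul' ih h3))).trans ?_)
      rw [one_mul]
      exact_mod_cast hKδ
  refine converges_of_majorant_ne_top (t := t) hρ0 hε0 (ne_top_of_le_ne_top ENNReal.one_ne_top ?_)
  -- A finite partial sum of the norm of `w` involves only coefficients that already agree with
  -- those of one iterate, whose norm is at most one.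
  rw [majorant, ENNReal.tsum_eq_iSup_sum]
  refine iSup_le fun F => ?_
  obtain ⟨n, hn⟩ : ∃ n, ∀ m ∈ F, wdeg t m < n :=
    ⟨F.sup (wdeg t) + 1, fun m hm => Nat.lt_succ_of_le (Finset.le_sup hm)⟩
  calc _ = ∑ m ∈ F, ((‖coeff m ((cauchyMap A B s₀ L)^[n] 0)‖₊ * weight t ρ ε m : ℝ≥0) : ℝ≥0∞) := by
        refine Finset.sum_congr rfl fun m hm => ?_
        have := happrox n m (hn m hm)
        rw [map_sub, sub_eq_zero] at this
        rw [this]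
    _ ≤ majorant t ρ ε ((cauchyMap A B s₀ L)^[n] 0) := ENNReal.sum_le_tsum F
    _ ≤ 1 := hiter n

end Formal

/-! ### The Monge–Ampère equation as a formal fixed point equation -/

section MongeAmpere

/-- The twice integrated series are the multiples of `t²`. -/
theorem exists_sq_mul_eq_integ_integ {σ : Type*} (t : σ) (w : MvPowerSeries σ ℝ) :
    ∃ k, X t ^ 2 * k = integ t (integ t w) ∧ (Converges w → Converges k) := by
  classical
  -- Integrating twice shifts the exponent by two in `t` and divides by `(m t + 1) (m t + 2)`, which
  -- is at least one, so convergence is inherited.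
  let k : MvPowerSeries σ ℝ := fun m => coeff m w / ((m t + 1) * (m t + 2))
  have hk : ∀ m, coeff m k = coeff m w / ((m t + 1) * (m t + 2)) := fun m => rfl
  refine ⟨k, ?_, fun ⟨r, hr, hs⟩ => ⟨r, hr, ?_⟩⟩
  · ext m
    rw [X_pow_eq, coeff_monomial_mul]
    split_ifs with h
    · obtain ⟨m, rfl⟩ := exists_add_of_le h
      have h2 : Finsupp.single t 2 + m = m + Finsupp.single t 1 + Finsupp.single t 1 := by
        rw [add_assoc, ← Finsupp.single_add, add_comm]
      rw [h2, coeff_integ_add_single, coeff_integ_add_single, ← h2, add_tsub_cancel_left, hk]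
      simp
      field_simp
      ring
    · by_cases h0 : m t = 0
      · rw [coeff_integ_of_eq_zero h0]
      · obtain ⟨m, rfl⟩ := exists_eq_add_single h0
        rw [coeff_integ_add_single, coeff_integ_of_eq_zero, zero_div]
        by_contra h1
        obtain ⟨m, rfl⟩ := exists_eq_add_single h1
        refine h ?_
        rw [add_assoc, ← Finsupp.single_add]
        exact le_add_self
  · refine Summable.of_nonneg_of_le (fun _ => by positivity) (fun m => ?_) hs
    gcongr
    rw [hk, norm_div]
    refine div_le_self (norm_nonneg _) ?_
    rw [Real.norm_of_nonneg (by positivity)]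
    nlinarith [(Nat.cast_nonneg (m t) : (0 : ℝ) ≤ m t)]

/-- The reverse passage from `k` to `w`. It is used only for formal uniqueness and for constant
terms, so convergence of `w` is not tracked. -/
theorem exists_integ_integ_eq_sq_mul {σ : Type*} (t : σ) (k : MvPowerSeries σ ℝ) :
    ∃ w, integ t (integ t w) = X t ^ 2 * k := by
  classical
  let w : MvPowerSeries σ ℝ := fun m => coeff m k * ((m t + 1) * (m t + 2))
  obtain ⟨k', hk', -⟩ := exists_sq_mul_eq_integ_integ t w
  refine ⟨w, ?_⟩
  rw [← hk']
  congr 1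
  ext m
  have h1 := congrArg (coeff (m + Finsupp.single t 1 + Finsupp.single t 1)) hk'
  have h2 : m + Finsupp.single t 1 + Finsupp.single t 1 = Finsupp.single t 2 + m := by
    rw [add_assoc, ← Finsupp.single_add, add_comm]
  rw [coeff_integ_add_single, coeff_integ_add_single, h2, X_pow_eq, coeff_add_monomial_mul] at h1
  have hw : coeff m w = coeff m k * ((m t + 1) * (m t + 2)) := rfl
  rw [one_mul, hw] at h1
  rw [h1]
  simp
  field_simp
  ring

/-- The six real coordinates `x₁, x₂, x₃, y₁, y₂, y₃` on `ℂ³`. -/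
abbrev RealIndex : Type := Fin 3 ⊕ Fin 3

section Entries

variable {R : Type*}

/-- From the second derivatives `d a c`, the entries `a₁₁, a₂₂, a₁₂, b₁₂, a₁₃, a₂₃, b₁₃, b₂₃, a₃₃`
of the complex Hessian, whose entry in place `(j, k)` is `a_jk + i b_jk`. -/
def hessEntries [AddCommGroup R] (d : RealIndex → RealIndex → R) : Fin 9 → R :=
  ![d (.inl 0) (.inl 0) + d (.inr 0) (.inr 0),
    d (.inl 1) (.inl 1) + d (.inr 1) (.inr 1),
    d (.inl 0) (.inl 1) + d (.inr 0) (.inr 1),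
    d (.inl 0) (.inr 1) - d (.inr 0) (.inl 1),
    d (.inl 0) (.inl 2) + d (.inr 0) (.inr 2),
    d (.inl 1) (.inl 2) + d (.inr 1) (.inr 2),
    d (.inl 0) (.inr 2) - d (.inr 0) (.inl 2),
    d (.inl 1) (.inr 2) - d (.inr 1) (.inl 2),
    d (.inl 2) (.inl 2) + d (.inr 2) (.inr 2)]

/-- The upper left minor of a Hermitian matrix. -/
def minorOf [CommRing R] (v : Fin 9 → R) : R := v 0 * v 1 - v 2 ^ 2 - v 3 ^ 2

/-- The part of the determinant of a Hermitian matrix without the last diagonal entry. -/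
def restOf [CommRing R] (v : Fin 9 → R) : R :=
  2 * ((v 2 * v 5 - v 3 * v 7) * v 4 + (v 2 * v 7 + v 3 * v 5) * v 6) -
    v 0 * (v 5 ^ 2 + v 7 ^ 2) - v 1 * (v 4 ^ 2 + v 6 ^ 2)

/-- The determinant of a Hermitian matrix. -/
def hermDet [CommRing R] (v : Fin 9 → R) : R := v 8 * minorOf v + restOf v

end Entries

/-- The coordinate in which the Cauchy problem is solved. -/
abbrev timeIndex : RealIndex := .inr 2

/-- The complex Hessian of `∬ w dt²`, apart from the summand `w` in the last entry. -/
def hessOp : Fin 9 → MvPowerSeries RealIndex ℝ →ₗ[ℝ] MvPowerSeries RealIndex ℝ :=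
  let S := slope timeIndex
  ![S (.inl 0) ∘ₗ S (.inl 0) + S (.inr 0) ∘ₗ S (.inr 0),
    S (.inl 1) ∘ₗ S (.inl 1) + S (.inr 1) ∘ₗ S (.inr 1),
    S (.inl 1) ∘ₗ S (.inl 0) + S (.inr 1) ∘ₗ S (.inr 0),
    S (.inr 1) ∘ₗ S (.inl 0) - S (.inl 1) ∘ₗ S (.inr 0),
    S (.inl 2) ∘ₗ S (.inl 0) + S (.inr 0),
    S (.inl 2) ∘ₗ S (.inl 1) + S (.inr 1),
    S (.inl 0) - S (.inl 2) ∘ₗ S (.inr 0),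
    S (.inl 1) - S (.inl 2) ∘ₗ S (.inr 1),
    S (.inl 2) ∘ₗ S (.inl 2)]

theorem smoothing_hessOp (i : Fin 9) : Smoothing timeIndex (hessOp i) := by
  have h : ∀ j : Fin 3, Smoothing timeIndex (slope timeIndex (.inl j)) :=
    fun j => smoothing_slope (by simp)
  have h0 : Smoothing timeIndex (slope timeIndex (.inr 0)) := smoothing_slope (by simp)
  have h1 : Smoothing timeIndex (slope timeIndex (.inr 1)) := smoothing_slope (by simp)
  fin_cases i
  · exact ((h 0).comp (h 0)).add (h0.comp h0)
  · exact ((h 1).comp (h 1)).add (h1.comp h1)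
  · exact ((h 1).comp (h 0)).add (h1.comp h0)
  · exact (h1.comp (h 0)).sub ((h 1).comp h0)
  · exact ((h 2).comp (h 0)).add h0
  · exact ((h 2).comp (h 1)).add h1
  · exact (h 0).sub ((h 2).comp h0)
  · exact (h 1).sub ((h 2).comp h1)
  · exact (h 2).comp (h 2)

/-- The entries of the formal complex Hessian of a power series. -/
def hessSeries (u : MvPowerSeries RealIndex ℝ) : Fin 9 → MvPowerSeries RealIndex ℝ :=
  hessEntries fun a c => pderiv ℝ c (pderiv ℝ a u)

theorem hessSeries_add (u v : MvPowerSeries RealIndex ℝ) (i : Fin 9) :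
    hessSeries (u + v) i = hessSeries u i + hessSeries v i := by
  fin_cases i <;> simp [hessSeries, hessEntries] <;> abel

/-- A second derivative of the double integral in which some direction differs from `t` is a
composite of slopes, where `∂ₜ ∫ dt` is the identity. Only the last diagonal entry contains `∂ₜ²`,
which contributes `w` itself. -/
theorem hessSeries_integ_integ (w : MvPowerSeries RealIndex ℝ) (i : Fin 9) :
    hessSeries (integ timeIndex (integ timeIndex w)) i = hessOp i w + if i = 8 then w else 0 := by
  have h : ∀ a c : RealIndex, a ≠ timeIndex →
      pderiv ℝ c (pderiv ℝ a (integ timeIndex (integ timeIndex w))) =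
        slope timeIndex c (slope timeIndex a w) := fun a c ha => (slope_slope ha w).symm
  have h' : ∀ u, slope timeIndex timeIndex u = u := pderiv_integ_self _
  have h'' : pderiv ℝ timeIndex (pderiv ℝ timeIndex (integ timeIndex (integ timeIndex w))) = w := by
    rw [pderiv_integ_self, pderiv_integ_self]
  fin_cases i <;> simp [hessSeries, hessEntries, hessOp, h, h', h'']

section Equation

variable (c : Fin 9 → ℝ)

/-- The coefficients of the formal Monge–Ampère equation at a point where the complex Hessian of
the initial data has the entries `c`; the variable `none` stands for the right hand side. -/
def maConst : MvPolynomial (Option (Fin 9)) ℝ :=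
  let v : Fin 9 → MvPolynomial (Option (Fin 9)) ℝ :=
    fun i => MvPolynomial.C (c i) + MvPolynomial.X (some i)
  MvPolynomial.C (minorOf c)⁻¹ *
    (MvPolynomial.C (hermDet c) + MvPolynomial.X none - hermDet v)

/-- The coefficient of `w` in the formal Monge–Ampère equation. -/
def maLin : MvPolynomial (Option (Fin 9)) ℝ :=
  let v : Fin 9 → MvPolynomial (Option (Fin 9)) ℝ :=
    fun i => MvPolynomial.C (c i) + MvPolynomial.X (some i)
  MvPolynomial.C (minorOf c)⁻¹ * (MvPolynomial.C (minorOf c) - minorOf v)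

theorem constantCoeff_maConst : MvPolynomial.constantCoeff (maConst c) = 0 := by
  simp [maConst, hermDet, minorOf, restOf, map_ofNat]

theorem constantCoeff_maLin : MvPolynomial.constantCoeff (maLin c) = 0 := by
  simp [maLin, minorOf]

/-- `hermDet` is affine in the last diagonal entry with slope `minorOf`, so the equation is `hermDet
v + w * minorOf v = g`. Division by the value `minorOf c` of the minor at the base point isolates
`w` and leaves its remaining coefficient without constant term. -/
theorem cauchyMap_ma_iff {c : Fin 9 → ℝ} (hc : minorOf c ≠ 0)
    (h₀ : Fin 9 → MvPowerSeries RealIndex ℝ) (g w : MvPowerSeries RealIndex ℝ) :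
    cauchyMap (maConst c) (maLin c)
      (fun o => o.elim (g - C (hermDet c)) fun i => h₀ i - C (c i))
      (fun o => o.elim 0 hessOp) w = w ↔
    hermDet (fun i => h₀ i + (hessOp i w + if i = 8 then w else 0)) = g := by
  set v : Fin 9 → MvPowerSeries RealIndex ℝ := fun i => h₀ i + hessOp i w with hv
  have hC : ∀ a : ℝ, algebraMap ℝ (MvPowerSeries RealIndex ℝ) a = C a := fun a => rfl
  have hinv : C (minorOf c)⁻¹ * C (minorOf c) = (1 : MvPowerSeries RealIndex ℝ) := by
    rw [← map_mul, inv_mul_cancel₀ hc, map_one]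
  have hone : ∀ i : Fin 9, C (c i) + (h₀ i - C (c i) + hessOp i w) = v i := fun i => by
    rw [hv]; ring
  have h1 : cauchyMap (maConst c) (maLin c)
      (fun o => o.elim (g - C (hermDet c)) fun i => h₀ i - C (c i))
      (fun o => o.elim 0 hessOp) w =
      C (minorOf c)⁻¹ * (g - hermDet v) + w * (C (minorOf c)⁻¹ * (C (minorOf c) - minorOf v)) := by
    simp only [cauchyMap, maConst, maLin, hermDet, minorOf, restOf, map_mul, map_add, map_sub,
      map_pow, MvPolynomial.aeval_C, MvPolynomial.aeval_X, Option.elim, hC, hone, map_ofNat]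
    simp only [LinearMap.zero_apply]
    ring
  have h2 : hermDet (fun i => h₀ i + (hessOp i w + if i = 8 then w else 0)) =
      hermDet v + w * minorOf v := by
    simp [hermDet, minorOf, restOf, hv]
    ring
  rw [h1, h2]
  have hne : C (minorOf c)⁻¹ ≠ (0 : MvPowerSeries RealIndex ℝ) := left_ne_zero_of_mul_eq_one hinv
  constructor
  · intro h
    have h3 : C (minorOf c)⁻¹ * (hermDet v + w * minorOf v) = C (minorOf c)⁻¹ * g := by
      linear_combination (-1 : MvPowerSeries RealIndex ℝ) * h + w * hinv
    exact mul_left_cancel₀ hne h3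
  · intro h
    linear_combination w * hinv - C (minorOf c)⁻¹ * h

end Equation

end MongeAmpere

/-! ### Local existence and uniqueness of the potential at a point of `y₃ = 0` -/

section LocalCauchy

theorem hasExpansion_coord {σ : Type*} [Fintype σ] {𝕜 : Type*} [RCLike 𝕜] {E : Type*}
    [NormedAddCommGroup E] [NormedSpace 𝕜 E] (b : Module.Basis σ 𝕜 E) (i : σ) (q : E) :
    HasExpansion b (X i) (fun z => b.equivFun (z - q) i) q := by
  classical
  refine ⟨⟨1, one_pos, ?_⟩, Eventually.of_forall fun v => ?_⟩
  · refine summable_of_ne_finset_zero (s := {Finsupp.single i 1}) fun m hm => ?_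
    simp [coeff_X, Finset.notMem_singleton.1 hm]
  · have h := hasSum_single (f := fun m => coeff m (X i : MvPowerSeries σ 𝕜) * monomialEval m v)
      (Finsupp.single i 1) fun m hm => by simp [coeff_X, hm]
    have h1 : monomialEval (Finsupp.single i 1) v = v i := by
      rw [monomialEval, Finset.prod_eq_single i] <;> simp +contextual [eq_comm]
    rw [add_sub_cancel_left, LinearEquiv.apply_symm_apply]
    simpa [h1] using h

/-- The real coordinates on `ℂ³`. -/
def realCoords : C3 ≃ₗ[ℝ] (RealIndex → ℝ) where
  toFun z := Sum.elim (fun j => (z j).re) fun j => (z j).im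
  invFun v := fun j => ⟨v (.inl j), v (.inr j)⟩
  map_add' z w := by ext (j | j) <;> simp
  map_smul' c z := by ext (j | j) <;> simp
  left_inv z := rfl
  right_inv v := by ext (j | j) <;> rfl

@[simp] theorem realCoords_inl (z : C3) (j : Fin 3) : realCoords z (.inl j) = (z j).re := rfl

@[simp] theorem realCoords_inr (z : C3) (j : Fin 3) : realCoords z (.inr j) = (z j).im := rfl

/-- The real basis `e₁, e₂, e₃, ie₁, ie₂, ie₃` of `ℂ³`. -/
def realBasis : Module.Basis RealIndex ℝ C3 := Module.Basis.ofEquivFun realCoords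

theorem realBasis_equivFun (z : C3) : realBasis.equivFun z = realCoords z := by
  simp [realBasis]

theorem realBasis_inl (j : Fin 3) : realBasis (.inl j) = Pi.single j 1 := by
  rw [realBasis, Module.Basis.coe_ofEquivFun]
  refine realCoords.injective ?_
  rw [LinearEquiv.apply_symm_apply]
  ext (k | k) <;> by_cases h : k = j <;> simp [h]

theorem realBasis_inr (j : Fin 3) : realBasis (.inr j) = Pi.single j Complex.I := by
  rw [realBasis, Module.Basis.coe_ofEquivFun]
  refine realCoords.injective ?_
  rw [LinearEquiv.apply_symm_apply]
  ext (k | k) <;> by_cases h : k = j <;> simp [h]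

/-- The iterated directional derivative of `f`, first along `u` and then along `v`. -/
def secondDeriv (f : C3 → ℝ) (z u v : C3) : ℝ := fderiv ℝ (fun y => fderiv ℝ f y u) z v

/-- The entries of the complex Hessian of `f`. -/
def hessFun (f : C3 → ℝ) (z : C3) : Fin 9 → ℝ :=
  hessEntries fun a c => secondDeriv f z (realBasis a) (realBasis c)

theorem secondDeriv_congr {f f' : C3 → ℝ} {z : C3} (h : f =ᶠ[𝓝 z] f') :
    secondDeriv f z = secondDeriv f' z := by
  funext u v
  have h1 : (fun y => fderiv ℝ f y u) =ᶠ[𝓝 z] fun y => fderiv ℝ f' y u :=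
    h.fderiv.mono fun y (hy : fderiv ℝ f y = fderiv ℝ f' y) => by
      change fderiv ℝ f y u = fderiv ℝ f' y u
      rw [hy]
  rw [secondDeriv, secondDeriv, h1.fderiv_eq]

theorem hessFun_congr {f f' : C3 → ℝ} {z : C3} (h : f =ᶠ[𝓝 z] f') :
    hessFun f z = hessFun f' z := by
  rw [hessFun, hessFun, secondDeriv_congr h]

variable {f f' f₀ G k k' : C3 → ℝ} {q : C3} {u : MvPowerSeries RealIndex ℝ}

theorem HasExpansion.hessFun (h : HasExpansion realBasis u f q) (i : Fin 9) :
    HasExpansion realBasis (hessSeries u i) (fun z => hessFun f z i) q := by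
  have h2 : ∀ a c, HasExpansion realBasis (pderiv ℝ c (pderiv ℝ a u))
      (fun z => secondDeriv f z (realBasis a) (realBasis c)) q := fun a c => (h.fderiv a).fderiv c
  fin_cases i
  · exact (h2 _ _).add (h2 _ _)
  · exact (h2 _ _).add (h2 _ _)
  · exact (h2 _ _).add (h2 _ _)
  · exact (h2 _ _).sub (h2 _ _)
  · exact (h2 _ _).add (h2 _ _)
  · exact (h2 _ _).add (h2 _ _)
  · exact (h2 _ _).sub (h2 _ _)
  · exact (h2 _ _).sub (h2 _ _)
  · exact (h2 _ _).add (h2 _ _)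

theorem HasExpansion.hermDet {v : Fin 9 → MvPowerSeries RealIndex ℝ} {φ : C3 → Fin 9 → ℝ}
    (h : ∀ i, HasExpansion realBasis (v i) (fun z => φ z i) q) :
    HasExpansion realBasis (hermDet v) (fun z => hermDet (φ z)) q := by
  have hsq : ∀ i, HasExpansion realBasis (v i ^ 2) (fun z => φ z i ^ 2) q := fun i => by
    simpa only [sq] using (h i).mul (h i)
  have h2 : HasExpansion realBasis (2 : MvPowerSeries RealIndex ℝ) (fun _ => (2 : ℝ)) q := by
    have h := hasExpansion_C (b := realBasis) (q := q) (2 : ℝ)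
    rwa [map_ofNat] at h
  have hm : HasExpansion realBasis (minorOf v) (fun z => minorOf (φ z)) q :=
    (((h 0).mul (h 1)).sub (hsq 2)).sub (hsq 3)
  have hr : HasExpansion realBasis (restOf v) (fun z => restOf (φ z)) q :=
    ((h2.mul (((((h 2).mul (h 5)).sub ((h 3).mul (h 7))).mul (h 4)).add
      ((((h 2).mul (h 7)).add ((h 3).mul (h 5))).mul (h 6)))).sub
      ((h 0).mul ((hsq 5).add (hsq 7)))).sub ((h 1).mul ((hsq 4).add (hsq 6)))
  exact ((h 8).mul hm).add hr

/-- The potential with Cauchy data on `y₃ = 0` given by `f₀`. -/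
def potential (f₀ k : C3 → ℝ) (z : C3) : ℝ := f₀ z + (z 2).im ^ 2 * k z

theorem HasExpansion.potential {u₀ u : MvPowerSeries RealIndex ℝ} (hq : (q 2).im = 0)
    (h₀ : HasExpansion realBasis u₀ f₀ q) (h : HasExpansion realBasis u k q) :
    HasExpansion realBasis (u₀ + X timeIndex ^ 2 * u) (potential f₀ k) q := by
  have hX := hasExpansion_coord realBasis timeIndex q
  have hX' : (fun z => realBasis.equivFun (z - q) timeIndex) = fun z : C3 => (z 2).im := by
    ext z
    rw [realBasis_equivFun, realCoords_inr]
    simp [hq]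
  rw [hX'] at hX
  have h1 := h₀.add ((hX.mul hX).mul h)
  rw [← sq] at h1
  simp only [← sq] at h1
  exact h1

/-- `k` solves the Monge–Ampère equation with right hand side `G` near `q`. -/
structure IsLocalSolution (f₀ G k : C3 → ℝ) (q : C3) : Prop where
  analyticAt : AnalyticAt ℝ k q
  eventually_eq : ∀ᶠ z in 𝓝 q, hermDet (hessFun (potential f₀ k) z) = G z

/-- The data of the formal problem at `q`. -/
structure CauchyData (f₀ G : C3 → ℝ) (q : C3) : Prop where
  im_eq_zero : (q 2).im = 0
  analyticAt : AnalyticAt ℝ f₀ q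
  analyticAt_rhs : AnalyticAt ℝ G q
  minor_ne_zero : minorOf (hessFun f₀ q) ≠ 0
  hermDet_eq : hermDet (hessFun f₀ q) = G q

theorem smoothing_option (o : Option (Fin 9)) :
    Smoothing timeIndex (o.elim 0 hessOp) := by
  cases o with
  | none => exact smoothing_zero
  | some i => exact smoothing_hessOp i

/-- The dictionary between formal fixed points and analytic germs. The series `s` have no constant
term: the Hessian entries are centred at their values, and for the right side this is the
compatibility `hermDet_eq`. -/
theorem CauchyData.exists_formal (h : CauchyData f₀ G q) :
    ∃ (u₀ : MvPowerSeries RealIndex ℝ) (A B : MvPolynomial (Option (Fin 9)) ℝ)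
      (s : Option (Fin 9) → MvPowerSeries RealIndex ℝ),
      HasExpansion realBasis u₀ f₀ q ∧
      MvPolynomial.constantCoeff A = 0 ∧ MvPolynomial.constantCoeff B = 0 ∧
      (∀ o, constantCoeff (s o) = 0) ∧ (∀ o, Converges (s o)) ∧
      ∀ w u k, integ timeIndex (integ timeIndex w) = X timeIndex ^ 2 * u →
        HasExpansion realBasis u k q →
        (cauchyMap A B s (fun o => o.elim 0 hessOp) w = w ↔ IsLocalSolution f₀ G k q) := by
  obtain ⟨u₀, hu₀⟩ := exists_hasExpansion_of_analyticAt realBasis h.analyticAt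
  obtain ⟨g, hg⟩ := exists_hasExpansion_of_analyticAt realBasis h.analyticAt_rhs
  set c := hessFun f₀ q with hc
  have hs : ∀ i, HasExpansion realBasis (hessSeries u₀ i - C (c i))
      (fun z => hessFun f₀ z i - c i) q := fun i => (hu₀.hessFun i).sub (hasExpansion_C _)
  have hs' : HasExpansion realBasis (g - C (LocalSLag.hermDet c))
      (fun z => G z - LocalSLag.hermDet c) q := hg.sub (hasExpansion_C _)
  refine ⟨u₀, maConst c, maLin c,
    fun o => o.elim (g - C (LocalSLag.hermDet c)) fun i => hessSeries u₀ i - C (c i),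
    hu₀, constantCoeff_maConst c, constantCoeff_maLin c, ?_, ?_, fun w u k hw hk => ?_⟩
  · rintro (_ | i)
    · exact hs'.constantCoeff_eq.trans (sub_eq_zero.2 h.hermDet_eq.symm)
    · simpa [hc] using (hs i).constantCoeff_eq
  · rintro (_ | i)
    exacts [hs'.converges, (hs i).converges]
  · have hpot := hu₀.potential h.im_eq_zero hk
    have hdet := HasExpansion.hermDet (φ := hessFun (LocalSLag.potential f₀ k)) hpot.hessFun
    have hfun : hessSeries (u₀ + X timeIndex ^ 2 * u) =
        fun i => hessSeries u₀ i + (hessOp i w + if i = 8 then w else 0) := by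
      funext i
      rw [hessSeries_add, ← hw, hessSeries_integ_integ]
    rw [hfun] at hdet
    rw [cauchyMap_ma_iff h.minor_ne_zero]
    constructor
    · intro heq
      rw [heq] at hdet
      exact ⟨hk.analyticAt, hdet.eventuallyEq hg⟩
    · intro hsol
      exact (hdet.congr hsol.eventually_eq).unique hg

theorem CauchyData.exists_isLocalSolution (h : CauchyData f₀ G q) :
    ∃ k, IsLocalSolution f₀ G k q := by
  obtain ⟨u₀, A, B, s, -, hA, hB, hs, hs', hiff⟩ := h.exists_formal
  obtain ⟨w, hw, hconv⟩ :=
    exists_converges_cauchyMap_fixed timeIndex hA hB hs hs' smoothing_option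
  obtain ⟨u, hu, hu'⟩ := exists_sq_mul_eq_integ_integ timeIndex w
  exact ⟨_, (hiff w u _ hu.symm (hu' hconv).hasExpansion).1 hw⟩

/-- Two analytic solutions give formal fixed points, which coincide. Cancelling `t²` identifies the
expansions of `k` and `k'`. -/
theorem IsLocalSolution.eventuallyEq (h : CauchyData f₀ G q) (hk : IsLocalSolution f₀ G k q)
    (hk' : IsLocalSolution f₀ G k' q) : k =ᶠ[𝓝 q] k' := by
  obtain ⟨u₀, A, B, s, -, hA, hB, hs, hs', hiff⟩ := h.exists_formal
  obtain ⟨u, hu⟩ := exists_hasExpansion_of_analyticAt realBasis hk.analyticAt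
  obtain ⟨u', hu'⟩ := exists_hasExpansion_of_analyticAt realBasis hk'.analyticAt
  obtain ⟨w, hw⟩ := exists_integ_integ_eq_sq_mul timeIndex u
  obtain ⟨w', hw'⟩ := exists_integ_integ_eq_sq_mul timeIndex u'
  have heq : w = w' := cauchyMap_fixed_unique timeIndex hB hs smoothing_option
    ((hiff w u k hw hu).2 hk) ((hiff w' u' k' hw' hu').2 hk')
  rw [heq, hw'] at hw
  have hX : (X timeIndex : MvPowerSeries RealIndex ℝ) ≠ 0 := fun h0 => by
    simpa using congrArg (coeff (Finsupp.single timeIndex 1)) h0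
  have huu : u' = u := mul_left_cancel₀ (pow_ne_zero 2 hX) hw
  rw [huu] at hu'
  exact hu.eventuallyEq hu'

/-- Because the initial data satisfy the equation at `q` itself, the fixed point `w` has no constant
term, and neither has `hessOp i w`. So the correction `y₃² k` does not change the complex Hessian at
`q`. -/
theorem IsLocalSolution.hessFun_eq (h : CauchyData f₀ G q) (hk : IsLocalSolution f₀ G k q) :
    hessFun (potential f₀ k) q = hessFun f₀ q := by
  obtain ⟨u₀, A, B, s, hu₀, hA, hB, hs, hs', hiff⟩ := h.exists_formal
  obtain ⟨u, hu⟩ := exists_hasExpansion_of_analyticAt realBasis hk.analyticAt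
  obtain ⟨w, hw⟩ := exists_integ_integ_eq_sq_mul timeIndex u
  have hw0 : constantCoeff w = 0 := constantCoeff_fixed timeIndex hA hB hs smoothing_option
    ((hiff w u k hw hu).2 hk)
  ext i
  have h1 := ((hu₀.potential h.im_eq_zero hu).hessFun i).constantCoeff_eq
  have h2 : constantCoeff (hessOp i w) = 0 :=
    vanishes_one_iff.1 ((smoothing_hessOp i).vanishes 0 w (vanishes_zero_left w))
  rw [← h1, ← (hu₀.hessFun i).constantCoeff_eq, hessSeries_add, ← hw, hessSeries_integ_integ,
    map_add, map_add, h2]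
  split_ifs <;> simp [hw0]

end LocalCauchy

/-! ### Gluing along balls with real centres; real points determine holomorphic functions -/

section Gluing

@[simp] theorem incl_apply (x : R3) (j : Fin 3) : incl x j = (x j : ℂ) := rfl

theorem norm_incl (x : R3) : ‖incl x‖ = ‖x‖ := by
  simp [Pi.norm_def, nnnorm]

theorem dist_incl (x y : R3) : dist (incl x) (incl y) = dist x y := by
  rw [dist_eq_norm, dist_eq_norm, ← map_sub, norm_incl]

theorem dist_incl_rePart_le (z : C3) (p : R3) : dist (incl (rePart z)) (incl p) ≤ dist z (incl p) := by
  refine (dist_pi_le_iff dist_nonneg).2 fun j => ?_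
  refine le_trans ?_ (dist_le_pi_dist z (incl p) j)
  have h : dist (incl (rePart z) j) (incl p j) = |(z j - (p j : ℂ)).re| := by
    rw [incl_apply, incl_apply, Complex.dist_eq, ← Complex.ofReal_sub, Complex.norm_real]
    simp [rePart]
  rw [h, Complex.dist_eq]
  exact Complex.abs_re_le_norm _

/-- Taking real parts does not increase the distance to a real point. As a consequence, overlapping
balls with real centres always share a real point. -/
theorem incl_rePart_mem_ball {z : C3} {p : R3} {r : ℝ} (hz : z ∈ Metric.ball (incl p) r) :
    incl (rePart z) ∈ Metric.ball (incl p) r :=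
  (dist_incl_rePart_le z p).trans_lt hz

/-- The union of the balls of radius `r p` around the points `p` of `U`. -/
def tube (U : Set R3) (r : R3 → ℝ) : Set C3 := ⋃ p ∈ U, Metric.ball (incl p) (r p)

theorem mem_tube {U : Set R3} {r : R3 → ℝ} {z : C3} :
    z ∈ tube U r ↔ ∃ p ∈ U, z ∈ Metric.ball (incl p) (r p) := by simp [tube]

theorem isOpen_tube (U : Set R3) (r : R3 → ℝ) : IsOpen (tube U r) :=
  isOpen_biUnion fun _ _ => Metric.isOpen_ball

theorem isStandardComplexification_tube {U : Set R3} {r : R3 → ℝ} (hr : ∀ p ∈ U, 0 < r p)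
    (hU : ∀ p ∈ U, ∀ x, incl x ∈ Metric.ball (incl p) (r p) → x ∈ U) :
    IsStandardComplexification U (tube U r) where
  isOpen := isOpen_tube U r
  incl_mem x hx := mem_tube.2 ⟨x, hx, Metric.mem_ball_self (hr x hx)⟩
  re_image := by
    ext x
    constructor
    · rintro ⟨z, hz, rfl⟩
      obtain ⟨p, hp, hz⟩ := mem_tube.1 hz
      exact hU p hp _ (incl_rePart_mem_ball hz)
    · intro hx
      exact ⟨incl x, mem_tube.2 ⟨x, hx, Metric.mem_ball_self (hr x hx)⟩, rfl⟩

/-- Analytic functions on balls around the points of `U` whose germs at the points of `U` agree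
are the restrictions of one function. -/
theorem exists_glue {F : Type*} [NormedAddCommGroup F] [NormedSpace ℝ F] {U : Set R3}
    {r : R3 → ℝ} {φ : R3 → C3 → F}
    (hφ : ∀ p ∈ U, AnalyticOnNhd ℝ (φ p) (Metric.ball (incl p) (r p)))
    (h : ∀ p ∈ U, ∀ x, incl x ∈ Metric.ball (incl p) (r p) → φ p =ᶠ[𝓝 (incl x)] φ x) :
    ∃ Φ : C3 → F, ∀ p ∈ U, Set.EqOn Φ (φ p) (Metric.ball (incl p) (r p)) := by
  classical
  let Φ : C3 → F := fun z =>
    if hz : ∃ p ∈ U, z ∈ Metric.ball (incl p) (r p) then φ hz.choose z else 0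
  refine ⟨Φ, fun p hp z hz => ?_⟩
  have hex : ∃ p ∈ U, z ∈ Metric.ball (incl p) (r p) := ⟨p, hp, hz⟩
  have hΦ : Φ z = φ hex.choose z := dif_pos hex
  rw [hΦ]
  obtain ⟨hp', hz'⟩ := hex.choose_spec
  set p' := hex.choose
  have h1 := h p hp _ (incl_rePart_mem_ball hz)
  have h2 := h p' hp' _ (incl_rePart_mem_ball hz')
  -- The overlap of the two balls is convex, and it contains the real part of `z`, where both germs
  -- agree with that of `φ (rePart z)`. The identity theorem carries this to `z`.
  exact ((hφ p' hp').mono Set.inter_subset_right).eqOn_of_preconnected_of_eventuallyEq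
    ((hφ p hp).mono Set.inter_subset_left)
    ((convex_ball (incl p) (r p)).inter (convex_ball (incl p') (r p'))).isPreconnected
    ⟨incl_rePart_mem_ball hz, incl_rePart_mem_ball hz'⟩ (h2.trans h1.symm) ⟨hz, hz'⟩

/-- A property of the points of `ℂ³` which holds near `p`, and a property of the points of `ℝ³`
which holds near `p`, hold on a ball. -/
theorem exists_ball_of_eventually {P : C3 → Prop} {Q : R3 → Prop} {p : R3}
    (hP : ∀ᶠ z in 𝓝 (incl p), P z) (hQ : ∀ᶠ x in 𝓝 p, Q x) :
    ∃ r > 0, (∀ z ∈ Metric.ball (incl p) r, P z) ∧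
      ∀ x, incl x ∈ Metric.ball (incl p) r → Q x := by
  obtain ⟨r, hr, h⟩ := Metric.eventually_nhds_iff_ball.1 hP
  obtain ⟨r', hr', h'⟩ := Metric.eventually_nhds_iff_ball.1 hQ
  refine ⟨min r r', lt_min hr hr', fun z hz => h z (Metric.ball_subset_ball (min_le_left _ _) hz),
    fun x hx => h' x ?_⟩
  rw [Metric.mem_ball, dist_incl] at hx
  exact hx.trans_le (min_le_right _ _)

/-- A holomorphic function on a ball with real centre is determined by its values at the real
points. -/
theorem eqOn_ball_of_eqOn_real {F F' : C3 → ℂ} {p : R3} {r : ℝ}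
    (hF : DifferentiableOn ℂ F (Metric.ball (incl p) r))
    (hF' : DifferentiableOn ℂ F' (Metric.ball (incl p) r))
    (h : ∀ x, incl x ∈ Metric.ball (incl p) r → F (incl x) = F' (incl x)) :
    Set.EqOn F F' (Metric.ball (incl p) r) := by
  intro z hz
  set x := rePart z with hx
  set y : R3 := fun j => (z j).im with hy
  -- The complex line through `x` in the direction `y` meets the real points at real parameters and
  -- passes through `z` at the parameter `i`. The problem reduces to the identity theorem in one
  -- variable on a convex set.
  let φ : ℂ → C3 := fun a => incl x + a • incl y
  have hφ : Differentiable ℂ φ := by fun_prop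
  have hφreal : ∀ s : ℝ, φ s = incl (x + s • y) := fun s => by
    ext j
    simp [φ]
  have hφ0 : φ 0 = incl x := by simp [φ]
  have hφI : φ Complex.I = z := by
    ext j
    simp [φ, hx, hy, rePart, mul_comm Complex.I, Complex.re_add_im]
  let S := φ ⁻¹' Metric.ball (incl p) r
  have hSo : IsOpen S := Metric.isOpen_ball.preimage hφ.continuous
  have hS : Convex ℝ S := by
    intro a ha c hc s t hs ht hst
    have h1 : φ (s • a + t • c) = s • φ a + t • φ c := by
      have : incl x = s • incl x + t • incl x := by rw [← add_smul, hst, one_smul]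
      simp only [φ, smul_add, add_smul, smul_assoc]
      nth_rewrite 1 [this]
      abel
    change φ (s • a + t • c) ∈ Metric.ball (incl p) r
    rw [h1]
    exact convex_ball (incl p) r ha hc hs ht hst
  have h0S : (0 : ℂ) ∈ S := by
    change φ 0 ∈ Metric.ball (incl p) r
    rw [hφ0]
    exact incl_rePart_mem_ball hz
  have hIS : Complex.I ∈ S := by
    change φ Complex.I ∈ Metric.ball (incl p) r
    rwa [hφI]
  have hd : DifferentiableOn ℂ (fun a => F (φ a) - F' (φ a)) S :=
    (hF.comp hφ.differentiableOn fun a ha => ha).sub (hF'.comp hφ.differentiableOn fun a ha => ha)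
  have hfreq : ∃ᶠ a in 𝓝[≠] (0 : ℂ), F (φ a) - F' (φ a) = 0 := by
    have h1 : Tendsto (fun s : ℝ => (s : ℂ)) (𝓝[≠] 0) (𝓝[≠] 0) := by
      refine tendsto_nhdsWithin_of_tendsto_nhds_of_eventually_within _ ?_ ?_
      · exact (Complex.continuous_ofReal.tendsto' 0 0 (by simp)).mono_left nhdsWithin_le_nhds
      · filter_upwards [self_mem_nhdsWithin] with s hs
        simpa using hs
    refine h1.frequently (Eventually.frequently ?_)
    have h2 : ∀ᶠ s : ℝ in 𝓝 0, (s : ℂ) ∈ S :=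
      (Complex.continuous_ofReal.tendsto' 0 0 (by simp)).eventually (hSo.mem_nhds h0S)
    filter_upwards [h2.filter_mono nhdsWithin_le_nhds] with s hs
    rw [hφreal, sub_eq_zero]
    refine h _ ?_
    rw [← hφreal]
    exact hs
  have h2 := (hd.analyticOnNhd hSo).eqOn_zero_of_preconnected_of_frequently_eq_zero
    hS.isPreconnected h0S hfreq hIS
  simpa [hφI, sub_eq_zero] using h2

end Gluing

/-! ### Holomorphic extension of the volume density -/

section Complexification

/-- A real-analytic function of three real variables extends locally to a holomorphic
function. -/
theorem exists_holomorphic_extension {h : R3 → ℝ} {p : R3} (hh : AnalyticAt ℝ h p) :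
    ∃ Γ : C3 → ℂ, AnalyticAt ℂ Γ (incl p) ∧ ∀ᶠ x in 𝓝 p, Γ (incl x) = h x := by
  obtain ⟨u, hu⟩ := exists_hasExpansion_of_analyticAt (Pi.basisFun ℝ (Fin 3)) hh
  -- The extension is the sum of the same power series, with its coefficients read as complex
  -- numbers.
  have hconv : Converges (map (algebraMap ℝ ℂ) u) := by
    obtain ⟨r, hr, hs⟩ := hu.converges
    exact ⟨r, hr, by simpa using hs⟩
  have hexp := hconv.hasExpansion (b := Pi.basisFun ℂ (Fin 3)) (q := incl p)
  refine ⟨_, hexp.analyticAt, ?_⟩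
  have h1 : Tendsto (fun x : R3 => x - p) (𝓝 p) (𝓝 0) := by
    simpa using (continuous_id.sub continuous_const).tendsto (f := fun x : R3 => x - p) p
  filter_upwards [h1.eventually hu.hasSum] with x hx
  have h2 : p + (Pi.basisFun ℝ (Fin 3)).equivFun.symm (x - p) = x := by
    ext j
    simp
  rw [h2] at hx
  have h3 : ∀ m : Fin 3 →₀ ℕ,
      monomialEval m (incl x - incl p) = ((monomialEval m (x - p) : ℝ) : ℂ) := fun m => by
    simp [monomialEval]
  have h4 := hx.mapL Complex.ofRealCLM
  rw [sumFun]
  convert! h4.tsum_eq using 3 with m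
  simp [h3]

theorem analyticAt_sqrt_det {U : Set R3} {g : R3 → Matrix (Fin 3) (Fin 3) ℝ}
    (hg : IsAnalyticMetric U g) {p : R3} (hp : p ∈ U) :
    AnalyticAt ℝ (fun x => Real.sqrt (g x).det) p := by
  have hdet : AnalyticAt ℝ (fun x => (g x).det) p := by
    have h : ∀ i j, AnalyticAt ℝ (fun x => g x i j) p := fun i j => hg.analytic i j p hp
    simp only [Matrix.det_fin_three]
    fun_prop
  have hsqrt : AnalyticAt ℝ Real.sqrt (g p).det :=
    (Real.contDiffAt_sqrt (hg.posDef p hp).det_pos.ne').analyticAt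
  exact hsqrt.fun_comp (f := fun x => (g x).det) hdet

/-- The holomorphic extension of the volume density of the metric. -/
theorem exists_density {U : Set R3} (hU : IsOpen U) {g : R3 → Matrix (Fin 3) (Fin 3) ℝ}
    (hg : IsAnalyticMetric U g) :
    ∃ Γ : C3 → ℂ, (∀ x ∈ U, AnalyticAt ℂ Γ (incl x)) ∧
      ∀ x ∈ U, Γ (incl x) = (Real.sqrt (g x).det : ℂ) := by
  have hloc : ∀ p : R3, ∃ Γ : C3 → ℂ, p ∈ U → AnalyticAt ℂ Γ (incl p) ∧
      ∀ᶠ x in 𝓝 p, Γ (incl x) = (Real.sqrt (g x).det : ℂ) := fun p => by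
    by_cases hp : p ∈ U
    · obtain ⟨Γ, h⟩ := exists_holomorphic_extension (analyticAt_sqrt_det hg hp)
      exact ⟨Γ, fun _ => h⟩
    · exact ⟨0, fun h => absurd h hp⟩
  choose φ hφ using hloc
  have hball : ∀ p : R3, ∃ r : ℝ, p ∈ U → 0 < r ∧
      (∀ z ∈ Metric.ball (incl p) r, AnalyticAt ℂ (φ p) z) ∧
      ∀ x, incl x ∈ Metric.ball (incl p) r →
        x ∈ U ∧ φ p (incl x) = (Real.sqrt (g x).det : ℂ) := fun p => by
    by_cases hp : p ∈ U
    · obtain ⟨r, hr, h1, h2⟩ := exists_ball_of_eventually (hφ p hp).1.eventually_analyticAt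
        ((hU.eventually_mem hp).and (hφ p hp).2)
      exact ⟨r, fun _ => ⟨hr, h1, h2⟩⟩
    · exact ⟨0, fun h => absurd h hp⟩
  choose r hr using hball
  obtain ⟨Γ, hΓ⟩ := exists_glue (U := U) (r := r) (φ := φ)
    (fun p hp z hz => ((hr p hp).2.1 z hz).restrictScalars) fun p hp x hx => by
      -- Near a common real point both local extensions are holomorphic and take the value `√det g`
      -- at real points, so they agree on a small ball.
      obtain ⟨hxU, -⟩ := (hr p hp).2.2 x hx
      obtain ⟨s, hs, hsub⟩ := Metric.mem_nhds_iff.1 <|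
        (Metric.isOpen_ball.inter Metric.isOpen_ball).mem_nhds
          ⟨hx, Metric.mem_ball_self (hr x hxU).1⟩
      refine Set.EqOn.eventuallyEq_of_mem (eqOn_ball_of_eqOn_real
        (fun z hz => ((hr p hp).2.1 z (hsub hz).1).differentiableAt.differentiableWithinAt)
        (fun z hz => ((hr x hxU).2.1 z (hsub hz).2).differentiableAt.differentiableWithinAt)
        fun y hy => ?_) (Metric.ball_mem_nhds _ hs)
      rw [((hr p hp).2.2 y (hsub hy).1).2, ((hr x hxU).2.2 y (hsub hy).2).2]
  refine ⟨Γ, fun x hx => ?_, fun x hx => ?_⟩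
  · refine ((hr x hx).2.1 _ (Metric.mem_ball_self (hr x hx).1)).congr ?_
    exact ((hΓ x hx).eventuallyEq_of_mem (Metric.ball_mem_nhds _ (hr x hx).1)).symm
  · rw [hΓ x hx (Metric.mem_ball_self (hr x hx).1)]
    exact ((hr x hx).2.2 x (Metric.mem_ball_self (hr x hx).1)).2

end Complexification

/-! ### Exterior products of one-forms as determinants -/

section Wedge

/-- The exterior product of complex-valued real-linear forms. -/
def covForm {p : ℕ} (φ : Fin p → C3 →ₗ[ℝ] ℂ) : C3 [⋀^Fin p]→ₗ[ℝ] ℂ :=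
  MultilinearMap.alternatization ((MultilinearMap.mkPiAlgebra ℝ (Fin p) ℂ).compLinearMap φ)

theorem covForm_apply {p : ℕ} (φ : Fin p → C3 →ₗ[ℝ] ℂ) (v : Fin p → C3) :
    covForm φ v = ∑ s : Equiv.Perm (Fin p), Equiv.Perm.sign s • ∏ i, φ i (v (s i)) := by
  simp [covForm, MultilinearMap.alternatization_apply]

theorem covForm_eq_det {p : ℕ} (φ : Fin p → C3 →ₗ[ℝ] ℂ) (v : Fin p → C3) :
    covForm φ v = Matrix.det (Matrix.of fun i j => φ i (v j)) := by
  rw [covForm_apply, ← Matrix.det_transpose, Matrix.det_apply]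
  rfl

theorem wedge_apply {p q : ℕ} (α : C3 [⋀^Fin p]→ₗ[ℝ] ℂ) (β : C3 [⋀^Fin q]→ₗ[ℝ] ℂ)
    (v : Fin (p + q) → C3) :
    wedge α β v = LinearMap.mul' ℝ ℂ (α.domCoprod β fun i => v (finSumFinEquiv i)) := rfl

/-- The shuffle product of two alternatizations is the alternatization of the tensor product, with
no numerical factor. All top-degree computations thereby become determinants of size six. -/
theorem wedge_covForm {p q : ℕ} (φ : Fin p → C3 →ₗ[ℝ] ℂ) (ψ : Fin q → C3 →ₗ[ℝ] ℂ) :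
    wedge (covForm φ) (covForm ψ) = covForm (Fin.append φ ψ) := by
  ext v
  rw [wedge_apply, covForm, covForm, ← MultilinearMap.domCoprod_alternization,
    MultilinearMap.alternatization_apply, map_sum, covForm_apply]
  refine Fintype.sum_equiv finSumFinEquiv.permCongr _ _ fun s => ?_
  rw [Equiv.Perm.sign_permCongr, Units.smul_def, Units.smul_def, map_zsmul]
  congr 1
  rw [← finSumFinEquiv.prod_comp, Fintype.prod_sum_type]
  simp [MultilinearMap.domCoprod_apply]

theorem alternatingMap_sum_apply {κ R M N ι : Type*} [CommSemiring R] [AddCommMonoid M] [Module R M]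
    [AddCommMonoid N] [Module R N] (s : Finset κ) (α : κ → M [⋀^ι]→ₗ[R] N) (v : ι → M) :
    (∑ i ∈ s, α i) v = ∑ i ∈ s, α i v := by
  classical
  induction s using Finset.induction_on with
  | empty => simp
  | insert a s ha ih => rw [Finset.sum_insert ha, Finset.sum_insert ha, AlternatingMap.add_apply, ih]

theorem wedge_sum_left {ι : Type*} {p q : ℕ} (s : Finset ι) (α : ι → C3 [⋀^Fin p]→ₗ[ℝ] ℂ)
    (β : C3 [⋀^Fin q]→ₗ[ℝ] ℂ) : wedge (∑ i ∈ s, α i) β = ∑ i ∈ s, wedge (α i) β := by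
  ext v
  rw [alternatingMap_sum_apply, wedge_apply, ← AlternatingMap.domCoprod'_apply,
    TensorProduct.sum_tmul, map_sum, alternatingMap_sum_apply, map_sum]
  rfl

theorem wedge_sum_right {ι : Type*} {p q : ℕ} (s : Finset ι) (α : C3 [⋀^Fin p]→ₗ[ℝ] ℂ)
    (β : ι → C3 [⋀^Fin q]→ₗ[ℝ] ℂ) : wedge α (∑ i ∈ s, β i) = ∑ i ∈ s, wedge α (β i) := by
  ext v
  rw [alternatingMap_sum_apply, wedge_apply, ← AlternatingMap.domCoprod'_apply,
    TensorProduct.tmul_sum, map_sum, alternatingMap_sum_apply, map_sum]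
  rfl

/-- The coordinate form `dz_j`. -/
def dz (j : Fin 3) : C3 →ₗ[ℝ] ℂ := (LinearMap.proj j : C3 →ₗ[ℂ] ℂ).restrictScalars ℝ

@[simp] theorem dz_apply (j : Fin 3) (u : C3) : dz j u = u j := rfl

/-- The conjugate coordinate form. -/
def dzBar (j : Fin 3) : C3 →ₗ[ℝ] ℂ := Complex.conjAe.toLinearMap ∘ₗ dz j

@[simp] theorem dzBar_apply (j : Fin 3) (u : C3) :
    dzBar j u = (starRingEnd ℂ) (u j) := rfl

/-- The form `dz₁ ∧ dz₂ ∧ dz₃ ∧ dz̄₁ ∧ dz̄₂ ∧ dz̄₃`. -/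
def topForm : C3 [⋀^Fin 6]→ₗ[ℝ] ℂ := covForm (Fin.append dz dzBar)

/-- A sum over triples of a symmetric function which vanishes on the diagonals. -/
theorem sum_fin_three_of_symm (f : Fin 3 → Fin 3 → Fin 3 → ℂ) (h : ∀ i j, f i i j = 0)
    (h12 : ∀ i j k, f i j k = f j i k) (h23 : ∀ i j k, f i j k = f i k j) :
    ∑ i, ∑ j, ∑ k, f i j k = 6 * f 0 1 2 := by
  have h' : ∀ i j, f i j j = 0 := fun i j => by rw [h12, h23, h]
  have h'' : ∀ i j, f i j i = 0 := fun i j => by rw [h23, h]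
  simp only [Fin.sum_univ_three, h, h', h'']
  rw [h12 2 1 0, h23 1 2 0, h12 1 0 2, h12 2 0 1, h23 0 2 1]
  ring

section Det

variable (D : (Fin 6 → ℂ) [⋀^Fin 6]→ₗ[ℂ] ℂ) (a b c d e f : Fin 6 → ℂ)

theorem alternating_swap_left : D ![a, b, c, d, e, f] = D ![c, d, a, b, e, f] := by
  have h := D.map_perm ![c, d, a, b, e, f] (Equiv.swap 0 2 * Equiv.swap 1 3)
  rw [show Equiv.Perm.sign (Equiv.swap (0 : Fin 6) 2 * Equiv.swap 1 3) = 1 by decide,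
    one_smul] at h
  rw [← h]
  congr 1
  ext i : 1
  fin_cases i <;> rfl

theorem alternating_swap_right : D ![a, b, c, d, e, f] = D ![a, b, e, f, c, d] := by
  have h := D.map_perm ![a, b, e, f, c, d] (Equiv.swap 2 4 * Equiv.swap 3 5)
  rw [show Equiv.Perm.sign (Equiv.swap (2 : Fin 6) 4 * Equiv.swap 3 5) = 1 by decide,
    one_smul] at h
  rw [← h]
  congr 1
  ext i : 1
  fin_cases i <;> rfl

theorem alternating_shuffle : D ![a, b, c, d, e, f] = -D ![a, c, e, b, d, f] := by
  have h := D.map_perm ![a, c, e, b, d, f]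
    (Equiv.swap 1 3 * Equiv.swap 3 4 * Equiv.swap 4 2)
  rw [show Equiv.Perm.sign (Equiv.swap (1 : Fin 6) 3 * Equiv.swap 3 4 * Equiv.swap 4 2) = -1 by
    decide, Units.neg_smul, one_smul] at h
  rw [← h]
  congr 1
  ext i : 1
  fin_cases i <;> rfl

end Det

theorem vec_eq_append {X : Type*} (T P : Fin 3 → X) :
    ![T 0, T 1, T 2, P 0, P 1, P 2] = Fin.append T P := by
  funext m
  fin_cases m <;> rfl

/-- The rows arise from those of `Z` and `Q` by left multiplication with the block diagonal matrix
of `c • 1` and `h`. -/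
theorem det_append_smul_sum (c : ℂ) (h : Matrix (Fin 3) (Fin 3) ℂ) (Z Q : Fin 3 → Fin 6 → ℂ) :
    Matrix.det (Matrix.of (Fin.append (fun j => c • Z j) fun j => ∑ k, h j k • Q k)) =
      c ^ 3 * h.det * Matrix.det (Matrix.of (Fin.append Z Q)) := by
  let e : Fin 3 ⊕ Fin 3 ≃ Fin 6 := finSumFinEquiv
  have hl : ∀ (A B : Fin 3 → Fin 6 → ℂ) i, Fin.append A B (e (.inl i)) = A i :=
    fun A B i => Fin.append_left A B i
  have hr : ∀ (A B : Fin 3 → Fin 6 → ℂ) i, Fin.append A B (e (.inr i)) = B i :=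
    fun A B i => Fin.append_right A B i
  clear_value e
  rw [← Matrix.det_submatrix_equiv_self e, ← Matrix.det_submatrix_equiv_self e (Matrix.of _)]
  have h1 : (Matrix.of (Fin.append (fun j => c • Z j) fun j => ∑ k, h j k • Q k)).submatrix e e =
      Matrix.fromBlocks (c • (1 : Matrix (Fin 3) (Fin 3) ℂ)) 0 0 h *
        (Matrix.of (Fin.append Z Q)).submatrix e e := by
    ext (i | i) j
    · simp [hl, hr, Matrix.mul_apply, Fintype.sum_sum_type, Matrix.one_apply]
    · simp [hl, hr, Matrix.mul_apply, Fintype.sum_sum_type]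
  rw [h1, Matrix.det_mul, Matrix.det_fromBlocks_zero₂₁, Matrix.det_smul, Matrix.det_one]
  simp

end Wedge

/-! ### The cube of a (1,1)-form -/

section Forms

/-- The determinant of six rows. -/
def detSix : (Fin 6 → ℂ) [⋀^Fin 6]→ₗ[ℂ] ℂ := Matrix.detRowAlternating

theorem detRowAlternating_apply {n : ℕ} (x : Fin n → Fin n → ℂ) :
    (Matrix.detRowAlternating : (Fin n → ℂ) [⋀^Fin n]→ₗ[ℂ] ℂ) x = Matrix.det (Matrix.of x) := rfl

theorem detSix_apply (x : Fin 6 → Fin 6 → ℂ) : detSix x = Matrix.det (Matrix.of x) := by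
  rw [detSix, detRowAlternating_apply]

theorem covForm_eq_detSix (φ : Fin 6 → C3 →ₗ[ℝ] ℂ) (v : Fin 6 → C3) :
    covForm φ v = detSix fun i m => φ i (v m) := by
  rw [covForm_eq_det, detSix_apply]

theorem covForm_append_apply (φ ψ : Fin 3 → C3 →ₗ[ℝ] ℂ) (v : Fin 6 → C3) :
    (covForm (Fin.append φ ψ) : C3 [⋀^Fin 6]→ₗ[ℝ] ℂ) v =
      detSix (Fin.append (fun j m => φ j (v m)) fun j m => ψ j (v m)) := by
  refine (covForm_eq_detSix (Fin.append φ ψ) v).trans (congrArg detSix ?_)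
  funext i
  fin_cases i <;> rfl

theorem covForm_append_append_apply (a b c d e f : C3 →ₗ[ℝ] ℂ) (v : Fin 6 → C3) :
    (covForm (Fin.append (Fin.append ![a, b] ![c, d]) ![e, f]) : C3 [⋀^Fin 6]→ₗ[ℝ] ℂ) v =
      detSix ![fun m => a (v m), fun m => b (v m), fun m => c (v m), fun m => d (v m),
        fun m => e (v m), fun m => f (v m)] := by
  refine (covForm_eq_detSix (Fin.append (Fin.append ![a, b] ![c, d]) ![e, f]) v).trans
    (congrArg detSix ?_)
  funext i
  fin_cases i <;> rfl

theorem wedge_cube_eq_sum (T P : Fin 3 → C3 →ₗ[ℝ] ℂ) :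
    wedge (wedge (∑ j, covForm ![T j, P j]) (∑ j, covForm ![T j, P j]))
      (∑ j, covForm ![T j, P j]) = ∑ k, ∑ j, ∑ i,
        covForm (Fin.append (Fin.append ![T i, P i] ![T j, P j]) ![T k, P k]) := by
  simp only [wedge_sum_left, wedge_sum_right, wedge_covForm]

/-- Terms with a repeated index vanish, and the six orderings of the three pairs contribute equally
because 2-forms commute. The sign comes from the odd permutation that separates the `t`s from the
`p`s. -/
theorem sum_detSix (t p : Fin 3 → Fin 6 → ℂ) :
    ∑ k, ∑ j, ∑ i, detSix ![t i, p i, t j, p j, t k, p k] = -6 * detSix (Fin.append t p) := by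
  rw [sum_fin_three_of_symm (fun k j i => detSix ![t i, p i, t j, p j, t k, p k]), ← vec_eq_append]
  · rw [alternating_swap_left, alternating_swap_right, alternating_swap_left, alternating_shuffle]
    ring
  · intro i j
    exact detSix.map_eq_zero_of_eq _ (i := 2) (j := 4) rfl (by decide)
  · intro i j k
    exact alternating_swap_right _ _ _ _ _ _ _
  · intro i j k
    exact alternating_swap_left _ _ _ _ _ _ _

theorem sum_sum_sum_apply (α : Fin 3 → Fin 3 → Fin 3 → C3 [⋀^Fin 6]→ₗ[ℝ] ℂ)
    (v : Fin 6 → C3) : (∑ k, ∑ j, ∑ i, α k j i) v = ∑ k, ∑ j, ∑ i, α k j i v := by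
  simp only [alternatingMap_sum_apply]

/-- The cube of a sum of three decomposable 2-forms. -/
theorem wedge_cube_apply (T P : Fin 3 → C3 →ₗ[ℝ] ℂ) (α : C3 [⋀^Fin 2]→ₗ[ℝ] ℂ)
    (hα : α = ∑ j, covForm ![T j, P j]) (v : Fin 6 → C3) :
    (wedge (wedge α α) α : C3 [⋀^Fin 6]→ₗ[ℝ] ℂ) v = -6 *
      detSix (Fin.append (fun j m => T j (v m)) fun j m => P j (v m)) := by
  rw [hα, wedge_cube_eq_sum]
  refine (sum_sum_sum_apply _ v).trans ?_
  simp only [covForm_append_append_apply]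
  exact sum_detSix (fun j m => T j (v m)) fun j m => P j (v m)

theorem topForm_apply (v : Fin 6 → C3) : topForm v =
    detSix (Fin.append (fun j m => dz j (v m)) fun j m => dzBar j (v m)) := by
  rw [topForm, covForm_append_apply]

theorem detSix_append_smul_sum (c : ℂ) (h : Matrix (Fin 3) (Fin 3) ℂ) (Z Q : Fin 3 → Fin 6 → ℂ) :
    detSix (Fin.append (fun j => c • Z j) fun j => ∑ k, h j k • Q k) =
      c ^ 3 * h.det * detSix (Fin.append Z Q) := by
  rw [detSix_apply, detSix_apply, det_append_smul_sum]

/-- The cube of the `(1,1)`-form with coefficient matrix `h`. -/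
theorem wedge_cube_eq (h : Matrix (Fin 3) (Fin 3) ℂ) (c : ℂ) (α : C3 [⋀^Fin 2]→ₗ[ℝ] ℂ)
    (hα : α = ∑ j, covForm ![c • dz j, ∑ k, h j k • dzBar k]) :
    (wedge (wedge α α) α : C3 [⋀^Fin 6]→ₗ[ℝ] ℂ) = (-6 * c ^ 3 * h.det) • topForm := by
  refine AlternatingMap.ext fun v => ?_
  rw [wedge_cube_apply (fun j => c • dz j) (fun j => ∑ k, h j k • dzBar k) α hα,
    AlternatingMap.smul_apply, topForm_apply, smul_eq_mul]
  have key := detSix_append_smul_sum c h (fun j m => dz j (v m)) fun j m => dzBar j (v m)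
  have h1 : (fun (j : Fin 3) (m : Fin 6) => (c • dz j) (v m)) = fun j => c • fun m => dz j (v m) :=
    rfl
  have h2 : (fun (j : Fin 3) (m : Fin 6) => (∑ k, h j k • dzBar k) (v m)) =
      fun j => ∑ k, h j k • fun m => dzBar k (v m) := by
    funext j m
    simp
  rw [h1, h2, key]
  ring

end Forms

/-! ### Hermitian matrix of a (1,1)-form and the volume equation -/

section Hermitian

theorem covForm_two_apply (a b : C3 →ₗ[ℝ] ℂ) (v : Fin 2 → C3) :
    covForm ![a, b] v = a (v 0) * b (v 1) - a (v 1) * b (v 0) := by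
  rw [covForm_eq_det, Matrix.det_fin_two]
  rfl

theorem covForm_smul {p : ℕ} (c : ℂ) (φ : Fin p → C3 →ₗ[ℝ] ℂ) :
    covForm (fun j => c • φ j) = c ^ p • covForm φ := by
  ext v
  rw [AlternatingMap.smul_apply, covForm_eq_det, covForm_eq_det]
  have : (Matrix.of fun i j => (c • φ i) (v j)) = c • Matrix.of fun i j => φ i (v j) := rfl
  rw [this, Matrix.det_smul, Fintype.card_fin, smul_eq_mul]

/-- The Hermitian matrix of a real 2-form of type `(1,1)`. -/
def hermMatrix (ω : C3 [⋀^Fin 2]→L[ℝ] ℝ) : Matrix (Fin 3) (Fin 3) ℂ :=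
  Matrix.of fun j k => (ω ![Pi.single j 1, Complex.I • Pi.single k 1] : ℂ) -
    Complex.I * (ω ![Pi.single j 1, Pi.single k 1] : ℂ)

theorem form_swap (ω : C3 [⋀^Fin 2]→L[ℝ] ℝ) (u v : C3) : ω ![u, v] = -ω ![v, u] := by
  have h := ω.toAlternatingMap.map_swap ![v, u] (i := 0) (j := 1) (by decide)
  refine Eq.trans ?_ h
  refine congrArg ω ?_
  funext i
  fin_cases i <;> rfl

theorem form_neg_right (ω : C3 [⋀^Fin 2]→L[ℝ] ℝ) (u v : C3) : ω ![u, -v] = -ω ![u, v] := by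
  have h := ω.map_update_smul ![u, v] 1 (-1 : ℝ) v
  have h1 : ∀ w : C3, Function.update ![u, v] 1 w = ![u, w] := fun w => by
    funext i
    fin_cases i <;> rfl
  simpa [h1] using h

theorem form_add_right (ω : C3 [⋀^Fin 2]→L[ℝ] ℝ) (u v w : C3) :
    ω ![u, v + w] = ω ![u, v] + ω ![u, w] := by
  have h := ω.map_update_add ![u, v] 1 v w
  have h1 : ∀ w : C3, Function.update ![u, v] 1 w = ![u, w] := fun w => by
    funext i
    fin_cases i <;> rfl
  simpa only [h1] using h

theorem form_add_left (ω : C3 [⋀^Fin 2]→L[ℝ] ℝ) (u v w : C3) :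
    ω ![u + v, w] = ω ![u, w] + ω ![v, w] := by
  rw [form_swap, form_add_right, form_swap ω u, form_swap ω v]
  ring

theorem form_I_left {ω : C3 [⋀^Fin 2]→L[ℝ] ℝ}
    (hω : ∀ u v : C3, ω ![Complex.I • u, Complex.I • v] = ω ![u, v]) (u v : C3) :
    ω ![Complex.I • u, v] = -ω ![u, Complex.I • v] := by
  rw [← hω u, ← form_neg_right]
  simp [smul_smul]

theorem form_I_symm {ω : C3 [⋀^Fin 2]→L[ℝ] ℝ}
    (hω : ∀ u v : C3, ω ![Complex.I • u, Complex.I • v] = ω ![u, v]) (u v : C3) :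
    ω ![u, Complex.I • v] = ω ![v, Complex.I • u] := by
  rw [form_swap, form_I_left hω, neg_neg]

theorem sum_hermitian_single (h : Matrix (Fin 3) (Fin 3) ℂ) (c s t : ℂ) (j k : Fin 3) :
    ∑ x, c * (s • Pi.single j 1 : C3) x * ∑ y, h x y * (starRingEnd ℂ) ((t • Pi.single k 1 : C3) y)
      = c * s * (starRingEnd ℂ) t * h j k := by
  rw [Finset.sum_eq_single j (fun x _ hx => by simp [hx]) (by simp),
    Finset.sum_eq_single k (fun y _ hy => by simp [hy]) (by simp)]
  simp
  ring

/-- Both sides are real-multilinear and alternating, so it is enough to compare them on the basis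
`e_j, i e_j`. There type (1,1) reduces everything to `ω(e_j, e_k)`, which is antisymmetric, and
`ω(e_j, i e_k)`, which is symmetric. -/
theorem complexify_eq {ω : C3 [⋀^Fin 2]→L[ℝ] ℝ}
    (hω : ∀ u v : C3, ω ![Complex.I • u, Complex.I • v] = ω ![u, v]) :
    complexify ω = ∑ j, covForm ![(Complex.I / 2) • dz j, ∑ k, hermMatrix ω j k • dzBar k] := by
  refine realBasis.ext_alternating fun v _ => ?_
  rw [alternatingMap_sum_apply]
  have hl : complexify ω (fun i => realBasis (v i)) =
      (ω ![realBasis (v 0), realBasis (v 1)] : ℂ) := by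
    change ((ω (fun i => realBasis (v i)) : ℝ) : ℂ) = _
    congr 2
    funext i
    fin_cases i <;> rfl
  have hsingle : ∀ j : Fin 3, (Pi.single j Complex.I : C3) = Complex.I • Pi.single j 1 :=
    fun j => by rw [← Pi.single_smul]; simp
  rw [hl]
  simp only [covForm_two_apply, LinearMap.smul_apply, LinearMap.sum_apply, dz_apply, dzBar_apply,
    smul_eq_mul]
  obtain ⟨a, ha⟩ : ∃ a : Fin 3 → Fin 3 → ℝ, ∀ j k, ω ![Pi.single j 1, Pi.single k 1] = a j k :=
    ⟨_, fun _ _ => rfl⟩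
  obtain ⟨b, hb⟩ : ∃ b : Fin 3 → Fin 3 → ℝ,
      ∀ j k, ω ![Pi.single j 1, Complex.I • Pi.single k 1] = b j k := ⟨_, fun _ _ => rfl⟩
  have ha' : ∀ j k, a k j = -a j k := fun j k => by rw [← ha, ← ha, form_swap]
  have hb' : ∀ j k, b k j = b j k := fun j k => by rw [← hb, ← hb, form_I_symm hω]
  have hh : ∀ j k, hermMatrix ω j k = b j k - Complex.I * a j k := fun j k => by
    rw [← ha, ← hb]; rfl
  have hone : ∀ j : Fin 3, (Pi.single j 1 : C3) = (1 : ℂ) • Pi.single j 1 :=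
    fun j => (one_smul _ _).symm
  rw [Finset.sum_sub_distrib]
  rcases v 0 with j | j <;> rcases v 1 with k | k <;>
    simp only [realBasis_inl, realBasis_inr, hsingle, hω, form_I_left hω, ha, hb] <;>
    [rw [hone j, hone k]; rw [hone j]; rw [hone k]; skip] <;>
    rw [sum_hermitian_single, sum_hermitian_single, hh, hh, ha' j k, hb' j k] <;>
    simp only [map_one, Complex.conj_I, Complex.ofReal_neg]
  · linear_combination (a j k : ℂ) * Complex.I_sq
  · linear_combination (b j k : ℂ) * Complex.I_sq
  · linear_combination -(b j k : ℂ) * Complex.I_sq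
  · linear_combination (a j k : ℂ) * (1 - Complex.I ^ 2) * Complex.I_sq

theorem cube_eq {ω : C3 [⋀^Fin 2]→L[ℝ] ℝ}
    (hω : ∀ u v : C3, ω ![Complex.I • u, Complex.I • v] = ω ![u, v]) :
    cube ω = (-6 * (Complex.I / 2) ^ 3 * (hermMatrix ω).det) • topForm :=
  wedge_cube_eq _ _ _ (complexify_eq hω)

theorem realify_eq {Ω : C3 [⋀^Fin 3]→L[ℂ] ℂ} {Γ : ℂ} (hΩ : ∀ v, Ω v = Γ * dz123 v) :
    realify Ω = Γ • covForm dz := by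
  ext v
  rw [AlternatingMap.smul_apply, covForm_eq_det, ← Matrix.det_transpose]
  exact hΩ v

theorem conjForm_realify_eq {Ω : C3 [⋀^Fin 3]→L[ℂ] ℂ} {Γ : ℂ} (hΩ : ∀ v, Ω v = Γ * dz123 v) :
    conjForm (realify Ω) = (starRingEnd ℂ) Γ • covForm dzBar := by
  ext v
  rw [realify_eq hΩ, AlternatingMap.smul_apply, covForm_eq_det]
  change (starRingEnd ℂ) (Γ * covForm dz v) = _
  rw [map_mul, covForm_eq_det, RingHom.map_det]
  rfl

theorem wedgeConj_eq {Ω : C3 [⋀^Fin 3]→L[ℂ] ℂ} {Γ : ℂ} (hΩ : ∀ v, Ω v = Γ * dz123 v) :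
    wedgeConj Ω = (Γ * (starRingEnd ℂ) Γ) • topForm := by
  -- The exterior product is built from the real tensor product, so the complex factor `Γ` cannot be
  -- pulled out by bilinearity. A cube root of it is absorbed into each of the three one-forms
  -- instead.
  obtain ⟨c, hc⟩ := IsAlgClosed.exists_pow_nat_eq Γ (n := 3) (by norm_num)
  rw [wedgeConj, conjForm_realify_eq hΩ, realify_eq hΩ, ← hc, map_pow, ← covForm_smul,
    ← covForm_smul, wedge_covForm]
  refine AlternatingMap.ext fun v => ?_
  rw [AlternatingMap.smul_apply, topForm_apply, covForm_append_apply, smul_eq_mul]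
  have key := detSix_append_smul_sum c ((starRingEnd ℂ) c • 1) (fun j m => dz j (v m))
    fun j m => dzBar j (v m)
  rw [Matrix.det_smul, Matrix.det_one, Fintype.card_fin, mul_one] at key
  rw [← key]
  congr 2
  funext j m
  rw [Finset.sum_eq_single j (fun k _ hk => by simp [Matrix.one_apply_ne' hk]) (by simp)]
  simp

/-- The volume equation in terms of the Hermitian matrix. -/
theorem volume_eq {ω : C3 [⋀^Fin 2]→L[ℝ] ℝ} {Ω : C3 [⋀^Fin 3]→L[ℂ] ℂ} {Γ : ℂ}
    (hω : ∀ u v : C3, ω ![Complex.I • u, Complex.I • v] = ω ![u, v])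
    (hΩ : ∀ v, Ω v = Γ * dz123 v) (h : (hermMatrix ω).det = Γ * (starRingEnd ℂ) Γ) :
    ((1 : ℂ) / (Nat.factorial 3 : ℂ)) • cube ω = (-((Complex.I / 2) ^ 3)) • wedgeConj Ω := by
  rw [cube_eq hω, wedgeConj_eq hΩ, h, smul_smul, smul_smul]
  congr 1
  norm_num [Nat.factorial]
  ring

end Hermitian

/-! ### The Kähler form of a potential -/

section KahlerForm

/-- Multiplication by `i`, as a real-linear map. -/
def mulI : C3 →L[ℝ] C3 := (Complex.I • ContinuousLinearMap.id ℂ C3).restrictScalars ℝ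

/-- The 1-form `-df ∘ J`. -/
def potentialForm (f : C3 → ℝ) (z : C3) : C3 [⋀^Fin 1]→L[ℝ] ℝ :=
  ContinuousAlternatingMap.ofSubsingletonLIE (𝕜 := ℝ) (E := C3) (F := ℝ) (0 : Fin 1)
    (-(fderiv ℝ f z).comp mulI)

theorem potentialForm_apply (f : C3 → ℝ) (z : C3) (v : Fin 1 → C3) :
    potentialForm f z v = -fderiv ℝ f z (Complex.I • v 0) := rfl

/-- The 2-form with potential `f`. -/
def kahlerForm (f : C3 → ℝ) : C3 → C3 [⋀^Fin 2]→L[ℝ] ℝ := extDeriv (potentialForm f)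

variable {f : C3 → ℝ} {z : C3}

theorem secondDeriv_eq (hf : AnalyticAt ℝ f z) (u v : C3) :
    secondDeriv f z u v = fderiv ℝ (fderiv ℝ f) z u v := by
  rw [secondDeriv, fderiv_clm_apply hf.fderiv.differentiableAt (differentiableAt_const u)]
  have h := (hf.contDiffAt (n := ⊤)).isSymmSndFDerivAt_of_omega v u
  simpa using h

theorem secondDeriv_symm (hf : AnalyticAt ℝ f z) (u v : C3) :
    secondDeriv f z u v = secondDeriv f z v u := by
  rw [secondDeriv_eq hf, secondDeriv_eq hf]
  exact (hf.contDiffAt (n := ⊤)).isSymmSndFDerivAt_of_omega u v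

theorem analyticAt_potentialForm (hf : AnalyticAt ℝ f z) :
    AnalyticAt ℝ (potentialForm f) z := by
  let T : (C3 →L[ℝ] ℝ) →L[ℝ] (C3 [⋀^Fin 1]→L[ℝ] ℝ) :=
    (ContinuousAlternatingMap.ofSubsingletonLIE (𝕜 := ℝ) (E := C3) (F := ℝ)
      (0 : Fin 1)).toContinuousLinearEquiv.toContinuousLinearMap.comp
      (-(ContinuousLinearMap.compL ℝ C3 C3 ℝ).flip mulI)
  exact (T.analyticAt _).comp hf.fderiv

theorem analyticAt_kahlerForm (hf : AnalyticAt ℝ f z) : AnalyticAt ℝ (kahlerForm f) z := by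
  have h : AnalyticAt ℝ (fun w => ContinuousAlternatingMap.alternatizeUncurryFinCLM (n := 1) ℝ C3 ℝ
      (fderiv ℝ (potentialForm f) w)) z :=
    ((ContinuousAlternatingMap.alternatizeUncurryFinCLM (n := 1) ℝ C3 ℝ).analyticAt _).fun_comp
      (analyticAt_potentialForm hf).fderiv
  exact h

theorem extDeriv_kahlerForm (hf : AnalyticAt ℝ f z) : extDeriv (kahlerForm f) z = 0 :=
  extDeriv_extDeriv_apply ((analyticAt_potentialForm hf).contDiffAt (n := ⊤)) le_top

theorem kahlerForm_apply (hf : AnalyticAt ℝ f z) (u v : C3) :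
    kahlerForm f z ![u, v] =
      secondDeriv f z (Complex.I • u) v - secondDeriv f z (Complex.I • v) u := by
  have h : ∀ w x : C3, fderiv ℝ (fun y => fderiv ℝ f y (Complex.I • w)) z x =
      secondDeriv f z (Complex.I • w) x := fun w x => rfl
  rw [kahlerForm, extDeriv_apply (analyticAt_potentialForm hf).differentiableAt]
  simp only [potentialForm_apply]
  simp [Fin.removeNth, h]
  ring

theorem kahlerForm_type (hf : AnalyticAt ℝ f z) (u v : C3) :
    kahlerForm f z ![Complex.I • u, Complex.I • v] = kahlerForm f z ![u, v] := by
  rw [kahlerForm_apply hf, kahlerForm_apply hf, smul_smul, smul_smul, Complex.I_mul_I]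
  simp only [secondDeriv_eq hf]
  have h := (hf.contDiffAt (n := ⊤)).isSymmSndFDerivAt_of_omega
  rw [neg_one_smul, neg_one_smul, map_neg, map_neg, h (Complex.I • u), h (Complex.I • v)]
  simp
  ring

/-- The associated metric is the real Hessian of `f` plus its pullback under `J`; symmetry of the
second derivative gives this form. Positivity is checked through it. -/
theorem kahlerForm_apply_I (hf : AnalyticAt ℝ f z) (u v : C3) :
    kahlerForm f z ![u, Complex.I • v] =
      secondDeriv f z (Complex.I • u) (Complex.I • v) + secondDeriv f z u v := by
  rw [kahlerForm_apply hf, smul_smul, Complex.I_mul_I, secondDeriv_symm hf u v]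
  simp only [secondDeriv_eq hf]
  rw [neg_one_smul, map_neg]
  simp

/-- The Hermitian matrix with the given entries. -/
def hermOf (v : Fin 9 → ℝ) : Matrix (Fin 3) (Fin 3) ℂ :=
  !![(v 0 : ℂ), v 2 + Complex.I * v 3, v 4 + Complex.I * v 6;
    v 2 - Complex.I * v 3, v 1, v 5 + Complex.I * v 7;
    v 4 - Complex.I * v 6, v 5 - Complex.I * v 7, v 8]

theorem det_hermOf (v : Fin 9 → ℝ) : (hermOf v).det = ((hermDet v : ℝ) : ℂ) := by
  rw [Matrix.det_fin_three]
  simp [hermOf, hermDet, minorOf, restOf]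
  ring_nf
  simp only [Complex.I_sq]
  ring

/-- This links geometry and equation: the Hermitian matrix that governs `ω³` is the complex Hessian
whose determinant is prescribed. -/
theorem hermMatrix_kahlerForm (hf : AnalyticAt ℝ f z) :
    hermMatrix (kahlerForm f z) = hermOf (hessFun f z) := by
  have hI : ∀ j : Fin 3, (Complex.I • Pi.single j 1 : C3) = realBasis (.inr j) := fun j => by
    rw [realBasis_inr, ← Pi.single_smul]; simp
  have h : ∀ j k, hermMatrix (kahlerForm f z) j k =
      ((secondDeriv f z (realBasis (.inl j)) (realBasis (.inl k)) +
        secondDeriv f z (realBasis (.inr j)) (realBasis (.inr k)) : ℝ) : ℂ) +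
      Complex.I * ((secondDeriv f z (realBasis (.inl j)) (realBasis (.inr k)) -
        secondDeriv f z (realBasis (.inr j)) (realBasis (.inl k)) : ℝ) : ℂ) := fun j k => by
    rw [hermMatrix, Matrix.of_apply, kahlerForm_apply_I hf, kahlerForm_apply hf, hI, hI,
      ← realBasis_inl, ← realBasis_inl,
      secondDeriv_symm hf (realBasis (.inr k)) (realBasis (.inl j))]
    push_cast
    ring
  have hs := fun a c => secondDeriv_symm hf (realBasis a) (realBasis c)
  ext j k
  rw [h]
  fin_cases j <;> fin_cases k <;> simp [hermOf, hessFun, hessEntries]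
  all_goals
    simp only [hs (.inr _) (.inl _), hs (.inl 1) (.inl 0), hs (.inl 2) (.inl 0),
      hs (.inl 2) (.inl 1), hs (.inr 1) (.inr 0), hs (.inr 2) (.inr 0), hs (.inr 2) (.inr 1)]
    ring

/-- The positivity of the form at a point spreads to a neighbourhood. -/
theorem eventually_kahlerForm_pos (hf : AnalyticAt ℝ f z)
    (hpos : ∀ u : C3, u ≠ 0 → 0 < kahlerForm f z ![u, Complex.I • u]) :
    ∀ᶠ w in 𝓝 z, ∀ u : C3, u ≠ 0 → 0 < kahlerForm f w ![u, Complex.I • u] := by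
  -- Positivity on the compact unit sphere is stable under small changes of the base point.
  -- Homogeneity of degree two in `u` then gives all nonzero vectors.
  have hev : ∀ᶠ w in 𝓝 z, ∀ u ∈ Metric.sphere (0 : C3) 1,
      0 < fderiv ℝ (fderiv ℝ f) w (mulI u) (mulI u) + fderiv ℝ (fderiv ℝ f) w u u := by
    refine (isCompact_sphere (0 : C3) 1).eventually_forall_of_forall_eventually fun u hu => ?_
    have hB : ContinuousAt (fun x : C3 × C3 => fderiv ℝ (fderiv ℝ f) x.1) (z, u) :=
      hf.fderiv.fderiv.continuousAt.comp continuousAt_fst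
    have hJ : ContinuousAt (fun x : C3 × C3 => mulI x.2) (z, u) :=
      mulI.continuous.continuousAt.comp continuousAt_snd
    refine (((hB.clm_apply hJ).clm_apply hJ).add
      ((hB.clm_apply continuousAt_snd).clm_apply continuousAt_snd)).eventually (lt_mem_nhds ?_)
    have h := hpos u (fun h0 => by simp [h0] at hu)
    rwa [kahlerForm_apply_I hf, secondDeriv_eq hf, secondDeriv_eq hf] at h
  filter_upwards [hev, hf.eventually_analyticAt] with w hw hfw u hu
  have hn : ‖u‖ ≠ 0 := norm_ne_zero_iff.2 hu
  have h := hw (‖u‖⁻¹ • u) (by simp [norm_smul, hn])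
  rw [kahlerForm_apply_I hfw, secondDeriv_eq hfw, secondDeriv_eq hfw]
  simp only [map_smul, smul_apply, smul_eq_mul, ← mul_add] at h
  exact (mul_pos_iff_of_pos_left (by positivity)).1 ((mul_pos_iff_of_pos_left (by positivity)).1 h)

end KahlerForm

/-! ### The form at a real point, where its Hermitian matrix is real -/

section RealPoints

variable {ω : C3 [⋀^Fin 2]→L[ℝ] ℝ} {G : Matrix (Fin 3) (Fin 3) ℝ}

theorem form_apply_eq (hω : ∀ u v : C3, ω ![Complex.I • u, Complex.I • v] = ω ![u, v])
    (u v : C3) : (ω ![u, v] : ℂ) = Complex.I / 2 * ∑ j, ∑ k, hermMatrix ω j k *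
      (u j * (starRingEnd ℂ) (v k) - v j * (starRingEnd ℂ) (u k)) := by
  change complexify ω ![u, v] = _
  rw [complexify_eq hω, alternatingMap_sum_apply, Finset.mul_sum]
  refine Finset.sum_congr rfl fun j _ => ?_
  rw [covForm_two_apply]
  simp only [LinearMap.smul_apply, LinearMap.sum_apply, dz_apply, dzBar_apply, smul_eq_mul,
    Matrix.cons_val_zero, Matrix.cons_val_one, mul_sub, Finset.sum_sub_distrib, Finset.mul_sum]
  congr 1 <;> exact Finset.sum_congr rfl fun k _ => by ring

/-- On real vectors `ω` is the antisymmetrization of its Hermitian matrix, which vanishes for a real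
symmetric one. This is the Lagrangian condition. -/
theorem form_incl_incl (hω : ∀ u v : C3, ω ![Complex.I • u, Complex.I • v] = ω ![u, v])
    (hG : G.IsSymm) (h : hermMatrix ω = G.map Complex.ofReal) (u v : R3) :
    ω ![incl u, incl v] = 0 := by
  have h1 := form_apply_eq hω (incl u) (incl v)
  rw [h] at h1
  have h2 := fun j k => congrArg (fun M => M j k) hG
  simp only [Matrix.transpose_apply] at h2
  simp only [Matrix.map_apply, incl_apply, Complex.conj_ofReal, Fin.sum_univ_three] at h1
  rw [h2 1 0, h2 2 0, h2 2 1] at h1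
  have h3 : (ω ![incl u, incl v] : ℂ) = 0 := h1.trans (by ring)
  exact_mod_cast h3

theorem form_incl_I_incl (hω : ∀ u v : C3, ω ![Complex.I • u, Complex.I • v] = ω ![u, v])
    (hG : G.IsSymm) (h : hermMatrix ω = G.map Complex.ofReal) (u v : R3) :
    ω ![incl u, Complex.I • incl v] = ∑ i, ∑ j, G i j * u i * v j := by
  have h1 := form_apply_eq hω (incl u) (Complex.I • incl v)
  rw [h] at h1
  have h2 := fun j k => congrArg (fun M => M j k) hG
  simp only [Matrix.transpose_apply] at h2
  simp only [Matrix.map_apply, incl_apply, Complex.conj_ofReal, Fin.sum_univ_three, Pi.smul_apply,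
    smul_eq_mul, map_mul, Complex.conj_I] at h1
  rw [h2 1 0, h2 2 0, h2 2 1] at h1
  have h3 : (ω ![incl u, Complex.I • incl v] : ℂ) =
      ((∑ i, ∑ j, G i j * u i * v j : ℝ) : ℂ) := h1.trans (by
    simp only [Fin.sum_univ_three]
    rw [h2 1 0, h2 2 0, h2 2 1]
    push_cast
    ring_nf
    simp only [Complex.I_sq]
    ring)
  exact_mod_cast h3

/-- For `u = x + iy` the mixed terms reduce to values of `ω` on pairs of real vectors and vanish.
What remains is the quadratic form of `G` at `x` plus its value at `y`. -/
theorem form_pos (hω : ∀ u v : C3, ω ![Complex.I • u, Complex.I • v] = ω ![u, v])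
    (hG : G.PosDef) (h : hermMatrix ω = G.map Complex.ofReal) {u : C3} (hu : u ≠ 0) :
    0 < ω ![u, Complex.I • u] := by
  have hs : G.IsSymm := by
    have := hG.isHermitian
    rwa [Matrix.IsHermitian, Matrix.conjTranspose_eq_transpose_of_trivial] at this
  set x := rePart u with hx
  set y : R3 := fun j => (u j).im with hy
  have hu' : u = incl x + Complex.I • incl y := by
    ext j
    simp [hx, hy, rePart, mul_comm Complex.I, Complex.re_add_im]
  have key : ∀ w : R3, w ≠ 0 → 0 < ω ![incl w, Complex.I • incl w] := fun w hw => by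
    rw [form_incl_I_incl hω hs h]
    have := hG.dotProduct_mulVec_pos hw
    simp only [dotProduct, Matrix.mulVec, Finset.mul_sum] at this
    refine this.trans_eq ?_
    refine Finset.sum_congr rfl fun i _ => Finset.sum_congr rfl fun j _ => ?_
    simp
    ring
  have key' : ∀ w : R3, 0 ≤ ω ![incl w, Complex.I • incl w] := fun w => by
    by_cases hw : w = 0
    · rw [form_incl_I_incl hω hs h]
      simp [hw]
    · exact (key w hw).le
  have hsplit : ω ![u, Complex.I • u] =
      ω ![incl x, Complex.I • incl x] + ω ![incl y, Complex.I • incl y] := by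
    rw [hu', smul_add, smul_smul, Complex.I_mul_I, neg_one_smul, form_add_right, form_add_left,
      form_neg_right, form_add_left, hω, form_I_left hω, form_incl_incl hω hs h,
      form_incl_incl hω hs h]
    ring
  rw [hsplit]
  by_cases hx0 : x = 0
  · have hy0 : y ≠ 0 := fun hy0 => hu (by rw [hu', hx0, hy0]; simp)
    exact add_pos_of_nonneg_of_pos (key' x) (key y hy0)
  · exact add_pos_of_pos_of_nonneg (key x hx0) (key' y)

end RealPoints

/-! ### The initial potential `½ ∑ g_jk(x) y_j y_k` -/

section InitialData

/-- The function `½ ∑ g_jk(x) y_j y_k`. -/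
def metricPotential (g : R3 → Matrix (Fin 3) (Fin 3) ℝ) (z : C3) : ℝ :=
  ∑ j, ∑ k, 1 / 2 * g (rePart z) j k * ((z j).im * (z k).im)

/-- The entries of a real symmetric matrix, as a Hermitian one. -/
def metricEntries (M : Matrix (Fin 3) (Fin 3) ℝ) : Fin 9 → ℝ :=
  ![M 0 0, M 1 1, M 0 1, 0, M 0 2, M 1 2, 0, 0, M 2 2]

theorem hermOf_metricEntries {M : Matrix (Fin 3) (Fin 3) ℝ} (hM : M.IsSymm) :
    hermOf (metricEntries M) = M.map Complex.ofReal := by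
  have h := fun j k => congrArg (fun M => M j k) hM
  simp only [Matrix.transpose_apply] at h
  ext j k
  fin_cases j <;> fin_cases k <;>
    simp [hermOf, metricEntries, h 1 0, h 2 0, h 2 1]

theorem hermDet_metricEntries {M : Matrix (Fin 3) (Fin 3) ℝ} (hM : M.IsSymm) :
    hermDet (metricEntries M) = M.det := by
  have h := det_hermOf (metricEntries M)
  rw [hermOf_metricEntries hM] at h
  have h1 : (M.map Complex.ofReal).det = ((M.det : ℝ) : ℂ) := (Complex.ofRealHom.map_det M).symm
  rw [h1] at h
  exact_mod_cast h.symm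

theorem isSymm_of_posDef {M : Matrix (Fin 3) (Fin 3) ℝ} (hM : M.PosDef) : M.IsSymm := by
  have h := hM.isHermitian
  rwa [Matrix.IsHermitian, Matrix.conjTranspose_eq_transpose_of_trivial] at h

theorem minorOf_metricEntries_ne_zero {M : Matrix (Fin 3) (Fin 3) ℝ} (hM : M.PosDef) :
    minorOf (metricEntries M) ≠ 0 := by
  intro h0
  have h00 : 0 < M 0 0 := hM.diag_pos
  have hs : M 1 0 = M 0 1 := congrArg (fun N => N 0 1) (isSymm_of_posDef hM)
  -- On this vector the quadratic form takes the value `M₀₀ (M₀₀ M₁₁ - M₀₁²)`, so positive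
  -- definiteness makes the minor positive.
  have hx : (![-M 0 1, M 0 0, 0] : R3) ≠ 0 := fun h => by
    have := congrFun h 1
    simp at this
    exact h00.ne' this
  have h := hM.dotProduct_mulVec_pos hx
  simp [Matrix.mulVec, dotProduct, Fin.sum_univ_three, hs] at h
  simp [minorOf, metricEntries] at h0
  nlinarith

theorem analyticAt_rePart (z : C3) : AnalyticAt ℝ rePart z :=
  (ContinuousLinearMap.pi fun i : Fin 3 => Complex.reCLM.comp
    (ContinuousLinearMap.proj (R := ℝ) (φ := fun _ : Fin 3 => ℂ) i)).analyticAt z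

variable {U : Set R3} {g : R3 → Matrix (Fin 3) (Fin 3) ℝ} {p : R3}

theorem analyticAt_coefficient (hg : IsAnalyticMetric U g) (hp : p ∈ U) (j k : Fin 3) :
    AnalyticAt ℝ (fun z => 1 / 2 * g (rePart z) j k) (incl p) :=
  analyticAt_const.fun_mul ((hg.analytic j k p hp).fun_comp
    (f := rePart) (analyticAt_rePart (incl p)))

theorem hasExpansion_metricPotential (hg : IsAnalyticMetric U g) (hp : p ∈ U) :
    ∃ A : Fin 3 → Fin 3 → MvPowerSeries RealIndex ℝ,
      (∀ j k, constantCoeff (A j k) = 1 / 2 * g p j k) ∧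
      HasExpansion realBasis (∑ j, ∑ k, A j k * (X (.inr j) * X (.inr k))) (metricPotential g)
        (incl p) := by
  choose A hA using fun j k => exists_hasExpansion_of_analyticAt realBasis
    (analyticAt_coefficient hg hp j k)
  refine ⟨A, fun j k => (hA j k).constantCoeff_eq, ?_⟩
  have hX : ∀ j : Fin 3, HasExpansion realBasis (X (.inr j)) (fun z => (z j).im) (incl p) :=
    fun j => by
      have h := hasExpansion_coord realBasis (.inr j) (incl p)
      have h1 : (fun z => realBasis.equivFun (z - incl p) (.inr j)) = fun z : C3 => (z j).im := by
        ext z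
        rw [realBasis_equivFun, realCoords_inr]
        simp
      rwa [h1] at h
  exact HasExpansion.sum _ fun j _ => HasExpansion.sum _ fun k _ => (hA j k).mul ((hX j).mul (hX k))

/-- Any term in which a derivative falls on `A` keeps a factor `X i` or `X j` and has no constant
term. -/
theorem constantCoeff_pderiv_pderiv {σ : Type*} [DecidableEq σ] (A : MvPowerSeries σ ℝ)
    (i j a c : σ) : constantCoeff (pderiv ℝ c (pderiv ℝ a (A * (X i * X j)))) =
      constantCoeff A * ((if i = a ∧ j = c then 1 else 0) + if i = c ∧ j = a then 1 else 0) := by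
  simp only [Derivation.leibniz, smul_eq_mul, map_add, map_mul, constantCoeff_X, pderiv_X,
    Pi.single_apply]
  have h : ∀ i j : σ, constantCoeff (if i = j then (1 : MvPowerSeries σ ℝ) else 0) =
      if i = j then 1 else 0 := fun i j => by split_ifs <;> simp
  simp only [h, ite_and]
  split_ifs <;> simp

/-- The potential is quadratic in `y`, so at `y = 0` only the `y`-`y` derivatives survive. The
factor `½` offsets the two equal contributions of `(j, k)` and `(k, j)`. -/
theorem hessFun_metricPotential (hg : IsAnalyticMetric U g) (hp : p ∈ U) :
    hessFun (metricPotential g) (incl p) = metricEntries (g p) := by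
  obtain ⟨A, hA, hu⟩ := hasExpansion_metricPotential hg hp
  have hs := fun j k => congrArg (fun M => M j k) (isSymm_of_posDef (hg.posDef p hp))
  simp only [Matrix.transpose_apply] at hs
  have h : ∀ a c, secondDeriv (metricPotential g) (incl p) (realBasis a) (realBasis c) =
      Sum.elim (fun _ => 0) (fun j => Sum.elim (fun _ => 0) (fun k => g p j k) c) a := fun a c => by
    have h1 := ((hu.fderiv a).fderiv c).constantCoeff_eq
    refine h1.symm.trans ?_
    simp only [map_sum, constantCoeff_pderiv_pderiv, hA]
    rcases a with a | a <;> rcases c with c | c <;> simp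
    simp only [mul_add, Finset.sum_add_distrib, ite_and, mul_ite, mul_one, mul_zero]
    simp [hs c a]
    ring
  rw [hessFun]
  simp only [h]
  funext i
  fin_cases i <;> simp [hessEntries, metricEntries]

theorem cauchyData (hg : IsAnalyticMetric U g) (hp : p ∈ U) {Γ : C3 → ℂ}
    (hΓ : AnalyticAt ℂ Γ (incl p)) (hΓ' : Γ (incl p) = (Real.sqrt (g p).det : ℂ)) :
    CauchyData (metricPotential g) (fun z => Complex.normSq (Γ z)) (incl p) where
  im_eq_zero := by simp
  analyticAt := by
    obtain ⟨A, -, hu⟩ := hasExpansion_metricPotential hg hp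
    exact hu.analyticAt
  analyticAt_rhs := by
    have h := hΓ.restrictScalars (𝕜 := ℝ)
    have hre := (Complex.reCLM.analyticAt _).fun_comp h
    have him := (Complex.imCLM.analyticAt _).fun_comp h
    exact (hre.fun_mul hre).fun_add (him.fun_mul him)
  minor_ne_zero := by
    rw [hessFun_metricPotential hg hp]
    exact minorOf_metricEntries_ne_zero (hg.posDef p hp)
  hermDet_eq := by
    rw [hessFun_metricPotential hg hp, hermDet_metricEntries (isSymm_of_posDef (hg.posDef p hp)),
      hΓ', Complex.normSq_ofReal, Real.mul_self_sqrt (hg.posDef p hp).det_pos.le]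

end InitialData

/-! ### The potential on a standard complexification -/

section Global

variable {U : Set R3} {g : R3 → Matrix (Fin 3) (Fin 3) ℝ}

theorem analyticAt_potential {f₀ k : C3 → ℝ} {z : C3} (h₀ : AnalyticAt ℝ f₀ z)
    (hk : AnalyticAt ℝ k z) : AnalyticAt ℝ (potential f₀ k) z := by
  have him : AnalyticAt ℝ (fun w : C3 => (w 2).im) z :=
    (Complex.imCLM.comp
      (ContinuousLinearMap.proj (R := ℝ) (φ := fun _ : Fin 3 => ℂ) 2)).analyticAt z
  exact h₀.fun_add ((him.fun_pow 2).fun_mul hk)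

theorem kahlerForm_congr {f f' : C3 → ℝ} {z : C3} (h : f =ᶠ[𝓝 z] f') :
    kahlerForm f z = kahlerForm f' z := by
  refine Filter.EventuallyEq.extDeriv_eq ?_
  filter_upwards [h.fderiv (𝕜 := ℝ)] with w hw
  rw [potentialForm, potentialForm, hw]

theorem kahlerForm_pos_of_hessFun (hg : IsAnalyticMetric U g) {p : R3} (hp : p ∈ U) {f : C3 → ℝ}
    (hf : AnalyticAt ℝ f (incl p)) (h : hessFun f (incl p) = metricEntries (g p)) (u : C3)
    (hu : u ≠ 0) : 0 < kahlerForm f (incl p) ![u, Complex.I • u] := by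
  refine form_pos (kahlerForm_type hf) (hg.posDef p hp) ?_ hu
  rw [hermMatrix_kahlerForm hf, h, hermOf_metricEntries (isSymm_of_posDef (hg.posDef p hp))]

/-- What is required of the potential `k` of a local solution at a point `z`. -/
structure GoodAt (f₀ k : C3 → ℝ) (Γ : C3 → ℂ) (z : C3) : Prop where
  analyticAt_init : AnalyticAt ℝ f₀ z
  analyticAt : AnalyticAt ℝ k z
  analyticAt_density : AnalyticAt ℂ Γ z
  density_ne_zero : Γ z ≠ 0
  hermDet_eq : hermDet (hessFun (potential f₀ k) z) = Complex.normSq (Γ z)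
  pos : ∀ u : C3, u ≠ 0 → 0 < kahlerForm (potential f₀ k) z ![u, Complex.I • u]

theorem potential_congr {f₀ k k' : C3 → ℝ} {z : C3} (h : k =ᶠ[𝓝 z] k') :
    potential f₀ k =ᶠ[𝓝 z] potential f₀ k' := by
  filter_upwards [h] with w hw
  rw [potential, potential, hw]

theorem GoodAt.congr {f₀ k k' : C3 → ℝ} {Γ : C3 → ℂ} {z : C3} (h : GoodAt f₀ k Γ z)
    (hk : k =ᶠ[𝓝 z] k') : GoodAt f₀ k' Γ z where
  analyticAt_init := h.analyticAt_init
  analyticAt := h.analyticAt.congr hk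
  analyticAt_density := h.analyticAt_density
  density_ne_zero := h.density_ne_zero
  hermDet_eq := by
    rw [← hessFun_congr (potential_congr hk)]
    exact h.hermDet_eq
  pos := by
    rw [← kahlerForm_congr (potential_congr hk)]
    exact h.pos

theorem exists_eventually_goodAt (hg : IsAnalyticMetric U g) {Γ : C3 → ℂ} {p : R3} (hp : p ∈ U)
    (hΓ : AnalyticAt ℂ Γ (incl p)) (hΓ' : Γ (incl p) = (Real.sqrt (g p).det : ℂ)) :
    ∃ k, ∀ᶠ z in 𝓝 (incl p), GoodAt (metricPotential g) k Γ z := by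
  have hC := cauchyData hg hp hΓ hΓ'
  obtain ⟨k, hk⟩ := hC.exists_isLocalSolution
  have hf := analyticAt_potential hC.analyticAt hk.analyticAt
  have hne : Γ (incl p) ≠ 0 := by
    rw [hΓ']
    exact_mod_cast (Real.sqrt_pos.2 (hg.posDef p hp).det_pos).ne'
  have hpos := eventually_kahlerForm_pos hf (kahlerForm_pos_of_hessFun hg hp hf
    ((hk.hessFun_eq hC).trans (hessFun_metricPotential hg hp)))
  refine ⟨k, ?_⟩
  filter_upwards [hC.analyticAt.eventually_analyticAt, hk.analyticAt.eventually_analyticAt,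
    hΓ.eventually_analyticAt, hΓ.continuousAt.eventually_ne hne, hk.eventually_eq, hpos]
    with z h1 h2 h3 h4 h5 h6
  exact ⟨h1, h2, h3, h4, h5, h6⟩

/-- The potential on a standard complexification. -/
theorem exists_potential (hU : IsOpen U) (hg : IsAnalyticMetric U g) :
    ∃ (UC : Set C3) (Γ : C3 → ℂ) (k : C3 → ℝ), IsStandardComplexification U UC ∧
      (∀ x ∈ U, Γ (incl x) = (Real.sqrt (g x).det : ℂ)) ∧
      (∀ z ∈ UC, GoodAt (metricPotential g) k Γ z) ∧
      (∀ x ∈ U, hessFun (potential (metricPotential g) k) (incl x) = metricEntries (g x)) ∧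
      ∀ F F' : C3 → ℂ, DifferentiableOn ℂ F UC → DifferentiableOn ℂ F' UC →
        (∀ x ∈ U, F (incl x) = F' (incl x)) → Set.EqOn F F' UC := by
  obtain ⟨Γ, hΓ, hΓ'⟩ := exists_density hU hg
  have hloc : ∀ p : R3, ∃ (k : C3 → ℝ) (r : ℝ), p ∈ U → 0 < r ∧
      (∀ z ∈ Metric.ball (incl p) r, GoodAt (metricPotential g) k Γ z) ∧
      ∀ x, incl x ∈ Metric.ball (incl p) r → x ∈ U := fun p => by
    by_cases hp : p ∈ U
    · obtain ⟨k, hk⟩ := exists_eventually_goodAt hg hp (hΓ p hp) (hΓ' p hp)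
      obtain ⟨r, hr, h⟩ := exists_ball_of_eventually hk (hU.eventually_mem hp)
      exact ⟨k, r, fun _ => ⟨hr, h⟩⟩
    · exact ⟨0, 0, fun h => absurd h hp⟩
  choose κ r hr using hloc
  -- The solution built at `p` solves the Cauchy problem at every real point of its ball, because
  -- `f₀` and `Γ` are the same globally. This allows the comparison with the solution built at that
  -- other point.
  have hsol : ∀ p ∈ U, ∀ x, incl x ∈ Metric.ball (incl p) (r p) →
      IsLocalSolution (metricPotential g) (fun z => Complex.normSq (Γ z)) (κ p) (incl x) :=
    fun p hp x hx => ⟨((hr p hp).2.1 _ hx).analyticAt, by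
      filter_upwards [Metric.isOpen_ball.mem_nhds hx] with z hz
      exact ((hr p hp).2.1 z hz).hermDet_eq⟩
  have hself : ∀ p ∈ U, incl p ∈ Metric.ball (incl p) (r p) :=
    fun p hp => Metric.mem_ball_self (hr p hp).1
  obtain ⟨k, hk⟩ := exists_glue (U := U) (r := r) (φ := κ)
    (fun p hp z hz => ((hr p hp).2.1 z hz).analyticAt) fun p hp x hx => by
      have hxU := (hr p hp).2.2 x hx
      exact (hsol p hp x hx).eventuallyEq (cauchyData hg hxU (hΓ x hxU) (hΓ' x hxU))
        (hsol x hxU x (hself x hxU))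
  have hev : ∀ p ∈ U, ∀ z ∈ Metric.ball (incl p) (r p), κ p =ᶠ[𝓝 z] k := fun p hp z hz =>
    ((hk p hp).eventuallyEq_of_mem (Metric.isOpen_ball.mem_nhds hz)).symm
  refine ⟨tube U r, Γ, k, isStandardComplexification_tube (fun p hp => (hr p hp).1)
    (fun p hp => (hr p hp).2.2), hΓ', fun z hz => ?_, fun x hx => ?_,
    fun F F' hF hF' h z hz => ?_⟩
  · obtain ⟨p, hp, hz⟩ := mem_tube.1 hz
    exact ((hr p hp).2.1 z hz).congr (hev p hp z hz)
  · rw [← hessFun_congr (potential_congr (hev x hx _ (hself x hx))),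
      (hsol x hx x (hself x hx)).hessFun_eq (cauchyData hg hx (hΓ x hx) (hΓ' x hx)),
      hessFun_metricPotential hg hx]
  · obtain ⟨p, hp, hz⟩ := mem_tube.1 hz
    have hsub : Metric.ball (incl p) (r p) ⊆ tube U r := fun w hw => mem_tube.2 ⟨p, hp, hw⟩
    exact eqOn_ball_of_eqOn_real (hF.mono hsub) (hF'.mono hsub)
      (fun x hx => h x ((hr p hp).2.2 x hx)) hz

end Global

/-! ### Calabi–Yau structure, special Lagrangian embedding and uniqueness of `Ω` -/

section Conclusion

variable {U : Set R3} {g : R3 → Matrix (Fin 3) (Fin 3) ℝ} {UC : Set C3} {Γ : C3 → ℂ}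

/-- The form `dz₁ ∧ dz₂ ∧ dz₃` as a continuous alternating map. -/
def volCLM : C3 [⋀^Fin 3]→L[ℂ] ℂ :=
  { dz123 with cont := Continuous.matrix_det (A := fun v : Matrix (Fin 3) (Fin 3) ℂ => v) continuous_id }

theorem smul_volCLM_apply (c : ℂ) (v : Fin 3 → C3) : (c • volCLM) v = c * dz123 v := rfl

theorem dz123_incl (v : Fin 3 → R3) :
    dz123 (fun i => incl (v i)) = ((Matrix.detRowAlternating v : ℝ) : ℂ) :=
  (Complex.ofRealHom.map_det (Matrix.of v)).symm

theorem restrict_smul_volCLM (c : ℝ) (v : Fin 3 → R3) :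
    ((c : ℂ) • volCLM) (fun i => incl (v i)) =
      ((c * (Matrix.detRowAlternating v : ℝ) : ℝ) : ℂ) := by
  rw [smul_volCLM_apply, dz123_incl, Complex.ofReal_mul]

theorem smul_volCLM_ne_zero {c : ℂ} (hc : c ≠ 0) : c • volCLM ≠ 0 := fun h => by
  have h1 := congrArg (fun T : C3 [⋀^Fin 3]→L[ℂ] ℂ => T (1 : Matrix (Fin 3) (Fin 3) ℂ)) h
  have h2 : dz123 (1 : Matrix (Fin 3) (Fin 3) ℂ) = 1 := Matrix.det_one
  have h3 : c * dz123 (1 : Matrix (Fin 3) (Fin 3) ℂ) = 0 := h1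
  rw [h2, mul_one] at h3
  exact hc h3

variable {f : C3 → ℝ}

theorem isKahlerForm_kahlerForm (hf : ∀ z ∈ UC, AnalyticAt ℝ f z)
    (hpos : ∀ z ∈ UC, ∀ u : C3, u ≠ 0 → 0 < kahlerForm f z ![u, Complex.I • u]) :
    IsKahlerForm UC (kahlerForm f) where
  smooth z hz := (analyticAt_kahlerForm (hf z hz)).contDiffAt.contDiffWithinAt
  closed z hz := extDeriv_kahlerForm (hf z hz)
  type_one_one z hz := kahlerForm_type (hf z hz)
  positive := hpos

theorem solves_kahlerForm (hg : IsAnalyticMetric U g) (hUC : IsStandardComplexification U UC)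
    (hΓ : DifferentiableOn ℂ Γ UC) (hΓ' : ∀ x ∈ U, Γ (incl x) = (Real.sqrt (g x).det : ℂ))
    (hf : ∀ z ∈ UC, AnalyticAt ℝ f z) (hω : IsKahlerForm UC (kahlerForm f))
    (hdet : ∀ z ∈ UC, hermDet (hessFun f z) = Complex.normSq (Γ z))
    (hreal : ∀ x ∈ U, hessFun f (incl x) = metricEntries (g x)) :
    Solves U g UC (fun z => Γ z • volCLM) (kahlerForm f) where
  holomorphic := hΓ.smul_const volCLM
  kahler := hω
  volume z hz := by
    refine volume_eq (Γ := Γ z) (kahlerForm_type (hf z hz)) (fun v => rfl) ?_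
    rw [hermMatrix_kahlerForm (hf z hz), det_hermOf, hdet z hz, Complex.mul_conj]
  induced x hx u v := by
    have hs := isSymm_of_posDef (hg.posDef x hx)
    have h := hf _ (hUC.incl_mem x hx)
    exact form_incl_I_incl (kahlerForm_type h) hs
      (by rw [hermMatrix_kahlerForm h, hreal x hx, hermOf_metricEntries hs]) u v
  restrict x hx v := by
    rw [hΓ' x hx]
    exact restrict_smul_volCLM _ v

theorem isCalabiYau_of_solves {Ω : C3 → C3 [⋀^Fin 3]→L[ℂ] ℂ} {ω : C3 → C3 [⋀^Fin 2]→L[ℝ] ℝ}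
    (hUC : IsOpen UC) (h : Solves U g UC Ω ω) (hne : ∀ z ∈ UC, Ω z ≠ 0) : IsCalabiYau UC Ω ω where
  isOpen := hUC
  holomorphic := h.holomorphic
  ne_zero := hne
  kahler := h.kahler
  volume := by
    refine ⟨6 * (-((Complex.I / 2) ^ 3)), fun z hz => ?_⟩
    rw [mul_smul, ← h.volume z hz, smul_smul]
    norm_num [Nat.factorial]

theorem fderiv_incl (x : R3) : fderiv ℝ incl x = incl := incl.fderiv

theorem incl_injective : Function.Injective incl := fun _ _ h => congrArg rePart h

theorem isSLagEmbedding_incl {Ω : C3 → C3 [⋀^Fin 3]→L[ℂ] ℂ} {ω : C3 → C3 [⋀^Fin 2]→L[ℝ] ℝ}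
    (hUC : IsStandardComplexification U UC) (h : Solves U g UC Ω ω)
    (hlag : ∀ x ∈ U, ∀ u v : R3, ω (incl x) ![incl u, incl v] = 0) :
    IsSLagEmbedding U g UC Ω ω incl where
  mapsTo := hUC.incl_mem
  smooth := incl.contDiff.contDiffOn
  immersion x _ := by
    rw [fderiv_incl]
    exact incl_injective
  embedding := by
    have h1 : Isometry incl := Isometry.of_dist_eq dist_incl
    exact h1.isEmbedding.comp Topology.IsEmbedding.subtypeVal
  isometric x hx u v := by
    rw [fderiv_incl]
    exact h.induced x hx u v
  calibrated x hx v := by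
    rw [fderiv_incl, h.restrict x hx v, Complex.ofReal_re]
  im_zero x hx v := by
    rw [fderiv_incl, h.restrict x hx v, Complex.ofReal_im]
  lagrangian x hx u v := by
    rw [fderiv_incl]
    exact hlag x hx u v

/-- Holomorphic volume forms which agree on the real points agree. -/
theorem Solves.eqOn {Ω Ω' : C3 → C3 [⋀^Fin 3]→L[ℂ] ℂ} {ω ω' : C3 → C3 [⋀^Fin 2]→L[ℝ] ℝ}
    (h : Solves U g UC Ω ω) (h' : Solves U g UC Ω' ω')
    (hid : ∀ F F' : C3 → ℂ, DifferentiableOn ℂ F UC → DifferentiableOn ℂ F' UC →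
        (∀ x ∈ U, F (incl x) = F' (incl x)) → Set.EqOn F F' UC) : Set.EqOn Ω' Ω UC := by
  have hincl : ∀ j : Fin 3, (Pi.basisFun ℂ (Fin 3) j : C3) = incl (Pi.single j 1) := fun j => by
    ext k
    by_cases hk : k = j <;> simp [hk]
  have hdiff : ∀ {Ω : C3 → C3 [⋀^Fin 3]→L[ℂ] ℂ}, IsHolomorphicForm UC Ω → ∀ v : Fin 3 → C3,
      DifferentiableOn ℂ (fun z => Ω z v) UC := fun hΩ v =>
    (ContinuousAlternatingMap.apply ℂ C3 ℂ v).differentiable.comp_differentiableOn hΩ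
  intro z hz
  refine ContinuousAlternatingMap.toAlternatingMap_injective ?_
  -- The complex basis of `ℂ³` consists of real vectors, so at real points the coefficients of both
  -- forms are fixed by their restriction to `U`. Holomorphy then determines them on all of `UC`.
  refine (Pi.basisFun ℂ (Fin 3)).ext_alternating fun v _ => ?_
  refine hid (fun z => Ω' z _) (fun z => Ω z _) (hdiff h'.holomorphic _) (hdiff h.holomorphic _)
    (fun x hx => ?_) hz
  simp only [hincl]
  rw [h.restrict x hx, h'.restrict x hx]

end Conclusion

end LocalSLag

end

theorem mainTheorem1 (U : Set LocalSLag.R3) (hU : IsOpen U) (h0 : (0 : LocalSLag.R3) ∈ U)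
    (g : LocalSLag.R3 → Matrix (Fin 3) (Fin 3) ℝ) (hg : LocalSLag.IsAnalyticMetric U g) :
    ∃ UC : Set LocalSLag.C3, LocalSLag.IsStandardComplexification U UC ∧
      ∃ Ω : LocalSLag.C3 → LocalSLag.C3 [⋀^Fin 3]→L[ℂ] ℂ,
        -- at least one `ω` exists, and `(U, g)` is special Lagrangian in the Calabi–Yau `UC`
        (∃ ω : LocalSLag.C3 → LocalSLag.C3 [⋀^Fin 2]→L[ℝ] ℝ,
          LocalSLag.Solves U g UC Ω ω ∧
          LocalSLag.IsCalabiYau UC Ω ω ∧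
          LocalSLag.IsSLagEmbedding U g UC Ω ω LocalSLag.incl) ∧
        -- uniqueness of `Ω`
        (∀ Ω' : LocalSLag.C3 → LocalSLag.C3 [⋀^Fin 3]→L[ℂ] ℂ,
          (∃ ω' : LocalSLag.C3 → LocalSLag.C3 [⋀^Fin 2]→L[ℝ] ℝ,
            LocalSLag.Solves U g UC Ω' ω') → Set.EqOn Ω' Ω UC) ∧
        -- `Ω` is the holomorphic extension of `√(det g) dx₁ ∧ dx₂ ∧ dx₃`
        (∃ Γ : LocalSLag.C3 → ℂ, DifferentiableOn ℂ Γ UC ∧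
          (∀ x ∈ U, Γ (LocalSLag.incl x) = (Real.sqrt (g x).det : ℂ)) ∧
          ∀ z ∈ UC, ∀ v : Fin 3 → LocalSLag.C3, Ω z v = Γ z * LocalSLag.dz123 v) := by
  obtain ⟨UC, Γ, k, hUC, hΓ', hgood, hreal, hid⟩ := LocalSLag.exists_potential hU hg
  have hΓ : DifferentiableOn ℂ Γ UC := fun z hz =>
    (hgood z hz).analyticAt_density.differentiableAt.differentiableWithinAt
  have hf : ∀ z ∈ UC, AnalyticAt ℝ (LocalSLag.potential (LocalSLag.metricPotential g) k) z :=
    fun z hz => LocalSLag.analyticAt_potential (hgood z hz).analyticAt_init (hgood z hz).analyticAt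
  have hsol := LocalSLag.solves_kahlerForm hg hUC hΓ hΓ' hf
    (LocalSLag.isKahlerForm_kahlerForm hf fun z hz => (hgood z hz).pos)
    (fun z hz => (hgood z hz).hermDet_eq) hreal
  refine ⟨UC, hUC, fun z => Γ z • LocalSLag.volCLM, ⟨_, hsol,
    LocalSLag.isCalabiYau_of_solves hUC.isOpen hsol fun z hz =>
      LocalSLag.smul_volCLM_ne_zero (hgood z hz).density_ne_zero,
    LocalSLag.isSLagEmbedding_incl hUC hsol fun x hx u v => ?_⟩, fun Ω' hΩ' => ?_,
    Γ, hΓ, hΓ', fun z _ v => rfl⟩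
  · have hs := LocalSLag.isSymm_of_posDef (hg.posDef x hx)
    have h := hf _ (hUC.incl_mem x hx)
    exact LocalSLag.form_incl_incl (LocalSLag.kahlerForm_type h) hs
      (by rw [LocalSLag.hermMatrix_kahlerForm h, hreal x hx, LocalSLag.hermOf_metricEntries hs]) u v
  · obtain ⟨ω', hω'⟩ := hΩ'
    exact hsol.eqOn hω' hid
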